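/- Let $\mathcal A,\mathcal B$ be finite alphabets, let $\sigma\colon\mathcal B^*\to\mathcal B^*$ be a primitive substitution (for some $k\ge 1$, every letter of $\mathcal B$ occurs in $\sigma^k(b)$ for every $b\in\mathcal B$), let $\tau\colon\mathcal B^*\to\mathcal A^*$ be a letter-to-letter substitution, and let $X\subseteq\mathcal A^{\mathbb Z}$ be the shift space generated by $(\sigma,\tau)$: for some letter $b\in\mathcal B$ the words $\sigma^n(b)$ converge to a right-infinite word $y\in\mathcal B^{\mathbb N}$, and $X$ is the set of all $z\in\mathcal A^{\mathbb Z}$ all of whose finite factors are factors of $\tau(y)$. (Such an $X$ is minimal.) Let $\mathcal L(X)$ be the set of finite words occurring in elements of $X$ and, for $u\in\mathcal L(X)$, let $$\mathcal R_X(u)=\{r\in\mathcal A^+ : ru\in\mathcal L(X)\cap(u\mathcal A^*\setminus\mathcal A^+u\mathcal A^+)\}$$ be the set of return words to $u$, and $\langle\mathcal R_X(u)\rangle$ the subgroup it generates in the free group $F_{\mathcal A}$. Let $\varphi\colon F_{\mathcal A}\to G$ be a morphism onto a finite group $G$. Proposition 4.4. There are algorithms which, given $\sigma$, $\tau$, the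 multiplication table of $G$, and the images under $\varphi$ of the letters of $\mathcal A$ (letters and elements of $G$ being represented by natural numbers), do the following. 1. Compute (the list of elements of) a subgroup $H\le G$ over which the images under $\varphi$ of the return groups stabilize; that is, for some $M\in\mathbb N$: (a) $\varphi\langle\mathcal R_X(u)\rangle=\varphi\langle\mathcal R_X(w)\rangle$ for all $w\in\mathcal L(X)$ of length $M$ and all $u\in\mathcal L(X)$ having $w$ as a prefix; (b) $\varphi\langle\mathcal R_X(u)\rangle$ is conjugate to $H$ in $G$ for all $u\in\mathcal L(X)$ of length at least $M$; and (c) $\varphi\langle\mathcal R_X(u)\rangle=H$ for some $u\in\mathcal L(X)$ of length at least $M$. 2. Decide whether $X$ has $\varphi$-stable return groups, that is, whether $\varphi\langle\mathcal R_X(u)\rangle=\varphi\langle\mathcal R_X(\varepsilon)\rangle$ for all $u\in\mathcal L(X)$, where $\varepsilon$ is the empty word. -/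

import Mathlib

namespace ReturnGroups

/-! ### Words, languages, shift spaces

Finite words over `A` are lists; the empty word is `[]`. -/

/-- The factor of length `n` starting at position `i` of a right-infinite word. -/
def factorNat {A : Type*} (x : ℕ → A) (i n : ℕ) : List A :=
  (List.range n).map fun k : ℕ => x (i + k)

/-- The factor of length `n` starting at position `i` of a two-sided infinite word. -/
def factorInt {A : Type*} (z : ℤ → A) (i : ℤ) (n : ℕ) : List A :=
  (List.range n).map fun k : ℕ => z (i + (k : ℤ))

/-- The language of a right-infinite word: all finite words appearing in it. -/
def langNat {A : Type*} (x : ℕ → A) : Set (List A) :=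
  {u | ∃ i n, u = factorNat x i n}

/-- The language of a two-sided infinite word. -/
def langInt {A : Type*} (z : ℤ → A) : Set (List A) :=
  {u | ∃ i n, u = factorInt z i n}

/-- The language of a set of two-sided infinite words. -/
def lang {A : Type*} (X : Set (ℤ → A)) : Set (List A) :=
  ⋃ z ∈ X, langInt z

/-! ### Substitutions

A substitution of the free monoid over `B` is given by the images `σ b` of the letters. -/

/-- The action of a substitution on finite words: the monoid morphism extending `σ`. -/
def applySubst {B : Type*} (σ : B → List B) (w : List B) : List B :=
  w.flatMap σ

/-- `σ` is primitive: for some `k ≥ 1`, each letter occurs in `σ ^ k` of each letter. -/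
def IsPrimitive {B : Type*} (σ : B → List B) : Prop :=
  ∃ k : ℕ, 0 < k ∧ ∀ a b : B, a ∈ (applySubst σ)^[k] [b]

/-- The finite words `σ ^ n (b)` converge, as `n → ∞`, to the right-infinite word `y`:
each prefix of `y` is a prefix of `σ ^ n (b)` for all large `n`. -/
def ConvergesTo {B : Type*} (σ : B → List B) (b : B) (y : ℕ → B) : Prop :=
  ∀ k : ℕ, ∃ N : ℕ, ∀ n ≥ N, factorNat y 0 k <+: (applySubst σ)^[n] [b]

/-- `X` is the substitutive shift space generated by `(σ, τ)`, with `τ` letter-to-letter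
(hence given by a map on letters): for some letter `b` the words `σ ^ n (b)` converge to a
right-infinite word `y`, and `X` consists of the two-sided infinite words whose factors
all appear in `τ (y)`. -/
def IsGeneratedBy {A B : Type*} (X : Set (ℤ → A)) (σ : B → List B) (τ : B → A) : Prop :=
  ∃ (b : B) (y : ℕ → B), ConvergesTo σ b y ∧ X = {z | langInt z ⊆ langNat (τ ∘ y)}

/-! ### Return words, return groups, stability -/

/-- The set of return words to `u` in `X`: the non-empty words `r` such that `ru` is in the
language of `X`, starts with `u`, and is not of the form `p u s` with `p`, `s` non-empty. -/
def returnWords {A : Type*} (X : Set (ℤ → A)) (u : List A) : Set (List A) :=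
  {r | r ≠ [] ∧ r ++ u ∈ lang X ∧ u <+: r ++ u ∧
    ¬ ∃ p s : List A, p ≠ [] ∧ s ≠ [] ∧ r ++ u = p ++ u ++ s}

/-- A finite word seen as an element of the free group. -/
def toFreeGroup {A : Type*} (u : List A) : FreeGroup A :=
  (u.map FreeGroup.of).prod

/-- The return group to `u` in `X`. -/
def returnGroup {A : Type*} (X : Set (ℤ → A)) (u : List A) : Subgroup (FreeGroup A) :=
  Subgroup.closure (toFreeGroup '' returnWords X u)

/-- The defining condition of eventual `φ`-stability, for a given `M`: for all `w` of length
`M` in the language of `X` and all `u` in the language having `w` as a prefix, the return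
groups to `u` and to `w` have the same image under `φ`. -/
def StableFrom {A G : Type*} [Group G] (φ : FreeGroup A →* G) (X : Set (ℤ → A))
    (M : ℕ) : Prop :=
  ∀ w ∈ lang X, w.length = M → ∀ u ∈ lang X, w <+: u →
    (returnGroup X u).map φ = (returnGroup X w).map φ

/-- `X` has `φ`-stable return groups. -/
def HasStableReturnGroups {A G : Type*} [Group G] (φ : FreeGroup A →* G)
    (X : Set (ℤ → A)) : Prop :=
  StableFrom φ X 0

/-- The images under `φ` of the return groups stabilize over `H` (up to conjugacy): for some
`M`, the condition of eventual stability holds for `M`, the image of the return group to each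
word of length at least `M` is a conjugate of `H`, and `H` itself is one of these images. -/
def StabilizesOver {A G : Type*} [Group G] (φ : FreeGroup A →* G) (X : Set (ℤ → A))
    (H : Subgroup G) : Prop :=
  ∃ M : ℕ, StableFrom φ X M ∧
    (∀ u ∈ lang X, M ≤ u.length →
      ∃ g : G, (returnGroup X u).map φ = H.map (MulAut.conj g).toMonoidHom) ∧
    ∃ u ∈ lang X, M ≤ u.length ∧ (returnGroup X u).map φ = H

/-! ### Inputs of algorithms -/

/-- Finite data describing `(σ, τ, G, φ)`: the images of the letters of `B` under `σ`, their
images under `τ`, the multiplication table of `G`, and the images under `φ` of the letters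
of `A`. Letters and group elements are represented by natural numbers. -/
abbrev Code : Type :=
  List (List ℕ) × List ℕ × List (List ℕ) × List ℕ

/-- The code of `(σ, τ, G, φ)` with respect to numberings of the finite sets `A`, `B`
and `G`. -/
def encodeInput {A B G : Type*} [Group G] {m n N : ℕ}
    (eA : A ≃ Fin m) (eB : B ≃ Fin n) (eG : G ≃ Fin N)
    (σ : B → List B) (τ : B → A) (φ : FreeGroup A →* G) : Code :=
  (List.ofFn fun i : Fin n => (σ (eB.symm i)).map fun b => (eB b : ℕ),
   List.ofFn fun i : Fin n => (eA (τ (eB.symm i)) : ℕ),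
   List.ofFn fun i : Fin N => List.ofFn fun j : Fin N => (eG (eG.symm i * eG.symm j) : ℕ),
   List.ofFn fun i : Fin m => (eG (φ (FreeGroup.of (eA.symm i))) : ℕ))

end ReturnGroups

namespace ReturnGroups

/-! ### Decomposition of a word at the occurrences of another word -/

/-! Write I(u) for the image in G of the return group to u. Lengthening u to p u s shrinks I(u), up
to conjugation by the value of p (`retImage_le_comap`). By uniform recurrence the images therefore
stabilize over any I(w) of minimal order (`stabilizes_of_card_minimal`), and stability means that
this minimal image contains the values of all letters that occur (`stable_iff_of_card_minimal`). The
task is thus to find a word w together with a finitely checkable proof that I(w) is minimal and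
equal to a given list K.

Such a proof is a certificate with two halves. Upper bound (`UpperCert`): if s contains all
two-letter words of the language of σ, and w occurs in every τ(σ^N(b)), then all return words to w
are visible in τ(σ^N(s)), so a multiplicatively closed list K containing their values contains I(w).
Lower bound: if K is also contained in I(u) for arbitrarily long u, then I(w) = K is minimal
(`retImage_eq_of_le`). In the aperiodic case this is witnessed by writing the sequence as the image
under Θ of a fixed point of ρ, where all ρ(d) start with the same letter z, and Θρ and Θ have the
same values in G. Then Θ(ρ^(k+1)(d)) is a product of return words to Θ(ρ^k(z)) and has the value of
Θ(d), for every k (`exists_mem_retImage_of_presentation`). In the periodic case a word as long as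
the period is a return to arbitrarily long words (`exists_mem_retImage_of_periodic`).

Certificates exist (`exists_cert`). In the aperiodic case let w_t = τ(σ^(pt)(c₀)). Bounds on lengths
of iterates, of linear recurrence type, bound the number of return words to w_t and the size of
their coding independently of t, so the pigeonhole principle yields t < t' with equal codings and
equal values in G (`FirstReturn.exists_codeAt_eq`). Decomposing the return words to w_t' into return
words to w_t defines ρ (`FirstReturn.exists_presentationCert`).

Validity of a certificate is a primitive recursive condition, so unbounded search finds a valid one,
and whichever is found gives the right answer (`encodeInput_spec`). -/

/-- The decomposition of `v` into blocks, cutting at the occurrences of `w` in `v ++ w`. -/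
def dec {α : Type*} [DecidableEq α] (w : List α) : List α → List (List α)
  | [] => []
  | a :: v =>
    if w <+: v ++ w then [a] :: dec w v
    else match dec w v with
      | [] => [[a]]
      | b :: bs => (a :: b) :: bs

section Dec

set_option linter.unusedSectionVars false

variable {α : Type*} [DecidableEq α] {w : List α}

theorem dec_flatten (w v : List α) : (dec w v).flatten = v := by
  induction v with
  | nil => rfl
  | cons a v ih =>
    unfold dec
    split_ifs
    · simp [ih]
    · split
      · rename_i h; rw [h] at ih; simp at ih; simp [← ih]
      · rename_i h; rw [h] at ih; simpa using ih

theorem dec_ne_nil {v : List α} (hv : v ≠ []) : dec w v ≠ [] := by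
  intro h
  have := dec_flatten w v
  rw [h] at this
  exact hv this.symm

theorem ne_nil_of_mem_dec {v r : List α} (h : r ∈ dec w v) : r ≠ [] := by
  induction v generalizing r with
  | nil => simp [dec] at h
  | cons a v ih =>
    unfold dec at h
    split_ifs at h
    · rcases List.mem_cons.1 h with h | h
      · simp [h]
      · exact ih h
    · split at h
      · simp at h; simp [h]
      · rename_i hd
        rcases List.mem_cons.1 h with h | h
        · simp [h]
        · exact ih (by rw [hd]; exact List.mem_cons_of_mem _ h)

/-- If `w` occurs at the start of `v ++ w`, then `u ++ w` and `u ++ v ++ w` agree as far as an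
occurrence of `w` at the start can reach. This makes cutting at occurrences a local operation. -/
theorem prefix_append_iff {u v : List α} (h : w <+: v ++ w) :
    w <+: u ++ v ++ w ↔ w <+: u ++ w := by
  have huv : u ++ w <+: u ++ v ++ w := by
    rw [List.append_assoc]
    exact (List.prefix_append_right_inj u).2 h
  constructor
  · intro h'
    exact List.prefix_of_prefix_length_le h' huv (by simp)
  · intro h'
    exact h'.trans huv

/-- The hypothesis puts a cut at the boundary, and by `prefix_append_iff` the cuts inside `u` do not
depend on `v`. -/
theorem dec_append (u : List α) {v : List α} (h : w <+: v ++ w) :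
    dec w (u ++ v) = dec w u ++ dec w v := by
  induction u with
  | nil => simp [dec]
  | cons a u ih =>
    rw [List.cons_append, dec, dec]
    by_cases h' : w <+: u ++ w
    · rw [if_pos h', if_pos ((prefix_append_iff h).2 h'), ih, List.cons_append]
    · rw [if_neg h', if_neg (fun h'' => h' ((prefix_append_iff h).1 h'')), ih]
      rcases hd : dec w u with _ | ⟨b, bs⟩
      -- An empty decomposition means that `u` is empty, but then `w` does occur at its end, against
      -- `h'`.
      · have := dec_flatten w u
        rw [hd] at this
        simp at this
        subst this
        simp at h'
      · simp

theorem prefix_flatten {rs : List (List α)} (h : ∀ r ∈ rs, w <+: r ++ w) :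
    w <+: rs.flatten ++ w := by
  induction rs with
  | nil => simp
  | cons r rs ih =>
    rw [List.flatten_cons]
    exact (prefix_append_iff (ih fun r hr => h r (List.mem_cons_of_mem _ hr))).2
      (h r List.mem_cons_self)

/-- Every block except the first begins at a cut, hence at an occurrence of `w`; the first does so
only if `w` is a prefix of `v ++ w`. -/
theorem prefix_of_mem_tail_dec {v : List α} : ∀ r ∈ (dec w v).tail, w <+: r ++ w := by
  induction v with
  | nil => simp [dec]
  | cons a v ih =>
    unfold dec
    split_ifs with hw
    · intro r hr
      rw [List.tail_cons] at hr
      have hfl := dec_flatten w v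
      rcases hd : dec w v with _ | ⟨x, xs⟩
      · rw [hd] at hr; simp at hr
      · rw [hd] at hr ih hfl
        rcases List.mem_cons.1 hr with rfl | hr
        · rw [List.flatten_cons] at hfl
          rw [← hfl] at hw
          exact (prefix_append_iff (prefix_flatten ih)).1 hw
        · exact ih r hr
    · rcases hd : dec w v with _ | ⟨x, xs⟩
      · simp
      · simpa [hd] using ih

theorem prefix_of_mem_dec {v r : List α} (hv : w <+: v ++ w) (h : r ∈ dec w v) :
    w <+: r ++ w := by
  have ih := prefix_of_mem_tail_dec (w := w) (v := v)
  have hfl := dec_flatten w v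
  rcases hd : dec w v with _ | ⟨x, xs⟩
  · rw [hd] at h; simp at h
  · rw [hd] at h ih hfl
    rcases List.mem_cons.1 h with rfl | hr
    · rw [List.flatten_cons] at hfl
      rw [← hfl] at hv
      exact (prefix_append_iff (prefix_flatten ih)).1 hv
    · exact ih r hr

theorem dec_flatten_of_prefix {rs : List (List α)} (h : ∀ r ∈ rs, w <+: r ++ w) :
    dec w rs.flatten = rs.flatMap (dec w) := by
  induction rs with
  | nil => simp [dec]
  | cons r rs ih =>
    have h' : ∀ r ∈ rs, w <+: r ++ w := fun r hr => h r (List.mem_cons_of_mem _ hr)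
    rw [List.flatten_cons, dec_append _ (prefix_flatten h'), ih h', List.flatMap_cons]

theorem dec_flatMap {β : Type*} {f : β → List α} {z : List β}
    (h : ∀ b ∈ z, w <+: f b ++ w) : dec w (z.flatMap f) = z.flatMap fun b => dec w (f b) := by
  rw [List.flatMap_def, dec_flatten_of_prefix, List.flatMap_map]
  simpa using h

theorem length_eq_one_of_flatMap {β γ : Type*} {f : β → List γ} {z : List β}
    (h : ∀ b ∈ z, f b ≠ []) (hz : (z.flatMap f).length ≤ z.length) :
    ∀ b ∈ z, (f b).length = 1 := by
  have hle : ∀ z : List β, (∀ b ∈ z, f b ≠ []) → z.length ≤ (z.flatMap f).length := by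
    intro z hz
    induction z with
    | nil => simp
    | cons b z ih =>
      have h1 := List.length_pos_iff.2 (hz b List.mem_cons_self)
      have h2 := ih fun b hb => hz b (List.mem_cons_of_mem _ hb)
      simp only [List.flatMap_cons, List.length_append, List.length_cons]
      omega
  induction z with
  | nil => simp
  | cons b z ih =>
    have h1 := List.length_pos_iff.2 (h b List.mem_cons_self)
    have h2 := hle z fun b hb => h b (List.mem_cons_of_mem _ hb)
    simp only [List.flatMap_cons, List.length_append, List.length_cons] at hz
    intro c hc
    rcases List.mem_cons.1 hc with rfl | hc
    · omega
    · exact ih (fun b hb => h b (List.mem_cons_of_mem _ hb)) (by omega) c hc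

/-- Cutting all the blocks again reproduces the same decomposition. Each block contributes at least
one piece and the number of pieces is unchanged, so each block stays whole: blocks are first
returns. -/
theorem dec_eq_singleton {v r : List α} (hv : w <+: v ++ w) (h : r ∈ dec w v) :
    dec w r = [r] := by
  have h1 := dec_flatten_of_prefix (w := w) (rs := dec w v) fun r hr => prefix_of_mem_dec hv hr
  rw [dec_flatten] at h1
  have h2 := length_eq_one_of_flatMap (f := dec w) (z := dec w v)
    (fun r hr => dec_ne_nil (ne_nil_of_mem_dec hr)) (by rw [← h1]) r h
  obtain ⟨x, hx⟩ := List.length_eq_one_iff.1 h2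
  have := dec_flatten w r
  rw [hx] at this ⊢
  simpa using this

end Dec

/-- A factor of the concatenation of the words `f b`, `b ∈ z`, is a factor of the concatenation of
at most two consecutive ones, or properly contains one of them. -/
theorem infix_flatMap {α β : Type*} {f : β → List α} {T : List α} (z : List β)
    (hT : T <:+: z.flatMap f) :
    (∃ y, y <:+: z ∧ y.length ≤ 2 ∧ T <:+: y.flatMap f) ∨
      ∃ b ∈ z, ∃ p q, p ≠ [] ∧ q ≠ [] ∧ T = p ++ f b ++ q := by
  induction hn : z.length using Nat.strong_induction_on generalizing z with
  | _ n ih =>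
  by_cases h2 : z.length ≤ 2
  · exact Or.inl ⟨z, List.infix_rfl, h2, hT⟩
  obtain ⟨a, z, rfl⟩ := List.exists_cons_of_length_pos (l := z) (by omega)
  obtain ⟨y, c, rfl⟩ : ∃ y c, z = y ++ [c] := by
    rcases List.eq_nil_or_concat z with rfl | ⟨y, c, rfl⟩
    · simp at h2
    · exact ⟨y, c, by simp⟩
  obtain ⟨b, y, rfl⟩ := List.exists_cons_of_length_pos (l := y) (by
    simp only [List.length_cons, List.length_append, List.length_nil] at h2; omega)
  have hr : T <:+: (b :: y ++ [c]).flatMap f → _ := fun h =>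
    ih _ (by rw [← hn]; simp) (b :: y ++ [c]) h rfl
  have hl : T <:+: (a :: b :: y).flatMap f → _ := fun h =>
    ih _ (by rw [← hn]; simp) (a :: b :: y) h rfl
  have hr' : T <:+: (b :: y ++ [c]).flatMap f →
      (∃ y', y' <:+: a :: (b :: y ++ [c]) ∧ y'.length ≤ 2 ∧ T <:+: y'.flatMap f) ∨
      ∃ b' ∈ a :: (b :: y ++ [c]), ∃ p q, p ≠ [] ∧ q ≠ [] ∧ T = p ++ f b' ++ q := by
    intro h
    rcases hr h with ⟨y', h1, h2⟩ | ⟨b', h1, h2⟩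
    · exact Or.inl ⟨y', h1.trans (List.suffix_cons _ _).isInfix, h2⟩
    · exact Or.inr ⟨b', List.mem_cons_of_mem _ h1, h2⟩
  have hl' : T <:+: (a :: b :: y).flatMap f →
      (∃ y', y' <:+: a :: (b :: y ++ [c]) ∧ y'.length ≤ 2 ∧ T <:+: y'.flatMap f) ∨
      ∃ b' ∈ a :: (b :: y ++ [c]), ∃ p q, p ≠ [] ∧ q ≠ [] ∧ T = p ++ f b' ++ q := by
    intro h
    rcases hl h with ⟨y', h1, h2⟩ | ⟨b', h1, h2⟩
    · exact Or.inl ⟨y', h1.trans (List.prefix_append (a :: b :: y) [c]).isInfix, h2⟩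
    · exact Or.inr ⟨b', by simp at h1 ⊢; tauto, h2⟩
  -- With the long word written as `a :: (b :: y ++ [c])`, either `T` misses `f a` or `f c`, and
  -- that letter can be dropped, or `T` overlaps both in nonempty words `p` and `q` and so covers
  -- the whole middle, in particular `f b`.
  obtain ⟨s, t, hst⟩ := hT
  have e : s ++ (T ++ t) = f a ++ ((b :: y).flatMap f ++ f c) := by
    rw [← List.append_assoc, hst]; simp
  rcases List.append_eq_append_iff.1 e with ⟨p, hp, h⟩ | ⟨p, hp, h⟩
  swap
  · exact hr' ⟨p, t, by rw [List.append_assoc, ← h]; simp⟩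
  rcases eq_or_ne p [] with rfl | hp0
  · exact hr' ⟨[], t, by simp at h; simp [h]⟩
  have e' : (p ++ (b :: y).flatMap f) ++ f c = T ++ t := by rw [h, List.append_assoc]
  rcases List.append_eq_append_iff.1 e' with ⟨q, hq, h'⟩ | ⟨q, hq, h'⟩
  swap
  · exact hl' ⟨s, q, by rw [List.append_assoc, ← hq, ← List.append_assoc, ← hp]; simp⟩
  rcases eq_or_ne q [] with rfl | hq0
  · refine hl' ⟨s, [], ?_⟩
    rw [hq, List.append_nil, List.append_nil, ← List.append_assoc, ← hp]; simp
  · exact Or.inr ⟨b, by simp, p, y.flatMap f ++ q, hp0, by simp [hq0], by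
      rw [hq]; simp⟩

/-! ### Images of return groups in a uniformly recurrent language -/

/-- The value of a word under the monoid morphism extending `g`. -/
def val {α G : Type*} [Monoid G] (g : α → G) (r : List α) : G :=
  (r.map g).prod

@[simp]
theorem val_nil {α G : Type*} [Monoid G] (g : α → G) : val g [] = 1 := rfl

@[simp]
theorem val_append {α G : Type*} [Monoid G] (g : α → G) (u v : List α) :
    val g (u ++ v) = val g u * val g v := by
  simp [val]

theorem val_flatMap {α β G : Type*} [Monoid G] (g : α → G) (f : β → List α) (z : List β) :
    val g (z.flatMap f) = val (fun b => val g (f b)) z := by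
  induction z with
  | nil => rfl
  | cons b z ih => rw [List.flatMap_cons, val_append, ih]; simp [val]

theorem val_mem {α G : Type*} [Group G] {g : α → G} {K : Subgroup G} {z : List α}
    (h : ∀ a ∈ z, g a ∈ K) : val g z ∈ K :=
  K.list_prod_mem fun x hx => by
    obtain ⟨a, ha, rfl⟩ := List.mem_map.1 hx
    exact h a ha

/-- The set of return words to `u` in the language `L`. -/
def ret {α : Type*} (L : Set (List α)) (u : List α) : Set (List α) :=
  {r | r ≠ [] ∧ r ++ u ∈ L ∧ u <+: r ++ u ∧
    ¬ ∃ p s : List α, p ≠ [] ∧ s ≠ [] ∧ r ++ u = p ++ u ++ s}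

/-- The subgroup generated by the values of the return words to `u`. -/
def retImage {α G : Type*} [Group G] (g : α → G) (L : Set (List α)) (u : List α) :
    Subgroup G :=
  Subgroup.closure (val g '' ret L u)

/-- Factorial, uniformly recurrent and right-extendable languages. -/
structure IsRecurrentLang {α : Type*} (L : Set (List α)) : Prop where
  infix_mem : ∀ {u v : List α}, v ∈ L → u <:+: v → u ∈ L
  recurrent : ∀ u ∈ L, ∃ M : ℕ, ∀ v ∈ L, M ≤ v.length → u <:+: v
  extend : ∀ u ∈ L, ∃ a, u ++ [a] ∈ L

section

variable {α G : Type*} [Group G] {g : α → G} {L : Set (List α)}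

theorem IsRecurrentLang.exists_append (hL : IsRecurrentLang L) {u : List α} (hu : u ∈ L)
    (n : ℕ) : ∃ t : List α, t.length = n ∧ u ++ t ∈ L := by
  induction n with
  | zero => exact ⟨[], rfl, by simpa⟩
  | succ n ih =>
    obtain ⟨t, ht, h⟩ := ih
    obtain ⟨a, ha⟩ := hL.extend _ h
    exact ⟨t ++ [a], by simp [ht], by simpa using ha⟩

/-- A return that is not a first return is split by an inner occurrence of `u` into two shorter
returns. -/
theorem val_mem_retImage (hL : IsRecurrentLang L) {u r : List α} (hr : r ++ u ∈ L)
    (hu : u <+: r ++ u) : val g r ∈ retImage g L u := by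
  induction hn : r.length using Nat.strong_induction_on generalizing r with
  | _ n ih =>
  rcases eq_or_ne r [] with rfl | h0
  · exact one_mem _
  by_cases h : ∃ p s : List α, p ≠ [] ∧ s ≠ [] ∧ r ++ u = p ++ u ++ s
  swap
  · exact Subgroup.subset_closure ⟨r, ⟨h0, hr, hu, h⟩, rfl⟩
  obtain ⟨p, s, hp, hs, e⟩ := h
  have hlen := congrArg List.length e
  simp only [List.length_append] at hlen
  have hp' := List.length_pos_iff.2 hp
  have hs' := List.length_pos_iff.2 hs
  have hpr : p <+: r := by
    refine List.prefix_of_prefix_length_le (l₃ := r ++ u) ?_ (List.prefix_append _ _) (by omega)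
    rw [e, List.append_assoc]; exact List.prefix_append _ _
  obtain ⟨q, rfl⟩ := hpr
  simp only [List.length_append] at hlen hn
  have e' : q ++ u = u ++ s := by simpa using e
  rw [val_append]
  refine mul_mem (ih p.length (by omega) (hL.infix_mem hr ?_) ?_ rfl)
    (ih q.length (by omega) (hL.infix_mem hr ?_) ?_ rfl)
  · rw [e]; exact (List.prefix_append _ _).isInfix
  · refine List.prefix_of_prefix_length_le hu ?_ (by simp)
    rw [e]; exact List.prefix_append _ _
  · rw [List.append_assoc]; exact (List.suffix_append _ _).isInfix
  · rw [e']; exact List.prefix_append _ _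

/-- If `r` is a return to `p ++ u ++ s`, then `r ++ p = p ++ q` for a return `q` to `u`, so the
value of `r` is that of `q` conjugated by the value of `p`. -/
theorem retImage_le_comap (hL : IsRecurrentLang L) (p u s : List α) :
    retImage g L (p ++ u ++ s) ≤
      (retImage g L u).map (MulAut.conj (val g p)).toMonoidHom := by
  rw [retImage, Subgroup.closure_le]
  rintro _ ⟨r, ⟨-, h1, h2, -⟩, rfl⟩
  have hp : p <+: r ++ p := by
    refine List.prefix_of_prefix_length_le (l₃ := r ++ (p ++ u ++ s)) ?_ ?_ (by simp)
    · refine List.IsPrefix.trans ?_ h2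
      rw [List.append_assoc]; exact List.prefix_append _ _
    · simp
  obtain ⟨q, hq⟩ := hp
  have e : r ++ (p ++ u ++ s) = p ++ (q ++ u ++ s) := by
    simp only [← List.append_assoc]; rw [← hq]
  have hqu : u <+: q ++ u := by
    rw [e, List.append_assoc, List.prefix_append_right_inj] at h2
    refine List.prefix_of_prefix_length_le ((List.prefix_append u s).trans h2) ?_ (by simp)
    exact List.prefix_append _ _
  have hv : val g q ∈ retImage g L u := by
    refine val_mem_retImage hL (hL.infix_mem h1 ?_) hqu
    rw [e]
    exact ⟨p, s, by simp⟩
  refine ⟨val g q, hv, ?_⟩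
  have := congrArg (val g) hq
  simp only [val_append] at this
  simp [this]

theorem retImage_append_le (hL : IsRecurrentLang L) (u s : List α) :
    retImage g L (u ++ s) ≤ retImage g L u := by
  intro x hx
  obtain ⟨y, hy, rfl⟩ := retImage_le_comap (g := g) hL [] u s hx
  simpa using hy

theorem card_retImage_le [Finite G] (hL : IsRecurrentLang L) {u v : List α} (h : u <:+: v) :
    Nat.card (retImage g L v) ≤ Nat.card (retImage g L u) := by
  obtain ⟨p, s, rfl⟩ := h
  refine (Subgroup.card_le_of_le (retImage_le_comap hL p u s)).trans ?_
  rw [Subgroup.card_map_of_injective]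
  exact (MulAut.conj (val g p)).injective

/-- The images of the return groups stabilize over any one of minimal order. -/
theorem stabilizes_of_card_minimal [Finite G] (hL : IsRecurrentLang L) {w : List α}
    (hw : w ∈ L) (hmin : ∀ u ∈ L, Nat.card (retImage g L w) ≤ Nat.card (retImage g L u)) :
    ∃ M : ℕ, (∀ v ∈ L, v.length = M → ∀ u ∈ L, v <+: u → retImage g L u = retImage g L v) ∧
      (∀ u ∈ L, M ≤ u.length →
        ∃ x : G, retImage g L u = (retImage g L w).map (MulAut.conj x).toMonoidHom) ∧
      ∃ u ∈ L, M ≤ u.length ∧ retImage g L u = retImage g L w := by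
  -- Every word of length at least `M` contains `w`, so its image has at most, hence exactly, the
  -- minimal order; all inclusions up to conjugacy then become equalities.
  obtain ⟨M, hM⟩ := hL.recurrent w hw
  refine ⟨M, ?_, ?_, ?_⟩
  · rintro v hv hvM u hu ⟨s, rfl⟩
    refine Subgroup.eq_of_le_of_card_ge (retImage_append_le hL v s) ?_
    exact (card_retImage_le hL (hM v hv hvM.ge)).trans (hmin _ hu)
  · intro u hu hMu
    obtain ⟨p, s, rfl⟩ := hM u hu hMu
    refine ⟨val g p, Subgroup.eq_of_le_of_card_ge (retImage_le_comap hL p w s) ?_⟩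
    rw [Subgroup.card_map_of_injective]
    · exact hmin _ hu
    · exact (MulAut.conj (val g p)).injective
  · obtain ⟨t, ht, h⟩ := hL.exists_append hw M
    exact ⟨w ++ t, h, by simp [ht],
      Subgroup.eq_of_le_of_card_ge (retImage_append_le hL w t) (hmin _ h)⟩

/-- A subgroup that contains the image of one return group, and is contained in the images of
return groups to arbitrarily long words, is of minimal order among all these images. -/
theorem retImage_eq_of_le [Finite G] (hL : IsRecurrentLang L) {w : List α} (hw : w ∈ L)
    {K : Subgroup G} (hK : retImage g L w ≤ K)
    (h : ∀ n : ℕ, ∃ u ∈ L, n ≤ u.length ∧ K ≤ retImage g L u) :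
    retImage g L w = K ∧
      ∀ u ∈ L, Nat.card (retImage g L w) ≤ Nat.card (retImage g L u) := by
  -- A sufficiently long word `v` contains `u`, so its image has order at most that of the image at
  -- `u`, and it can be chosen to contain `K`.
  have key : ∀ u ∈ L, Nat.card K ≤ Nat.card (retImage g L u) := by
    intro u hu
    obtain ⟨M, hM⟩ := hL.recurrent u hu
    obtain ⟨v, hv, hMv, hKv⟩ := h M
    exact (Subgroup.card_le_of_le hKv).trans (card_retImage_le hL (hM v hv hMv))
  have e := Subgroup.eq_of_le_of_card_ge hK (key w hw)
  exact ⟨e, e ▸ key⟩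

theorem mem_ret_nil {r : List α} :
    r ∈ ret L [] ↔ ∃ a, r = [a] ∧ [a] ∈ L := by
  constructor
  · rintro ⟨h0, h1, -, h3⟩
    rcases r with _ | ⟨a, _ | ⟨b, r⟩⟩
    · simp at h0
    · exact ⟨a, rfl, by simpa using h1⟩
    · exact absurd ⟨[a], b :: r, by simp, by simp, by simp⟩ h3
  · rintro ⟨a, rfl, h⟩
    refine ⟨by simp, by simpa, by simp, ?_⟩
    rintro ⟨p, s, hp, hs, e⟩
    have := congrArg List.length e
    have hp' := List.length_pos_iff.2 hp
    have hs' := List.length_pos_iff.2 hs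
    simp at this
    omega

/-- Stability is the equality of the image of minimal order with that of the empty word. -/
theorem stable_iff_of_card_minimal [Finite G] (hL : IsRecurrentLang L) {w : List α}
    (hw : w ∈ L) (hmin : ∀ u ∈ L, Nat.card (retImage g L w) ≤ Nat.card (retImage g L u)) :
    (∀ u ∈ L, retImage g L u = retImage g L []) ↔ ∀ a, [a] ∈ L → g a ∈ retImage g L w := by
  have hle : ∀ u, retImage g L u ≤ retImage g L [] := fun u =>
    retImage_append_le hL [] u
  constructor
  · intro h a ha
    rw [h w hw]
    exact Subgroup.subset_closure ⟨[a], mem_ret_nil.2 ⟨a, rfl, ha⟩, by simp [val]⟩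
  · intro h u hu
    have e : retImage g L [] ≤ retImage g L w := by
      rw [retImage, Subgroup.closure_le]
      rintro _ ⟨r, hr, rfl⟩
      obtain ⟨a, rfl, ha⟩ := mem_ret_nil.1 hr
      simpa [val] using h a ha
    exact Subgroup.eq_of_le_of_card_ge (hle u)
      ((Subgroup.card_le_of_le e).trans (hmin u hu))

end

/-! ### Iterates of a substitution -/

/-- The iterates of a substitution, as maps on words. -/
def iter {β : Type*} (σ : β → List β) (m : ℕ) (z : List β) : List β :=
  (applySubst σ)^[m] z

section Iter

variable {β : Type*} {σ : β → List β}

@[simp]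
theorem iter_zero (z : List β) : iter σ 0 z = z := rfl

theorem iter_one (z : List β) : iter σ 1 z = z.flatMap σ := rfl

theorem iter_add (m j : ℕ) (z : List β) : iter σ (m + j) z = iter σ m (iter σ j z) :=
  Function.iterate_add_apply _ _ _ _

@[simp]
theorem iter_append (m : ℕ) (u v : List β) : iter σ m (u ++ v) = iter σ m u ++ iter σ m v := by
  induction m generalizing u v with
  | zero => rfl
  | succ m ih => rw [iter_add, iter_add, iter_add, ← ih, iter_one, iter_one, iter_one,
      List.flatMap_append]

@[simp]
theorem iter_nil (m : ℕ) : iter σ m [] = [] := by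
  have := congrArg List.length (iter_append (σ := σ) m [] [])
  simpa using this

theorem iter_cons (m : ℕ) (b : β) (v : List β) : iter σ m (b :: v) = iter σ m [b] ++ iter σ m v :=
  iter_append m [b] v

theorem iter_eq_flatMap (m : ℕ) (z : List β) : iter σ m z = z.flatMap fun b => iter σ m [b] := by
  induction z with
  | nil => simp
  | cons b z ih => rw [iter_cons, ih, List.flatMap_cons]

theorem iter_infix (m : ℕ) {u v : List β} (h : u <:+: v) : iter σ m u <:+: iter σ m v := by
  obtain ⟨s, t, rfl⟩ := h
  exact ⟨iter σ m s, iter σ m t, by simp⟩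

theorem iter_prefix (m : ℕ) {u v : List β} (h : u <+: v) : iter σ m u <+: iter σ m v := by
  obtain ⟨t, rfl⟩ := h
  exact ⟨iter σ m t, by simp⟩

theorem iter_infix_of_mem (m : ℕ) {b : β} {v : List β} (h : b ∈ v) :
    iter σ m [b] <:+: iter σ m v :=
  iter_infix m ((List.singleton_infix_iff b v).2 h)

end Iter

/-- Primitive substitutions on the letters `0, …, n - 1`, with a letter `c` whose image properly
starts with `c`. -/
structure IsPrimSubst (n : ℕ) (σ : ℕ → List ℕ) : Prop where
  lt : ∀ b < n, ∀ a ∈ σ b, a < n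
  primitive : ∃ k, ∀ a < n, ∀ b < n, a ∈ iter σ k [b]
  start : ∃ c < n, ∃ t ≠ [], σ c = c :: t

/-- The language of a substitution on the letters `0, …, n - 1`. -/
def langSub (n : ℕ) (σ : ℕ → List ℕ) : Set (List ℕ) :=
  {u | ∃ m, ∃ b < n, u <:+: iter σ m [b]}

namespace IsPrimSubst

variable {n : ℕ} {σ : ℕ → List ℕ}

theorem iter_lt (hσ : IsPrimSubst n σ) {z : List ℕ} (hz : ∀ a ∈ z, a < n) (m : ℕ) :
    ∀ a ∈ iter σ m z, a < n := by
  induction m with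
  | zero => exact hz
  | succ m ih =>
    intro a ha
    rw [add_comm, iter_add, iter_one, List.mem_flatMap] at ha
    obtain ⟨b, hb, ha⟩ := ha
    exact hσ.lt b (ih b hb) a ha

theorem apply_ne_nil (hσ : IsPrimSubst n σ) {b : ℕ} (hb : b < n) : σ b ≠ [] := by
  intro h
  obtain ⟨c, hc, t, ht, hct⟩ := hσ.start
  obtain ⟨k, hk⟩ := hσ.primitive
  rcases k with _ | k
  -- The exponent in `primitive` may be zero; then `b` must be the letter `c`, whose image is
  -- nonempty.
  · have h1 := hk b hb c hc
    simp only [iter_zero, List.mem_singleton] at h1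
    rw [← h1, h] at hct
    simp at hct
  · have h1 := hk b hb b hb
    rw [iter_add, iter_one, List.flatMap_singleton, h, iter_nil] at h1
    simp at h1

theorem iter_ne_nil (hσ : IsPrimSubst n σ) {z : List ℕ} (hz : ∀ a ∈ z, a < n) (h0 : z ≠ [])
    (m : ℕ) : iter σ m z ≠ [] := by
  induction m with
  | zero => exact h0
  | succ m ih =>
    rw [add_comm, iter_add, iter_one]
    obtain ⟨b, y, hy⟩ := List.exists_cons_of_ne_nil ih
    rw [hy, List.flatMap_cons]
    have := hσ.apply_ne_nil (hσ.iter_lt hz m b (by rw [hy]; simp))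
    simp [this]

theorem iter_singleton_ne_nil (hσ : IsPrimSubst n σ) {b : ℕ} (hb : b < n) (m : ℕ) :
    iter σ m [b] ≠ [] :=
  hσ.iter_ne_nil (by simpa) (by simp) m

/-- Since no letter is erased, σ^j(b) contains some letter, and applying σ^k to that letter already
yields all letters. -/
theorem exists_mem_iter (hσ : IsPrimSubst n σ) :
    ∃ k, ∀ m ≥ k, ∀ a < n, ∀ b < n, a ∈ iter σ m [b] := by
  obtain ⟨k, hk⟩ := hσ.primitive
  refine ⟨k, fun m hm a ha b hb => ?_⟩
  obtain ⟨j, rfl⟩ := Nat.exists_eq_add_of_le hm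
  obtain ⟨c, y, hy⟩ := List.exists_cons_of_ne_nil (hσ.iter_singleton_ne_nil hb j)
  have hc := hσ.iter_lt (z := [b]) (by simpa) j c (by rw [hy]; simp)
  rw [iter_add, hy, iter_cons]
  exact List.mem_append_left _ (hk a ha c hc)

theorem lt_of_mem (hσ : IsPrimSubst n σ) {u : List ℕ} (hu : u ∈ langSub n σ) :
    ∀ a ∈ u, a < n := by
  obtain ⟨m, b, hb, h⟩ := hu
  exact fun a ha => hσ.iter_lt (z := [b]) (by simpa) m a (h.subset ha)

theorem exists_infix_iter (hσ : IsPrimSubst n σ) {u : List ℕ} (hu : u ∈ langSub n σ) :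
    ∃ i, ∀ m ≥ i, ∀ b < n, u <:+: iter σ m [b] := by
  obtain ⟨j, c, hc, h⟩ := hu
  obtain ⟨k, hk⟩ := hσ.exists_mem_iter
  refine ⟨j + k, fun m hm b hb => ?_⟩
  obtain ⟨l, rfl⟩ := Nat.exists_eq_add_of_le (Nat.le_of_add_right_le hm)
  rw [iter_add]
  exact h.trans (iter_infix_of_mem j (hk l (by omega) c hc b hb))

/-- The iterates of the starting letter `c` grow by at least one letter at each step, and `c` occurs
in σ^k of every letter. -/
theorem exists_le_length (hσ : IsPrimSubst n σ) (l : ℕ) :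
    ∃ i, ∀ m ≥ i, ∀ b < n, l ≤ (iter σ m [b]).length := by
  obtain ⟨c, hc, t, ht, hct⟩ := hσ.start
  obtain ⟨k, hk⟩ := hσ.exists_mem_iter
  have htn : ∀ a ∈ t, a < n := fun a ha => hσ.lt c hc a (by rw [hct]; simp [ha])
  have hlen : ∀ m, m ≤ (iter σ m [c]).length := by
    intro m
    induction m with
    | zero => simp
    | succ m ih =>
      rw [iter_add, iter_one, List.flatMap_singleton, hct, iter_cons, List.length_append]
      have := List.length_pos_iff.2 (hσ.iter_ne_nil htn ht m)
      omega
  refine ⟨l + k, fun m hm b hb => ?_⟩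
  obtain ⟨j, rfl⟩ := Nat.exists_eq_add_of_le (Nat.le_of_add_left_le hm)
  rw [add_comm, iter_add]
  have := (iter_infix_of_mem (σ := σ) j (hk k le_rfl c hc b hb)).length_le
  have := hlen j
  omega

theorem exists_length_le (hσ : IsPrimSubst n σ) :
    ∃ S, 0 < S ∧ ∀ m, ∀ z : List ℕ, (∀ a ∈ z, a < n) →
      (iter σ m z).length ≤ S ^ m * z.length := by
  obtain ⟨S, hS⟩ : ∃ S, ∀ b < n, (σ b).length ≤ S :=
    ⟨(Finset.range n).sup fun b => (σ b).length, fun b hb =>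
      Finset.le_sup (f := fun b => (σ b).length) (Finset.mem_range.2 hb)⟩
  refine ⟨S + 1, by omega, fun m => ?_⟩
  have h1 : ∀ z : List ℕ, (∀ a ∈ z, a < n) → (z.flatMap σ).length ≤ (S + 1) * z.length := by
    intro z hz
    induction z with
    | nil => simp
    | cons b z ih =>
      have h1 := hS b (hz b (by simp))
      have h2 := ih fun a ha => hz a (by simp [ha])
      rw [List.flatMap_cons, List.length_append, List.length_cons, mul_add]
      omega
  induction m with
  | zero => simp
  | succ m ih =>
    intro z hz
    have h2 := h1 _ (hσ.iter_lt hz m)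
    rw [add_comm m 1, iter_add, iter_one]
    calc _ ≤ _ := h2
      _ ≤ (S + 1) * ((S + 1) ^ m * z.length) := Nat.mul_le_mul_left _ (ih z hz)
      _ = _ := by ring

/-- The lengths of the images of all words of a given length under the iterates of a primitive
substitution have the same order of magnitude. -/
theorem exists_length_ratio (hσ : IsPrimSubst n σ) (j : ℕ) :
    ∃ κ k, ∀ m ≥ k, ∀ z : List ℕ, (∀ a ∈ z, a < n) → ∀ b < n,
      (iter σ (m + j) z).length ≤ κ * z.length * (iter σ m [b]).length := by
  obtain ⟨k, hk⟩ := hσ.exists_mem_iter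
  obtain ⟨S, -, hS⟩ := hσ.exists_length_le
  refine ⟨S ^ (k + j), k, fun m hm z hz b hb => ?_⟩
  obtain ⟨i, rfl⟩ := Nat.exists_eq_add_of_le hm
  induction z with
  | nil => simp
  | cons c z ih =>
    have h1 := ih fun a ha => hz a (by simp [ha])
    have hc : c < n := hz c (by simp)
    -- Here σ^i(c) is a factor of σ^(k+i)(b); the remaining `k + j` steps multiply lengths by at
    -- most `S ^ (k + j)`.
    have h2 : (iter σ i [c]).length ≤ (iter σ (k + i) [b]).length := by
      rw [add_comm, iter_add]
      exact (iter_infix_of_mem i (hk k le_rfl c hc b hb)).length_le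
    have h3 := hS (k + j) (iter σ i [c]) (hσ.iter_lt (by simpa) i)
    rw [← iter_add, show k + j + i = k + i + j by ring] at h3
    have h4 := Nat.mul_le_mul_left (S ^ (k + j)) h2
    rw [iter_cons, List.length_append, List.length_cons]
    calc _ ≤ S ^ (k + j) * (iter σ (k + i) [b]).length +
        S ^ (k + j) * z.length * (iter σ (k + i) [b]).length := by omega
      _ = _ := by ring

theorem singleton_mem {b : ℕ} (hb : b < n) : [b] ∈ langSub n σ :=
  ⟨0, b, hb, List.infix_rfl⟩

theorem infix_mem {u v : List ℕ} (hv : v ∈ langSub n σ) (h : u <:+: v) : u ∈ langSub n σ := by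
  obtain ⟨m, b, hb, h'⟩ := hv
  exact ⟨m, b, hb, h.trans h'⟩

theorem iter_mem {u : List ℕ} (hu : u ∈ langSub n σ) (m : ℕ) : iter σ m u ∈ langSub n σ := by
  obtain ⟨j, b, hb, h⟩ := hu
  exact ⟨m + j, b, hb, by rw [iter_add]; exact iter_infix m h⟩

theorem exists_infix_level (hσ : IsPrimSubst n σ) {u : List ℕ} (hu : u ∈ langSub n σ) (m : ℕ) :
    ∃ z ∈ langSub n σ, u <:+: iter σ m z := by
  obtain ⟨c, hc, -⟩ := hσ.start
  obtain ⟨i, hi⟩ := hσ.exists_infix_iter hu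
  refine ⟨iter σ i [c], iter_mem (singleton_mem hc) i, ?_⟩
  rw [← iter_add]
  exact hi _ (by omega) c hc

/-- Uniform recurrence: choose i such that `u` occurs in every σ^i(b). A word longer than the image
of two letters under σ^i contains some whole σ^i(b). Extendability: `u` occurs in σ^i(c), which is
followed by the nonempty word σ^i(t) in σ^(i+1)(c). -/
theorem isRecurrentLang (hσ : IsPrimSubst n σ) : IsRecurrentLang (langSub n σ) where
  infix_mem := infix_mem
  recurrent := by
    intro u hu
    obtain ⟨i, hi⟩ := hσ.exists_infix_iter hu
    obtain ⟨S, -, hS⟩ := hσ.exists_length_le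
    refine ⟨S ^ i * 2 + 1, fun v hv hl => ?_⟩
    obtain ⟨z, hz, h⟩ := hσ.exists_infix_level hv i
    rw [iter_eq_flatMap] at h
    rcases infix_flatMap z h with ⟨y, hy, hy2, h⟩ | ⟨b, hb, p, q, -, -, h⟩
    · rw [← iter_eq_flatMap] at h
      have h1 := h.length_le
      have h2 := hS i y (hσ.lt_of_mem (infix_mem hz hy))
      have h3 := Nat.mul_le_mul_left (S ^ i) hy2
      omega
    · exact (hi i le_rfl b (hσ.lt_of_mem hz b hb)).trans ⟨p, q, h.symm⟩
  extend := by
    intro u hu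
    obtain ⟨i, hi⟩ := hσ.exists_infix_iter hu
    obtain ⟨c, hc, t, ht, hct⟩ := hσ.start
    have htn : ∀ a ∈ t, a < n := fun a ha => hσ.lt c hc a (by rw [hct]; simp [ha])
    have hmem : iter σ i [c] ++ iter σ i t ∈ langSub n σ := by
      rw [← iter_append, List.singleton_append, ← hct]
      exact ⟨i + 1, c, hc, by rw [iter_add, iter_one, List.flatMap_singleton]⟩
    obtain ⟨p, q, h⟩ := hi i le_rfl c hc
    obtain ⟨a, y, hy⟩ : ∃ a y, q ++ iter σ i t = a :: y :=
      List.exists_cons_of_ne_nil (by simp [hσ.iter_ne_nil htn ht])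
    refine ⟨a, infix_mem hmem ⟨p, y, ?_⟩⟩
    rw [← h, List.append_assoc _ q, hy]; simp

theorem exists_cons_mem (hσ : IsPrimSubst n σ) {u : List ℕ} (hu : u ∈ langSub n σ) :
    ∃ a, a :: u ∈ langSub n σ := by
  obtain ⟨i, hi⟩ := hσ.exists_infix_iter hu
  obtain ⟨c, hc, t, ht, hct⟩ := hσ.start
  obtain ⟨y, d, rfl⟩ : ∃ y d, t = y ++ [d] := by
    rcases List.eq_nil_or_concat t with rfl | ⟨y, c, rfl⟩
    · simp at ht
    · exact ⟨y, c, by simp⟩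
  have hd : d < n := hσ.lt c hc d (by rw [hct]; simp)
  have hcy : ∀ a ∈ c :: y, a < n := fun a ha => hσ.lt c hc a (by
    rw [hct]; rcases List.mem_cons.1 ha with h | h <;> simp [h])
  have hmem : iter σ i (c :: y) ++ iter σ i [d] ∈ langSub n σ := by
    rw [← iter_append, List.cons_append, ← hct]
    exact ⟨i + 1, c, hc, by rw [iter_add, iter_one, List.flatMap_singleton]⟩
  obtain ⟨p, q, h⟩ := hi i le_rfl d hd
  obtain ⟨x, a, hy⟩ : ∃ x a, iter σ i (c :: y) ++ p = x ++ [a] := by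
    rcases List.eq_nil_or_concat (iter σ i (c :: y) ++ p) with h | ⟨y, c, h⟩
    · simp [hσ.iter_ne_nil hcy] at h
    · exact ⟨y, c, by simpa using h⟩
  refine ⟨a, infix_mem hmem ⟨x, q, ?_⟩⟩
  rw [← h, ← List.append_assoc, ← List.append_assoc, hy]; simp

theorem exists_pair (hσ : IsPrimSubst n σ) {u : List ℕ} (hu : u ∈ langSub n σ)
    (h2 : u.length ≤ 2) : ∃ a b, [a, b] ∈ langSub n σ ∧ u <:+: [a, b] := by
  obtain ⟨t, ht, h⟩ := hσ.isRecurrentLang.exists_append hu (2 - u.length)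
  obtain ⟨a, b, hab⟩ := List.length_eq_two.1 (show (u ++ t).length = 2 by simp; omega)
  exact ⟨a, b, hab ▸ h, hab ▸ (List.prefix_append u t).isInfix⟩

end IsPrimSubst

/-! ### Letter-to-letter images -/

/-- The language of the image of a substitutive shift space under a letter-to-letter map. -/
def langMor (n : ℕ) (σ : ℕ → List ℕ) (τ : ℕ → ℕ) : Set (List ℕ) :=
  List.map τ '' langSub n σ

/-- The word `τ (σ ^ m (z))`. -/
def img (σ : ℕ → List ℕ) (τ : ℕ → ℕ) (m : ℕ) (z : List ℕ) : List ℕ :=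
  (iter σ m z).map τ

section Img

variable {n : ℕ} {σ : ℕ → List ℕ} {τ : ℕ → ℕ}

@[simp]
theorem img_append (m : ℕ) (u v : List ℕ) : img σ τ m (u ++ v) = img σ τ m u ++ img σ τ m v := by
  simp [img]

@[simp]
theorem img_nil (m : ℕ) : img σ τ m [] = [] := by simp [img]

@[simp]
theorem length_img (m : ℕ) (u : List ℕ) : (img σ τ m u).length = (iter σ m u).length := by
  simp [img]

theorem img_eq_flatMap (m : ℕ) (z : List ℕ) : img σ τ m z = z.flatMap fun b => img σ τ m [b] := by
  rw [img, iter_eq_flatMap, List.map_flatMap]; rfl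

theorem img_add (m j : ℕ) (z : List ℕ) : img σ τ (m + j) z = img σ τ m (iter σ j z) := by
  rw [img, img, iter_add]

theorem img_infix (m : ℕ) {u v : List ℕ} (h : u <:+: v) : img σ τ m u <:+: img σ τ m v := by
  obtain ⟨s, t, rfl⟩ := h
  exact ⟨img σ τ m s, img σ τ m t, by simp⟩

theorem img_prefix (m : ℕ) {u v : List ℕ} (h : u <+: v) : img σ τ m u <+: img σ τ m v := by
  obtain ⟨t, rfl⟩ := h
  exact ⟨img σ τ m t, by simp⟩

theorem img_mem {u : List ℕ} (hu : u ∈ langSub n σ) (m : ℕ) : img σ τ m u ∈ langMor n σ τ :=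
  ⟨_, IsPrimSubst.iter_mem hu m, rfl⟩

theorem langMor_infix_mem {u v : List ℕ} (hv : v ∈ langMor n σ τ) (h : u <:+: v) :
    u ∈ langMor n σ τ := by
  obtain ⟨v, hv, rfl⟩ := hv
  obtain ⟨s, t, h⟩ := h
  obtain ⟨x, t', rfl, h, -⟩ := List.map_eq_append_iff.1 h.symm
  obtain ⟨s', u', rfl, -, rfl⟩ := List.map_eq_append_iff.1 h
  exact ⟨u', IsPrimSubst.infix_mem hv ⟨s', t', rfl⟩, rfl⟩

namespace IsPrimSubst

theorem isRecurrentLang_langMor (hσ : IsPrimSubst n σ) : IsRecurrentLang (langMor n σ τ) where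
  infix_mem := langMor_infix_mem
  recurrent := by
    rintro _ ⟨u, hu, rfl⟩
    obtain ⟨M, hM⟩ := hσ.isRecurrentLang.recurrent u hu
    refine ⟨M, ?_⟩
    rintro _ ⟨v, hv, rfl⟩ hl
    exact (hM v hv (by simpa using hl)).map τ
  extend := by
    rintro _ ⟨u, hu, rfl⟩
    obtain ⟨a, ha⟩ := hσ.isRecurrentLang.extend u hu
    exact ⟨τ a, _, ha, by simp⟩

theorem langMor_cons_mem (hσ : IsPrimSubst n σ) {u : List ℕ} (hu : u ∈ langMor n σ τ) :
    ∃ a, a :: u ∈ langMor n σ τ := by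
  obtain ⟨u, hu, rfl⟩ := hu
  obtain ⟨a, ha⟩ := hσ.exists_cons_mem hu
  exact ⟨τ a, _, ha, by simp⟩

theorem exists_infix_img (hσ : IsPrimSubst n σ) {T : List ℕ} (hT : T ∈ langMor n σ τ) (m : ℕ) :
    ∃ z ∈ langSub n σ, T <:+: img σ τ m z := by
  obtain ⟨u, hu, rfl⟩ := hT
  obtain ⟨z, hz, h⟩ := hσ.exists_infix_level hu m
  exact ⟨z, hz, h.map τ⟩

/-- This reduces questions about the language to the finitely many images of two-letter words: in
the applications the second alternative is excluded, or contributes an inner occurrence of a chosen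
word. -/
theorem infix_img_pair (hσ : IsPrimSubst n σ) {T : List ℕ} (hT : T ∈ langMor n σ τ) (m : ℕ) :
    (∃ a b, [a, b] ∈ langSub n σ ∧ T <:+: img σ τ m [a, b]) ∨
      ∃ b < n, ∃ p q, p ≠ [] ∧ q ≠ [] ∧ T = p ++ img σ τ m [b] ++ q := by
  obtain ⟨z, hz, h⟩ := hσ.exists_infix_img hT m
  rw [img_eq_flatMap] at h
  rcases infix_flatMap z h with ⟨y, hy, hy2, h⟩ | ⟨b, hb, p, q, h1⟩
  · rw [← img_eq_flatMap] at h
    obtain ⟨a, b, hab, h'⟩ := hσ.exists_pair (infix_mem hz hy) hy2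
    exact Or.inl ⟨a, b, hab, h.trans (img_infix m h')⟩
  · exact Or.inr ⟨b, hσ.lt_of_mem hz b hb, p, q, h1⟩

end IsPrimSubst

end Img

/-! ### Lower bounds for the images of all return groups -/

theorem iter_flatMap_comm {β γ : Type*} {σ : β → List β} {ρ : γ → List γ} {P : γ → List β}
    {J : ℕ} (h : ∀ c, iter σ J (P c) = (ρ c).flatMap P) (k : ℕ) (y : List γ) :
    iter σ (J * k) (y.flatMap P) = (iter ρ k y).flatMap P := by
  have h1 : ∀ y : List γ, iter σ J (y.flatMap P) = (y.flatMap ρ).flatMap P := by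
    intro y
    induction y with
    | nil => simp
    | cons c y ih => simp [h, ih]
  induction k generalizing y with
  | zero => rfl
  | succ k ih =>
    rw [Nat.mul_succ, iter_add, h1, ih, ← iter_one, ← iter_add]

theorem flatMap_flatMap_eq {β γ δ : Type*} {f : β → List γ} {h : γ → List δ} {k : β → List δ}
    (e : ∀ b, (f b).flatMap h = k b) (y : List β) : (y.flatMap f).flatMap h = y.flatMap k := by
  rw [List.flatMap_assoc]; simp [e]

theorem val_iter {G : Type*} [Monoid G] {h : ℕ → G} {ρ : ℕ → List ℕ}
    (e : ∀ d, val h (ρ d) = h d) (k : ℕ) (y : List ℕ) : val h (iter ρ k y) = val h y := by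
  induction k with
  | zero => rfl
  | succ k ih => rw [add_comm, iter_add, iter_one, val_flatMap]; simp only [e]; exact ih

theorem two_pow_le_length_iter {ρ : ℕ → List ℕ} {l : ℕ}
    (h2 : ∀ d < l, 2 ≤ (ρ d).length) (hl : ∀ d < l, ∀ x ∈ ρ d, x < l) (k : ℕ) {z : List ℕ}
    (hz : ∀ x ∈ z, x < l) :
    2 ^ k * z.length ≤ (iter ρ k z).length ∧ ∀ x ∈ iter ρ k z, x < l := by
  induction k with
  | zero => exact ⟨by simp, hz⟩
  | succ k ih =>
    rw [add_comm, iter_add, iter_one]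
    have key : ∀ y : List ℕ, (∀ x ∈ y, x < l) → 2 * y.length ≤ (y.flatMap ρ).length := by
      intro y hy
      induction y with
      | nil => simp
      | cons d y ih =>
        have h1 := h2 d (hy d (by simp))
        have h3 := ih fun x hx => hy x (by simp [hx])
        simp only [List.length_cons, List.flatMap_cons, List.length_append]
        omega
    refine ⟨?_, ?_⟩
    · have h3 := key _ ih.2
      rw [pow_add, pow_one, mul_assoc]
      have := ih.1
      omega
    · intro x hx
      obtain ⟨d, hd, hx⟩ := List.mem_flatMap.1 hx
      exact hl d (ih.2 d hd) x hx

theorem length_le_flatMap {β γ : Type*} {f : β → List γ} {z : List β} (h : ∀ b ∈ z, f b ≠ []) :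
    z.length ≤ (z.flatMap f).length := by
  induction z with
  | nil => simp
  | cons b z ih =>
    have h1 := List.length_pos_iff.2 (h b List.mem_cons_self)
    have h2 := ih fun b hb => h b (List.mem_cons_of_mem _ hb)
    simp only [List.flatMap_cons, List.length_append, List.length_cons]
    omega

/-- If the image of a substitutive sequence is also the image under `Θ` of a fixed point of a
left proper substitution `ρ`, and `Θ` and `Θ ρ` have the same values in `G`, then these values
belong to the images of return groups to arbitrarily long words. -/
theorem exists_mem_retImage_of_presentation {n : ℕ} {σ : ℕ → List ℕ} {τ : ℕ → ℕ} {G : Type*}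
    [Group G] {g : ℕ → G} (hσ : IsPrimSubst n σ) {J N l z : ℕ} {Q σ' P Θ ρ : ℕ → List ℕ}
    {y : List ℕ} (hQ : ∀ c, iter σ J (Q c) = (σ' c).flatMap Q)
    (hP : ∀ c, (P c).flatMap ρ = (σ' c).flatMap P)
    (hΘ : ∀ c, (P c).flatMap Θ = img σ τ N (Q c))
    (hy : y.flatMap Q ∈ langSub n σ)
    (hl : ∀ d < l, ∃ d' < l, [d, d'] <:+: y.flatMap P)
    (hz : z < l) (hΘ0 : ∀ d < l, Θ d ≠ []) (hρz : ∀ d < l, ∃ x, ρ d = z :: x)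
    (hρ2 : ∀ d < l, 2 ≤ (ρ d).length) (hρl : ∀ d < l, ∀ x ∈ ρ d, x < l)
    (hg : ∀ d, val g ((ρ d).flatMap Θ) = val g (Θ d)) (k : ℕ) :
    ∃ u ∈ langMor n σ τ, k ≤ u.length ∧ ∀ d < l, val g (Θ d) ∈ retImage g (langMor n σ τ) u := by
  have hL : IsRecurrentLang (langMor n σ τ) := hσ.isRecurrentLang_langMor
  -- By the intertwining relations this word equals τ(σ^(N + Jk)(Q(y))).
  have hmem : ∀ k, (iter ρ k (y.flatMap P)).flatMap Θ ∈ langMor n σ τ := by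
    intro k
    have h1 := iter_flatMap_comm (σ := ρ) (J := 1) (P := P) hP k y
    rw [one_mul] at h1
    rw [h1, flatMap_flatMap_eq hΘ]
    have h2 : ∀ x : List ℕ, x.flatMap (fun c => img σ τ N (Q c)) = img σ τ N (x.flatMap Q) := by
      intro x
      induction x with
      | nil => simp
      | cons c x ih => simp [ih]
    rw [h2, ← iter_flatMap_comm hQ]
    exact img_mem (IsPrimSubst.iter_mem hy _) _
  -- Every ρ(d) starts with `z`, so all the words Θ(ρ^(k+1)(d)) start with the common word
  -- Θ(ρ^k(z)). Since each `d` has a successor `d'`, Θ(ρ^(k+1)(d)) is a return, not necessarily a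
  -- first one, to that word.
  have hstart : ∀ d < l, ∃ x, (iter ρ (k + 1) [d]).flatMap Θ =
      (iter ρ k [z]).flatMap Θ ++ x := by
    intro d hd
    obtain ⟨x, hx⟩ := hρz d hd
    refine ⟨(iter ρ k x).flatMap Θ, ?_⟩
    rw [iter_add, iter_one, List.flatMap_singleton, hx, iter_cons, List.flatMap_append]
  have hret : ∀ d < l, (iter ρ (k + 1) [d]).flatMap Θ ++ (iter ρ k [z]).flatMap Θ ∈
      langMor n σ τ := by
    intro d hd
    obtain ⟨d', hd', p, q, h⟩ := hl d hd
    obtain ⟨x, hx⟩ := hstart d' hd'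
    refine hL.infix_mem (hmem (k + 1)) ?_
    rw [← h, iter_append, iter_append, show [d, d'] = [d] ++ [d'] from rfl, iter_append]
    simp only [List.flatMap_append, hx]
    exact ⟨(iter ρ (k + 1) p).flatMap Θ, x ++ (iter ρ (k + 1) q).flatMap Θ, by simp⟩
  refine ⟨(iter ρ k [z]).flatMap Θ,
    hL.infix_mem (hret z hz) (List.suffix_append _ _).isInfix, ?_, fun d hd => ?_⟩
  · obtain ⟨h1, h2⟩ := two_pow_le_length_iter hρ2 hρl k (z := [z]) (by simpa)
    have h3 := length_le_flatMap (f := Θ) (z := iter ρ k [z]) fun b hb => hΘ0 b (h2 b hb)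
    have h4 := Nat.lt_two_pow_self (n := k)
    simp only [List.length_singleton, mul_one] at h1
    omega
  · obtain ⟨x, hx⟩ := hstart d hd
    have h1 := val_mem_retImage (g := g) hL (hret d hd) (by rw [hx]; simp)
    rw [val_flatMap, val_iter fun d => by rw [← val_flatMap]; exact hg d] at h1
    simpa [val] using h1

/-- If a language has period `|w|`, then the value of its word `w` belongs to the images of
return groups to arbitrarily long words. -/
theorem exists_mem_retImage_of_periodic {α G : Type*} [Group G] {g : α → G} {L : Set (List α)}
    (hL : IsRecurrentLang L) {w : List α} (hw : w ∈ L)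
    (hper : ∀ T ∈ L, ∀ i, i + w.length < T.length → T[i]? = T[i + w.length]?) (k : ℕ) :
    ∃ u ∈ L, k ≤ u.length ∧ val g w ∈ retImage g L u := by
  -- In `w ++ t` the period `|w|` makes `t` a prefix of `w ++ t`, so `w` is a return to the long
  -- word `t`.
  obtain ⟨t, ht, h⟩ := hL.exists_append hw k
  refine ⟨t, hL.infix_mem h (List.suffix_append _ _).isInfix, ht.ge, val_mem_retImage hL h ?_⟩
  rw [List.prefix_iff_getElem?]
  intro i hi
  rw [hper _ h i (by simp; omega), List.getElem?_append_right (by omega)]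
  simp [hi]

/-- A language has period `d` if this holds for its words of length `d + 1`. -/
theorem periodic_of_length {α : Type*} {L : Set (List α)} (hL : IsRecurrentLang L) {d : ℕ}
    (h : ∀ T ∈ L, T.length = d + 1 → T[0]? = T[d]?) (T : List α) (hT : T ∈ L) (i : ℕ)
    (hi : i + d < T.length) : T[i]? = T[i + d]? := by
  have h1 := h ((T.drop i).take (d + 1)) (hL.infix_mem hT ?_) (by simp; omega)
  · simpa [List.getElem?_take, List.getElem?_drop] using h1
  · exact (List.take_prefix _ _).isInfix.trans (List.drop_suffix _ _).isInfix

/-! ### Certificates -/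

/-- The factors of length at most two of the image of `s` are factors of `s`. -/
def PairClosed (σ : ℕ → List ℕ) (s : List ℕ) : Prop :=
  ∀ k < (s.flatMap σ).length, ((s.flatMap σ).drop k).take 2 <:+: s

/-- By induction on m, short factors of σ^m(s) are factors of s: a factor of σ^(m+1)(s) of length at
most two lies in the image of at most two consecutive letters of σ^m(s), which occur in `s` by
induction. Every two-letter word of the language appears in some σ^m(s). -/
theorem PairClosed.infix {n : ℕ} {σ : ℕ → List ℕ} (hσ : IsPrimSubst n σ) {s : List ℕ}
    (h : PairClosed σ s) (hs : s ∈ langSub n σ) (hs0 : s ≠ []) {a b : ℕ}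
    (hab : [a, b] ∈ langSub n σ) : [a, b] <:+: s := by
  have key : ∀ m, ∀ T : List ℕ, T.length ≤ 2 → T <:+: iter σ m s → T <:+: s := by
    intro m
    induction m with
    | zero => exact fun T _ h => h
    | succ m ih =>
      intro T hT2 hT
      rw [add_comm, iter_add, iter_one] at hT
      rcases infix_flatMap _ hT with ⟨y, hy, hy2, hT⟩ | ⟨b, hb, p, q, hp, hq, rfl⟩
      · obtain ⟨p, q, hpq⟩ : T <:+: s.flatMap σ := by
          obtain ⟨p, q, hpq⟩ := ih y hy2 hy
          refine hT.trans ⟨p.flatMap σ, q.flatMap σ, ?_⟩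
          rw [← hpq]; simp
        rcases eq_or_ne T [] with rfl | hT0
        · exact List.nil_infix
        have hT1 := List.length_pos_iff.2 hT0
        refine List.IsInfix.trans ?_ (h p.length (by rw [← hpq]; simp; omega))
        rw [← hpq, List.append_assoc, List.drop_left, List.take_append, List.take_of_length_le hT2]
        exact (List.prefix_append _ _).isInfix
      · have h1 := List.length_pos_iff.2 hp
        have h2 := List.length_pos_iff.2 hq
        have h3 := List.length_pos_iff.2 (hσ.apply_ne_nil
          (hσ.lt_of_mem (IsPrimSubst.iter_mem hs m) b hb))
        simp only [List.length_append] at hT2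
        omega
  obtain ⟨i, hi⟩ := hσ.exists_infix_iter hab
  obtain ⟨c, y, rfl⟩ := List.exists_cons_of_ne_nil hs0
  refine key i _ le_rfl ((hi i le_rfl c (hσ.lt_of_mem hs c (by simp))).trans ?_)
  exact iter_infix_of_mem i (by simp)

/-- The number of the value of a word, given the multiplication in the group, the values of the
letters and the neutral element. -/
def wordNum (mul : ℕ → ℕ → ℕ) (gn : ℕ → ℕ) (e : ℕ) (w : List ℕ) : ℕ :=
  w.foldl (fun x a => mul x (gn a)) e

/-- The first component of an entry of a table, as a substitution. -/
def tabFst {δ : Type*} (R : List (List ℕ × δ)) (d : ℕ) : List ℕ :=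
  (R.map Prod.fst).getD d []

/-- The second component of an entry of a table, as a substitution. -/
def tabSnd (R : List (List ℕ × List ℕ)) (d : ℕ) : List ℕ :=
  (R.map Prod.snd).getD d []

/-- The numbers of the values of the words in `E` over the generators listed in `R`. -/
def elems (mul : ℕ → ℕ → ℕ) (gn : ℕ → ℕ) (e : ℕ) (E : List (List ℕ))
    (R : List (List ℕ × List ℕ)) : List ℕ :=
  E.map fun y => wordNum mul gn e (y.flatMap (tabFst R))

/-- The list `l` is closed under multiplication, and contains the values of all return words to
`w`. -/
def UpperCert (σ : ℕ → List ℕ) (τ : ℕ → ℕ) (n : ℕ) (mul : ℕ → ℕ → ℕ) (gn : ℕ → ℕ) (e : ℕ)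
    (s : List ℕ) (N : ℕ) (w l : List ℕ) : Prop :=
  mul e e = e ∧ PairClosed σ s ∧ (∀ b < n, w <:+: img σ τ N [b]) ∧
    (∀ j < (img σ τ N s).length + 1, ∀ i < j + 1, w <+: (img σ τ N s).drop i →
      w <+: (img σ τ N s).drop j →
      wordNum mul gn e (((img σ τ N s).drop i).take (j - i)) ∈ l) ∧
    ∀ x ∈ l, ∀ y ∈ l, mul x y ∈ l

/-- The table `R` lists the images under `Θ` and `ρ` of letters, such that the image of the
substitutive sequence is the image under `Θ` of a fixed point of `ρ`. -/
def PresentationCert (σ : ℕ → List ℕ) (τ : ℕ → ℕ) (mul : ℕ → ℕ → ℕ) (gn : ℕ → ℕ) (e : ℕ)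
    (s : List ℕ) (J N z : ℕ) (y : List ℕ) (C : List (List ℕ × List ℕ × List ℕ))
    (R : List (List ℕ × List ℕ)) : Prop :=
  (∀ c ∈ C, iter σ J c.1 = c.2.1.flatMap (tabFst C) ∧
    c.2.2.flatMap (tabSnd R) = c.2.1.flatMap (tabSnd (C.map Prod.snd)) ∧
    c.2.2.flatMap (tabFst R) = img σ τ N c.1) ∧
  y.flatMap (tabFst C) <:+: s ∧
  (∀ d < R.length, ∃ d' < R.length, [d, d'] <:+: y.flatMap (tabSnd (C.map Prod.snd))) ∧
  z < R.length ∧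
  ∀ r ∈ R, r.1 ≠ [] ∧ r.2.head? = some z ∧ 2 ≤ r.2.length ∧ (∀ x ∈ r.2, x < R.length) ∧
    wordNum mul gn e (r.2.flatMap (tabFst R)) = wordNum mul gn e r.1

/-- The image of the substitutive sequence has period `|w|`. -/
def PeriodicCert (σ : ℕ → List ℕ) (τ : ℕ → ℕ) (s : List ℕ) (N : ℕ) (w : List ℕ)
    (R : List (List ℕ × List ℕ)) : Prop :=
  (∀ r ∈ R, r.1 = w) ∧
  ∀ i < (img σ τ N s).length, i + w.length < (img σ τ N s).length →
    (img σ τ N s)[i]? = (img σ τ N s)[i + w.length]?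

/-! ### Soundness of certificates -/

section Sound

variable {G : Type*} [Group G] {ι : G → ℕ} {mul : ℕ → ℕ → ℕ} {g : ℕ → G} {gn : ℕ → ℕ} {e : ℕ}

theorem wordNum_eq (hmul : ∀ x y, mul (ι x) (ι y) = ι (x * y)) (hg : ∀ a, ι (g a) = gn a)
    (he : ι 1 = e) (w : List ℕ) : wordNum mul gn e w = ι (val g w) := by
  have key : ∀ (w : List ℕ) (x : G),
      w.foldl (fun x a => mul x (gn a)) (ι x) = ι (x * val g w) := by
    intro w
    induction w with
    | nil => simp
    | cons a w ih =>
      intro x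
      rw [List.foldl_cons, ← hg, hmul, ih]
      simp [val, mul_assoc]
  rw [wordNum, ← he, key, one_mul]

variable {n : ℕ} {σ : ℕ → List ℕ} {τ : ℕ → ℕ} {s w : List ℕ} {N : ℕ}
  {R : List (List ℕ × List ℕ)} {E : List (List ℕ)}

/-- As `w` occurs in the image of each letter, a first return followed by `w` cannot contain such an
image in its interior. It therefore fits in the image of a two-letter word. -/
theorem infix_of_mem_ret (hσ : IsPrimSubst n σ)
    (hs : ∀ a b, [a, b] ∈ langSub n σ → [a, b] <:+: s) (hw : ∀ b < n, w <:+: img σ τ N [b])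
    {r : List ℕ} (hr : r ∈ ret (langMor n σ τ) w) : r ++ w <:+: img σ τ N s := by
  obtain ⟨-, h1, -, h3⟩ := hr
  rcases hσ.infix_img_pair h1 N with ⟨a, b, hab, h⟩ | ⟨b, hb, p, q, hp, hq, h⟩
  · exact h.trans (img_infix N (hs a b hab))
  · obtain ⟨x, y, hxy⟩ := hw b hb
    exact absurd ⟨p ++ x, y ++ q, by simp [hp], by simp [hq], by rw [h, ← hxy]; simp⟩ h3

theorem mem_img_iff (hσ : IsPrimSubst n σ) (hsL : s ∈ langSub n σ)
    (hs : ∀ a b, [a, b] ∈ langSub n σ → [a, b] <:+: s) (N a : ℕ) :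
    a ∈ img σ τ N s ↔ [a] ∈ langMor n σ τ := by
  constructor
  · intro h
    exact langMor_infix_mem (img_mem hsL N) ((List.singleton_infix_iff _ _).2 h)
  · intro h
    rcases hσ.infix_img_pair h N with ⟨b, c, hbc, h⟩ | ⟨b, hb, p, q, hp, hq, h⟩
    · exact (List.singleton_infix_iff _ _).1 (h.trans (img_infix N (hs b c hbc)))
    · have h1 := congrArg List.length h
      have h2 := List.length_pos_iff.2 hp
      have h3 := List.length_pos_iff.2 hq
      simp only [List.length_append, List.length_singleton] at h1
      omega

/-- The list is a finite multiplicatively closed set, hence a subgroup `K`. It contains the values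
of all return words to `w` because these are visible in the image of `s`, and its elements are
products of values of the table `R`, which bounds it from above. -/
theorem UpperCert.exists_subgroup [Finite G] (hι : Function.Injective ι)
    (hmul : ∀ x y, mul (ι x) (ι y) = ι (x * y)) (hg : ∀ a, ι (g a) = gn a)
    (he : ∃ x, ι x = e) (hσ : IsPrimSubst n σ) (hsL : s ∈ langSub n σ) (hs0 : s ≠ [])
    (h : UpperCert σ τ n mul gn e s N w (elems mul gn e E R)) :
    ι 1 = e ∧ w ∈ langMor n σ τ ∧
      ∃ K : Subgroup G, (∀ k, k ∈ elems mul gn e E R ↔ ∃ x ∈ K, ι x = k) ∧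
        retImage g (langMor n σ τ) w ≤ K ∧
        ∀ K' : Subgroup G, (∀ d < R.length, val g (tabFst R d) ∈ K') → K ≤ K' := by
  obtain ⟨h1, h2, h3, h4, h5⟩ := h
  have hs : ∀ a b, [a, b] ∈ langSub n σ → [a, b] <:+: s := fun a b => h2.infix hσ hsL hs0
  -- The only idempotent of a group is its neutral element.
  have he1 : ι 1 = e := by
    obtain ⟨x, rfl⟩ := he
    rw [hmul] at h1
    rw [mul_eq_left.1 (hι h1)]
  have hnum := wordNum_eq hmul hg he1
  have hmem : ∀ k ∈ elems mul gn e E R, ∃ y ∈ E, k = ι (val g (y.flatMap (tabFst R))) := by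
    intro k hk
    obtain ⟨y, hy, rfl⟩ := List.mem_map.1 hk
    exact ⟨y, hy, hnum _⟩
  obtain ⟨c, hc, -⟩ := hσ.start
  have hocc : ∃ p q, img σ τ N s = p ++ w ++ q := by
    obtain ⟨b, y, rfl⟩ := List.exists_cons_of_ne_nil hs0
    obtain ⟨p, q, h⟩ := h3 b (hσ.lt_of_mem hsL b (by simp))
    exact ⟨p, q ++ img σ τ N y, by rw [← List.singleton_append, img_append, ← h]; simp⟩
  have hone : ι 1 ∈ elems mul gn e E R := by
    obtain ⟨p, q, h⟩ := hocc
    -- Two equal positions of an occurrence of `w` enclose the empty word, whose value is 1.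
    have := h4 p.length (by rw [h]; simp) p.length (by omega) (by rw [h]; simp)
      (by rw [h]; simp)
    simpa [hnum] using this
  let M : Submonoid G :=
    { carrier := {x | ι x ∈ elems mul gn e E R}
      mul_mem' := fun {a b} ha hb => by
        change ι (a * b) ∈ elems mul gn e E R
        rw [← hmul]; exact h5 _ ha _ hb
      one_mem' := hone }
  let K : Subgroup G :=
    { M with
      inv_mem' := fun {x} hx => by
        -- In a finite group inverses are positive powers, up to the trivial power for `x = 1`.
        have : x⁻¹ = x ^ (orderOf x - 1) := by
          rw [inv_eq_iff_mul_eq_one, ← pow_succ', Nat.sub_add_cancel (orderOf_pos x),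
            pow_orderOf_eq_one]
        change x⁻¹ ∈ M
        rw [this]
        exact pow_mem (show x ∈ M from hx) _ }
  have hK : ∀ x, x ∈ K ↔ ι x ∈ elems mul gn e E R := fun x => Iff.rfl
  refine ⟨he1, langMor_infix_mem (img_mem (IsPrimSubst.singleton_mem hc) N) (h3 c hc), K,
    ?_, ?_, ?_⟩
  · intro k
    constructor
    · intro hk
      obtain ⟨y, -, rfl⟩ := hmem k hk
      exact ⟨_, hk, rfl⟩
    · rintro ⟨x, hx, rfl⟩
      exact hx
  · rw [retImage, Subgroup.closure_le]
    rintro _ ⟨r, hr, rfl⟩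
    obtain ⟨p, q, hpq⟩ := infix_of_mem_ret hσ hs h3 hr
    have hwr := hr.2.2.1
    change val g r ∈ K
    rw [hK, ← hnum]
    have := h4 (p.length + r.length) (by rw [← hpq]; simp) p.length (by omega)
      (by
        rw [← hpq, List.append_assoc, List.drop_left]
        exact hwr.trans (List.prefix_append _ _))
      (by
        rw [← hpq, show p ++ (r ++ w) ++ q = (p ++ r) ++ (w ++ q) by simp,
          ← List.length_append, List.drop_left]
        exact List.prefix_append _ _)
    rw [← hpq, List.append_assoc, List.drop_left, Nat.add_sub_cancel_left, List.append_assoc,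
      List.take_left] at this
    exact this
  · intro K' hK' x hx
    obtain ⟨y, -, hy⟩ := hmem _ ((hK x).1 hx)
    rw [hι hy, val_flatMap]
    refine val_mem fun d _ => ?_
    by_cases hd : d < R.length
    · exact hK' d hd
    · rw [tabFst, List.getD_eq_default _ _ (by simpa using hd)]
      exact one_mem _

theorem tabFst_of_lt {δ : Type*} {R : List (List ℕ × δ)} {d : ℕ} (hd : d < R.length) :
    tabFst R d = R[d].1 := by
  simp [tabFst, hd]

theorem tabSnd_of_lt {d : ℕ} (hd : d < R.length) : tabSnd R d = R[d].2 := by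
  simp [tabSnd, hd]

theorem tabFst_of_le {δ : Type*} {R : List (List ℕ × δ)} {d : ℕ} (hd : R.length ≤ d) :
    tabFst R d = [] := by
  simp [tabFst, hd]

theorem tabSnd_of_le {d : ℕ} (hd : R.length ≤ d) : tabSnd R d = [] := by
  simp [tabSnd, hd]

/-- The checks cover only the entries of the tables. Beyond them all lookups give the empty word, so
the relations required for every index hold trivially there. -/
theorem PresentationCert.exists_mem_retImage (hι : Function.Injective ι)
    (hmul : ∀ x y, mul (ι x) (ι y) = ι (x * y)) (hg : ∀ a, ι (g a) = gn a) (he : ι 1 = e)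
    (hσ : IsPrimSubst n σ) (hsL : s ∈ langSub n σ) {J N z : ℕ} {y : List ℕ}
    {C : List (List ℕ × List ℕ × List ℕ)} (h : PresentationCert σ τ mul gn e s J N z y C R)
    (k : ℕ) : ∃ u ∈ langMor n σ τ, k ≤ u.length ∧
      ∀ d < R.length, val g (tabFst R d) ∈ retImage g (langMor n σ τ) u := by
  obtain ⟨h1, h2, h3, h4, h5⟩ := h
  have h5' : ∀ d (hd : d < R.length), _ := fun d hd => h5 R[d] (List.getElem_mem hd)
  refine exists_mem_retImage_of_presentation hσ (J := J) (N := N) (Q := tabFst C)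
    (σ' := tabFst (C.map Prod.snd)) (P := tabSnd (C.map Prod.snd)) (ρ := tabSnd R) (z := z)
    (y := y) ?_ ?_ ?_ (IsPrimSubst.infix_mem hsL h2) h3 h4 ?_ ?_ ?_ ?_ ?_ k
  · intro c
    rcases lt_or_ge c C.length with hc | hc
    · rw [tabFst_of_lt hc, (h1 _ (List.getElem_mem hc)).1, tabFst_of_lt (by simpa)]
      simp
    · rw [tabFst_of_le hc, tabFst_of_le (by simpa)]; simp
  · intro c
    rcases lt_or_ge c C.length with hc | hc
    · rw [tabFst_of_lt (by simpa), tabSnd_of_lt (by simpa), List.getElem_map,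
        (h1 _ (List.getElem_mem hc)).2.1]
    · rw [tabFst_of_le (by simpa), tabSnd_of_le (by simpa)]; simp
  · intro c
    rcases lt_or_ge c C.length with hc | hc
    · rw [tabFst_of_lt hc, tabSnd_of_lt (by simpa), List.getElem_map,
        (h1 _ (List.getElem_mem hc)).2.2]
    · rw [tabFst_of_le hc, tabSnd_of_le (by simpa)]; simp
  · intro d hd
    rw [tabFst_of_lt hd]; exact (h5' d hd).1
  · intro d hd
    rw [tabSnd_of_lt hd]
    exact ⟨_, (List.cons_head?_tail (h5' d hd).2.1).symm⟩
  · intro d hd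
    rw [tabSnd_of_lt hd]; exact (h5' d hd).2.2.1
  · intro d hd
    rw [tabSnd_of_lt hd]; exact (h5' d hd).2.2.2.1
  · intro d
    rcases lt_or_ge d R.length with hd | hd
    · have := (h5' d hd).2.2.2.2
      rw [wordNum_eq hmul hg he, wordNum_eq hmul hg he] at this
      rw [tabSnd_of_lt hd, tabFst_of_lt hd, hι this]
    · rw [tabSnd_of_le hd, tabFst_of_le hd]; simp

/-- A word of length `|w| + 1` is too short to contain the image of a letter strictly inside,
because that image contains `w`. So it lies in the image of `s`, where the period has been checked.
-/
theorem PeriodicCert.exists_mem_retImage (hσ : IsPrimSubst n σ)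
    (hs : ∀ a b, [a, b] ∈ langSub n σ → [a, b] <:+: s) (hw : ∀ b < n, w <:+: img σ τ N [b])
    (hwL : w ∈ langMor n σ τ) (h : PeriodicCert σ τ s N w R)
    (k : ℕ) : ∃ u ∈ langMor n σ τ, k ≤ u.length ∧
      ∀ d < R.length, val g (tabFst R d) ∈ retImage g (langMor n σ τ) u := by
  obtain ⟨h1, h2⟩ := h
  have hL : IsRecurrentLang (langMor n σ τ) := hσ.isRecurrentLang_langMor
  have hper := periodic_of_length hL (d := w.length) fun T hT hTl => by
    rcases hσ.infix_img_pair hT N with ⟨a, b, hab, h⟩ | ⟨b, hb, p, q, hp, hq, h⟩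
    · obtain ⟨p, q, hpq⟩ := h.trans (img_infix N (hs a b hab))
      have h3 := h2 p.length (by rw [← hpq]; simp; omega) (by rw [← hpq]; simp; omega)
      have h4 : ∀ i < T.length, (p ++ T ++ q)[p.length + i]? = T[i]? := fun i hi => by
        rw [List.append_assoc, List.getElem?_append_right (by omega),
          Nat.add_sub_cancel_left, List.getElem?_append_left hi]
      rw [← hpq, h4 w.length (by omega)] at h3
      rw [← h3]
      exact (h4 0 (by omega)).symm
    · have h3 := congrArg List.length h
      have h4 := List.length_pos_iff.2 hp
      have h5 := List.length_pos_iff.2 hq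
      have h6 := (hw b hb).length_le
      simp only [List.length_append] at h3
      omega
  obtain ⟨u, hu, hku, hm⟩ := exists_mem_retImage_of_periodic (g := g) hL hwL hper k
  refine ⟨u, hu, hku, fun d hd => ?_⟩
  rw [tabFst_of_lt hd, h1 _ (List.getElem_mem hd)]
  exact hm

/-- A certificate yields a subgroup that is an image of a return group of minimal order. -/
theorem exists_subgroup_of_cert [Finite G] (hι : Function.Injective ι)
    (hmul : ∀ x y, mul (ι x) (ι y) = ι (x * y)) (hg : ∀ a, ι (g a) = gn a)
    (he : ∃ x, ι x = e) (hσ : IsPrimSubst n σ) (hsL : s ∈ langSub n σ) (hs0 : s ≠ [])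
    (h : UpperCert σ τ n mul gn e s N w (elems mul gn e E R))
    {J N' z : ℕ} {y : List ℕ} {C : List (List ℕ × List ℕ × List ℕ)}
    (h' : PresentationCert σ τ mul gn e s J N' z y C R ∨ PeriodicCert σ τ s N w R) :
    w ∈ langMor n σ τ ∧
      (∀ u ∈ langMor n σ τ, Nat.card (retImage g (langMor n σ τ) w) ≤
        Nat.card (retImage g (langMor n σ τ) u)) ∧
      (∀ k, k ∈ elems mul gn e E R ↔ ∃ x ∈ retImage g (langMor n σ τ) w, ι x = k) ∧
      ∀ a, a ∈ img σ τ N s ↔ [a] ∈ langMor n σ τ := by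
  obtain ⟨he1, hw, K, hK, hwK, hgen⟩ := h.exists_subgroup hι hmul hg he hσ hsL hs0
  have hs : ∀ a b, [a, b] ∈ langSub n σ → [a, b] <:+: s := fun a b => h.2.1.infix hσ hsL hs0
  have hlow : ∀ k, ∃ u ∈ langMor n σ τ, k ≤ u.length ∧
      K ≤ retImage g (langMor n σ τ) u := by
    intro k
    obtain ⟨u, hu, hku, hm⟩ : ∃ u ∈ langMor n σ τ, k ≤ u.length ∧
        ∀ d < R.length, val g (tabFst R d) ∈ retImage g (langMor n σ τ) u := by
      rcases h' with h' | h'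
      · exact h'.exists_mem_retImage hι hmul hg he1 hσ hsL k
      · exact h'.exists_mem_retImage hσ hs h.2.2.1 hw k
    exact ⟨u, hu, hku, hgen _ hm⟩
  obtain ⟨e, hmin⟩ := retImage_eq_of_le hσ.isRecurrentLang_langMor hw hwK hlow
  exact ⟨hw, hmin, by rw [e]; exact hK, mem_img_iff hσ hsL hs N⟩

end Sound

/-! ### Existence of certificates: the upper bound -/

open Filter in
theorem IsPrimSubst.eventually_infix {n : ℕ} {σ : ℕ → List ℕ} (hσ : IsPrimSubst n σ)
    {F : Set (List ℕ)} (hF : F.Finite) (h : F ⊆ langSub n σ) :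
    ∀ᶠ m in atTop, ∀ u ∈ F, ∀ b < n, u <:+: iter σ m [b] := by
  rw [eventually_all_finite hF]
  intro u hu
  obtain ⟨i, hi⟩ := hσ.exists_infix_iter (h hu)
  exact eventually_atTop.2 ⟨i, hi⟩

theorem finite_lists {δ : Type*} {S : Set δ} (hS : S.Finite) (k : ℕ) :
    {l : List δ | l.length ≤ k ∧ ∀ x ∈ l, x ∈ S}.Finite := by
  have := hS.to_subtype
  refine ((List.finite_length_le S k).image (List.map Subtype.val)).subset ?_
  rintro l ⟨h1, h2⟩
  exact ⟨l.attach.map fun x => ⟨x.1, h2 _ x.2⟩, by simpa using h1, by simp⟩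

theorem finite_pairs {n : ℕ} {σ : ℕ → List ℕ} (hσ : IsPrimSubst n σ) (k : ℕ) :
    {u | u ∈ langSub n σ ∧ u.length ≤ k}.Finite :=
  (finite_lists (Set.finite_Iio n) k).subset fun _ hu => ⟨hu.2, hσ.lt_of_mem hu.1⟩

section

variable {G : Type*} [Group G] {ι : G → ℕ} {mul : ℕ → ℕ → ℕ} {g : ℕ → G} {gn : ℕ → ℕ}
  {n : ℕ} {σ : ℕ → List ℕ} {τ : ℕ → ℕ}

/-- In a finite group the generated subgroup is the generated submonoid, so positive words over the
generators suffice. -/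
theorem exists_elems [Finite G] (hmul : ∀ x y, mul (ι x) (ι y) = ι (x * y))
    (hg : ∀ a, ι (g a) = gn a) (R : List (List ℕ × List ℕ)) :
    ∃ E, ∀ k, k ∈ elems mul gn (ι 1) E R ↔
      ∃ x ∈ Subgroup.closure (val g '' {r | r ∈ R.map Prod.fst}), ι x = k := by
  have h1 : ∀ x ∈ Subgroup.closure (val g '' {r | r ∈ R.map Prod.fst}),
      ∃ y : List ℕ, val g (y.flatMap (tabFst R)) = x := by
    intro x hx
    rw [← Subgroup.mem_toSubmonoid, Subgroup.closure_toSubmonoid_of_finite] at hx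
    induction hx using Submonoid.closure_induction with
    | mem x hx =>
      obtain ⟨r, hr, rfl⟩ := hx
      obtain ⟨d, hd, rfl⟩ := List.mem_iff_getElem.1 (show r ∈ R.map Prod.fst from hr)
      exact ⟨[d], by simp only [List.length_map] at hd; simp [tabFst, hd]⟩
    | one => exact ⟨[], rfl⟩
    | mul x y _ _ hx hy =>
      obtain ⟨u, rfl⟩ := hx
      obtain ⟨v, rfl⟩ := hy
      exact ⟨u ++ v, by simp⟩
  have h2 : ∀ y : List ℕ, val g (y.flatMap (tabFst R)) ∈
      Subgroup.closure (val g '' {r | r ∈ R.map Prod.fst}) := by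
    intro y
    rw [val_flatMap]
    refine val_mem fun d _ => ?_
    by_cases hd : d < R.length
    · exact Subgroup.subset_closure ⟨_, List.getElem_mem (l := R.map Prod.fst) (n := d) (by simpa),
        by simp [tabFst, hd]⟩
    · rw [tabFst_of_le (not_lt.1 hd)]; exact one_mem _
  choose! f hf using h1
  have : Fintype G := Fintype.ofFinite G
  -- For `x` outside the subgroup `f x` is an arbitrary word, but its value still lies in the
  -- subgroup by `h2`; listing `f` over all of `G` is harmless.
  refine ⟨(Finset.univ (α := G)).toList.map f, fun k => ?_⟩
  rw [elems, List.mem_map]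
  simp only [wordNum_eq hmul hg rfl]
  constructor
  · rintro ⟨y, -, rfl⟩
    exact ⟨_, h2 y, rfl⟩
  · rintro ⟨x, hx, rfl⟩
    exact ⟨f x, List.mem_map.2 ⟨x, by simp, rfl⟩, by rw [hf x hx]⟩

theorem pairClosed_of_infix (hσ : IsPrimSubst n σ) {s : List ℕ} (hsL : s ∈ langSub n σ)
    (hs : ∀ a b, [a, b] ∈ langSub n σ → [a, b] <:+: s) : PairClosed σ s := by
  intro k _
  have h1 : ((s.flatMap σ).drop k).take 2 ∈ langSub n σ :=
    IsPrimSubst.infix_mem (IsPrimSubst.iter_mem hsL 1)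
      ((List.take_prefix _ _).isInfix.trans (List.drop_suffix _ _).isInfix)
  obtain ⟨a, b, hab, h⟩ := hσ.exists_pair h1 (by simp)
  exact h.trans (hs a b hab)

-- For large i the word σ^i(0) contains all two-letter words, hence is closed in the required sense.
-- The factor between two occurrences of `w`, followed by `w`, is a return covered by the hypothesis
-- `h`. Stating this for all large i lets it be combined with other such conditions.
open Filter in
theorem exists_upperCert [Finite G] (hmul : ∀ x y, mul (ι x) (ι y) = ι (x * y))
    (hg : ∀ a, ι (g a) = gn a) (hσ : IsPrimSubst n σ) {w : List ℕ} (hw : w ∈ langMor n σ τ)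
    {R : List (List ℕ × List ℕ)}
    (h : ∀ r, r ++ w ∈ langMor n σ τ → w <+: r ++ w →
      val g r ∈ Subgroup.closure (val g '' {r | r ∈ R.map Prod.fst})) :
    ∃ E N, ∀ᶠ i in atTop,
      UpperCert σ τ n mul gn (ι 1) (iter σ i [0]) N w (elems mul gn (ι 1) E R) := by
  obtain ⟨E, hE⟩ := exists_elems hmul hg R
  obtain ⟨c, hc, -⟩ := hσ.start
  have h0 : 0 < n := by omega
  obtain ⟨u, hu, rfl⟩ := hw
  obtain ⟨N, hN⟩ := hσ.exists_infix_iter hu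
  refine ⟨E, N, ?_⟩
  filter_upwards [hσ.eventually_infix (finite_pairs hσ 2) fun u hu => hu.1] with i hi
  have hs : ∀ a b, [a, b] ∈ langSub n σ → [a, b] <:+: iter σ i [0] :=
    fun a b hab => hi _ ⟨hab, by simp⟩ 0 h0
  have hsL : iter σ i [0] ∈ langSub n σ := IsPrimSubst.iter_mem (IsPrimSubst.singleton_mem h0) i
  refine ⟨by rw [hmul, one_mul], pairClosed_of_infix hσ hsL hs,
    fun b hb => (hN N le_rfl b hb).map τ, ?_, ?_⟩
  · intro j hj k hk h1 h2
    rw [wordNum_eq hmul hg rfl, hE]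
    have hv : img σ τ N (iter σ i [0]) ∈ langMor n σ τ := img_mem hsL N
    have e : (img σ τ N (iter σ i [0])).drop k =
        ((img σ τ N (iter σ i [0])).drop k).take (j - k) ++ (img σ τ N (iter σ i [0])).drop j := by
      rw [← Nat.add_sub_cancel' (show k ≤ j by omega), ← List.drop_drop,
        Nat.add_sub_cancel_left, List.take_append_drop]
    have h3 : ((img σ τ N (iter σ i [0])).drop k).take (j - k) ++ u.map τ <+:
        (img σ τ N (iter σ i [0])).drop k := by
      conv_rhs => rw [e]
      exact (List.prefix_append_right_inj _).2 h2
    refine ⟨_, h _ (langMor_infix_mem hv (h3.isInfix.trans (List.drop_suffix _ _).isInfix)) ?_, rfl⟩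
    exact List.prefix_of_prefix_length_le h1 h3 (by simp)
  · intro x hx y hy
    obtain ⟨x', hx', rfl⟩ := (hE x).1 hx
    obtain ⟨y', hy', rfl⟩ := (hE y).1 hy
    rw [hmul]
    exact (hE _).2 ⟨x' * y', mul_mem hx' hy', rfl⟩

/-! ### Existence of certificates: periodic languages -/

theorem getElem?_mod_of_periodic {α : Type*} {V : List α} {d : ℕ}
    (h : ∀ i, i + d < V.length → V[i]? = V[i + d]?) (i : ℕ) (hi : i < V.length) :
    V[i]? = V[i % d]? := by
  rcases Nat.eq_zero_or_pos d with rfl | hd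
  · simp
  induction i using Nat.strong_induction_on with
  | _ i ih =>
  rcases lt_or_ge i d with h1 | h1
  · rw [Nat.mod_eq_of_lt h1]
  · have h2 := h (i - d) (by omega)
    rw [Nat.sub_add_cancel h1] at h2
    rw [← h2, ih (i - d) (by omega) (by omega), Nat.mod_eq_sub_mod h1]

/-- With `d` the least period, a nonempty return shorter than `d` would be a smaller period, and a
longer one begins with `w`, which can be split off. -/
theorem val_mem_zpowers_of_periodic {α : Type*} {g : α → G} {L : Set (List α)}
    (hL : IsRecurrentLang L) {d : ℕ} (hd : 0 < d)
    (hper : ∀ T ∈ L, T.length = d + 1 → T[0]? = T[d]?)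
    (hmin : ∀ e, 0 < e → e < d → ∃ T ∈ L, T.length = e + 1 ∧ T[0]? ≠ T[e]?)
    {w : List α} (hwd : w.length = d) {r : List α} (hr : r ++ w ∈ L)
    (hw : w <+: r ++ w) : val g r ∈ Subgroup.closure {val g w} := by
  have hper' := periodic_of_length hL hper
  induction hn : r.length using Nat.strong_induction_on generalizing r with
  | _ m ih =>
  rcases eq_or_ne r [] with rfl | h0
  · exact one_mem _
  have hr0 := List.length_pos_iff.2 h0
  rcases lt_or_ge r.length d with hlt | hge
  · exfalso
    -- `T` violates the period `|r|`, and it is located inside an extension `V` of `r ++ w`. The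
    -- shift by `|r|` preserves the first `d` letters of `V` because `w` is a prefix of `r ++ w`;
    -- reduction of positions modulo `d` extends this to `T`, a contradiction.
    obtain ⟨T, hT, hTl, hne⟩ := hmin r.length hr0 hlt
    obtain ⟨M, hM⟩ := hL.recurrent T hT
    obtain ⟨t, ht, hV⟩ := hL.exists_append hr M
    obtain ⟨p, q, hpq⟩ := hM _ hV (by simp; omega)
    set V := r ++ w ++ t with hVdef
    have hVl : V.length = r.length + d + M := by simp only [hVdef, List.length_append, hwd, ht]
    have h1 : ∀ i < d, V[i]? = V[i + r.length]? := by
      intro i hi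
      obtain ⟨x, hx⟩ := hw
      have e1 : V = r ++ (w ++ t) := by rw [hVdef, List.append_assoc]
      have e2 : V = w ++ (x ++ t) := by rw [hVdef, ← hx, List.append_assoc]
      conv_lhs => rw [e2, List.getElem?_append_left (by omega)]
      conv_rhs => rw [e1, List.getElem?_append_right (by omega), Nat.add_sub_cancel,
        List.getElem?_append_left (by omega)]
    have h2 : ∀ i < T.length, V[p.length + i]? = T[i]? := fun i hi => by
      rw [← hpq, List.append_assoc, List.getElem?_append_right (by omega),
        Nat.add_sub_cancel_left, List.getElem?_append_left hi]
    have hlen : p.length + T.length ≤ V.length := by rw [← hpq]; simp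
    have h3 := getElem?_mod_of_periodic (hper' V hV)
    apply hne
    have hmod : p.length % d < d := Nat.mod_lt _ (by omega)
    rw [← h2 0 (by omega), ← h2 r.length (by omega), add_zero, h3 _ (by omega), h1 _ hmod,
      h3 (p.length + r.length) (by omega), h3 (p.length % d + r.length) (by omega),
      Nat.mod_add_mod]
  · obtain ⟨q, rfl⟩ : w <+: r :=
      List.prefix_of_prefix_length_le hw (List.prefix_append _ _) (by omega)
    simp only [List.length_append] at hn hr0
    rw [val_append]
    refine mul_mem (Subgroup.subset_closure rfl) (ih q.length (by omega)
      (hL.infix_mem hr (by rw [List.append_assoc]; exact (List.suffix_append _ _).isInfix)) ?_ rfl)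
    rw [List.prefix_iff_getElem?]
    intro i hi
    have h1 := hper' _ hr i (by simp; omega)
    rw [List.append_assoc, List.getElem?_append_left hi,
      List.getElem?_append_right (by omega), hwd, Nat.add_sub_cancel] at h1
    rw [← h1]; simp [hi]

open Filter in
theorem exists_cert_of_periodic [Finite G] (hmul : ∀ x y, mul (ι x) (ι y) = ι (x * y))
    (hg : ∀ a, ι (g a) = gn a) (hσ : IsPrimSubst n σ)
    (hper : ∃ d, 0 < d ∧ ∀ T ∈ langMor n σ τ, T.length = d + 1 → T[0]? = T[d]?) :
    ∃ E N w R, ∀ᶠ i in atTop,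
      UpperCert σ τ n mul gn (ι 1) (iter σ i [0]) N w (elems mul gn (ι 1) E R) ∧
      PeriodicCert σ τ (iter σ i [0]) N w R := by
  classical
  have hL : IsRecurrentLang (langMor n σ τ) := hσ.isRecurrentLang_langMor
  obtain ⟨hd, hper'⟩ := Nat.find_spec hper
  set d := Nat.find hper with hd_def
  have hmin : ∀ e, 0 < e → e < d → ∃ T ∈ langMor n σ τ, T.length = e + 1 ∧ T[0]? ≠ T[e]? := by
    intro e he hed
    have := Nat.find_min hper hed
    push Not at this
    exact this he
  obtain ⟨c, hc, -⟩ := hσ.start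
  have h0 : 0 < n := by omega
  obtain ⟨w, hwd, hw⟩ := hL.exists_append
    (hL.infix_mem (img_mem (τ := τ) (IsPrimSubst.singleton_mem hc) 0) List.nil_infix) d
  rw [List.nil_append] at hw
  -- Any word of length equal to the least period serves as `w`. The second component `[]` is a
  -- filler: a periodic certificate uses only the first components of its table.
  obtain ⟨E, N, h⟩ := exists_upperCert hmul hg hσ hw (R := [(w, [])]) fun r hr hwr => by
    have := val_mem_zpowers_of_periodic (g := g) hL hd hper' hmin hwd hr hwr
    refine Subgroup.closure_mono ?_ this
    rintro _ rfl
    exact ⟨w, by simp, rfl⟩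
  refine ⟨E, N, w, [(w, [])], h.mono fun i hi => ⟨hi, by simp, fun k hk hkw => ?_⟩⟩
  rw [hwd] at hkw ⊢
  exact periodic_of_length hL hper' _
    (img_mem (IsPrimSubst.iter_mem (IsPrimSubst.singleton_mem h0) i) N) k hkw

end

/-! ### Existence of certificates: coding by return words -/

theorem exists_append_of_mem_dec {α : Type*} [DecidableEq α] {w v r : List α}
    (h : r ∈ dec w v) :
    ∃ x y, v = x ++ r ++ y ∧ w <+: y ++ w := by
  obtain ⟨l₁, l₂, e⟩ := List.append_of_mem h
  have h1 := dec_flatten w v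
  rw [e] at h1
  refine ⟨l₁.flatten, l₂.flatten, by rw [← h1]; simp, prefix_flatten fun b hb => ?_⟩
  refine prefix_of_mem_tail_dec b (v := v) ?_
  rw [e]
  rcases l₁ with _ | ⟨a, l₁⟩
  · exact hb
  · simp [hb]

theorem length_le_of_forall_le {α : Type*} {rs : List (List α)} {k : ℕ} (h0 : rs.flatten ≠ [])
    (h : ∀ r ∈ rs, rs.flatten.length ≤ k * r.length) : rs.length ≤ k := by
  have key : ∀ (l : ℕ) (xs : List (List α)), (∀ r ∈ xs, l ≤ k * r.length) →
      xs.length * l ≤ k * xs.flatten.length := by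
    intro l xs hx
    induction xs with
    | nil => simp
    | cons x xs ih =>
      have h1 := hx x (by simp)
      have h2 := ih fun r hr => hx r (by simp [hr])
      simp only [List.length_cons, List.flatten_cons, List.length_append]
      rw [add_mul, mul_add]
      omega
  exact Nat.le_of_mul_le_mul_right (key _ rs h) (List.length_pos_iff.2 h0)

theorem getD_map_idxOf {α δ : Type*} [BEq α] [LawfulBEq α] {l : List α} {a : α} (h : a ∈ l)
    (f : α → δ) (d : δ) : (l.map f).getD (l.idxOf a) d = f a := by
  rw [List.getD_eq_getElem?_getD, List.getElem?_map, List.getElem?_idxOf h]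
  rfl

theorem flatMap_map_idxOf {α δ : Type*} [BEq α] [LawfulBEq α] {l : List α} {h : ℕ → List δ}
    {f : α → List δ} (e : ∀ a ∈ l, h (l.idxOf a) = f a) {x : List α} (hx : ∀ a ∈ x, a ∈ l) :
    (x.map fun a => l.idxOf a).flatMap h = x.flatMap f := by
  rw [List.flatMap_map]
  exact List.flatMap_congr fun a ha => e a (hx a ha)

theorem iter_flatten {β : Type*} {σ : β → List β} (m : ℕ) (xs : List (List β)) :
    iter σ m xs.flatten = xs.flatMap (iter σ m) := by
  induction xs with
  | nil => simp
  | cons x xs ih => simp [ih]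

theorem img_flatten {σ : ℕ → List ℕ} {τ : ℕ → ℕ} (m : ℕ) (xs : List (List ℕ)) :
    img σ τ m xs.flatten = xs.flatMap (img σ τ m) := by
  induction xs with
  | nil => simp
  | cons x xs ih => simp [ih]

/-- A letter `c` whose image starts with `c`, and a first return `c₀` to `c` such that
`σ ^ p (c)` starts with `c₀ c`. -/
structure FirstReturn (n : ℕ) (σ : ℕ → List ℕ) (c p : ℕ) (c₀ : List ℕ) : Prop where
  prim : IsPrimSubst n σ
  lt : c < n
  start : [c] <+: σ c
  head : [c] <+: c₀
  dec_eq : dec [c] c₀ = [c₀]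
  pre : c₀ ++ [c] <+: iter σ p [c]

/-- With σ(c) = c b t, the word σ^(k+1)(c) starts with σ^k(c), which begins with c, and has another
c inside σ^k(b). Cutting what precedes this c at the occurrences of c, the first block is `c₀`. -/
theorem IsPrimSubst.exists_firstReturn {n : ℕ} {σ : ℕ → List ℕ} (hσ : IsPrimSubst n σ) :
    ∃ c p c₀, FirstReturn n σ c p c₀ := by
  obtain ⟨c, hc, t, ht, hct⟩ := hσ.start
  obtain ⟨k, hk⟩ := hσ.exists_mem_iter
  have hst : [c] <+: σ c := ⟨t, by rw [hct]; rfl⟩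
  have hsi : [c] <+: iter σ k [c] := by
    have : ∀ m, [c] <+: iter σ m [c] := by
      intro m
      induction m with
      | zero => exact List.prefix_rfl
      | succ m ih =>
        rw [iter_add, iter_one, List.flatMap_singleton]
        exact ih.trans (iter_prefix m hst)
    exact this k
  obtain ⟨b, t, rfl⟩ := List.exists_cons_of_ne_nil ht
  obtain ⟨x, hx⟩ := hsi
  obtain ⟨y, z, hyz⟩ := List.append_of_mem (hk k le_rfl c hc b (hσ.lt c hc b (by rw [hct]; simp)))
  have e : iter σ (k + 1) [c] = (c :: x ++ y) ++ c :: (z ++ iter σ k t) := by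
    rw [iter_add, iter_one, List.flatMap_singleton, hct, iter_cons, iter_cons k b, ← hx, hyz]
    simp
  have hv : [c] <+: (c :: x ++ y) ++ [c] := ⟨x ++ y ++ [c], by simp⟩
  obtain ⟨c₀, rest, hd⟩ := List.exists_cons_of_ne_nil (dec_ne_nil (w := [c])
    (v := c :: x ++ y) (by simp))
  have hmem : c₀ ∈ dec [c] (c :: x ++ y) := by rw [hd]; simp
  have hfl := dec_flatten [c] (c :: x ++ y)
  rw [hd, List.flatten_cons] at hfl
  have hrest : [c] <+: rest.flatten ++ [c] := prefix_flatten fun r hr =>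
    prefix_of_mem_tail_dec r (v := c :: x ++ y) (by rw [hd]; exact hr)
  refine ⟨c, k + 1, c₀, hσ, hc, hst, ?_, dec_eq_singleton hv hmem, ?_⟩
  · obtain ⟨a, l, rfl⟩ := List.exists_cons_of_ne_nil (ne_nil_of_mem_dec hmem)
    have := prefix_of_mem_dec hv hmem
    simpa using this
  · rw [e, ← hfl, List.append_assoc]
    refine (List.prefix_append_right_inj _).2 (hrest.trans ?_)
    exact (List.prefix_append_right_inj _).2 ⟨z ++ iter σ k t, by simp⟩

/-- The return words to `c` that occur in the words `σ ^ j (c₀)`. -/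
def returnBlocks (σ : ℕ → List ℕ) (c : ℕ) (c₀ : List ℕ) : Set (List ℕ) :=
  {b | ∃ j, b ∈ dec [c] (iter σ j c₀)}

/-- The decomposition of the word `τ (σ ^ (p t + p) (b))` at the occurrences of
`τ (σ ^ (p t) (c₀))`. -/
def blockDec (σ : ℕ → List ℕ) (τ : ℕ → ℕ) (p : ℕ) (c₀ : List ℕ) (t : ℕ) (b : List ℕ) :
    List (List ℕ) :=
  dec (img σ τ (p * t) c₀) (img σ τ (p * t + p) b)

namespace FirstReturn

variable {n : ℕ} {σ : ℕ → List ℕ} {τ : ℕ → ℕ} {c p : ℕ} {c₀ : List ℕ}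

theorem start_iter (h : FirstReturn n σ c p c₀) {x : List ℕ} (hx : [c] <+: x) (m : ℕ) :
    [c] <+: iter σ m x := by
  refine List.IsPrefix.trans ?_ (iter_prefix m hx)
  induction m with
  | zero => exact List.prefix_rfl
  | succ m ih =>
    rw [iter_add, iter_one, List.flatMap_singleton]
    exact ih.trans (iter_prefix m h.start)

theorem mem_langSub (h : FirstReturn n σ c p c₀) : c₀ ∈ langSub n σ :=
  IsPrimSubst.infix_mem (IsPrimSubst.iter_mem (IsPrimSubst.singleton_mem h.lt) p)
    ((List.prefix_append _ _).trans h.pre).isInfix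

theorem iter_ne_nil (h : FirstReturn n σ c p c₀) {x : List ℕ} (hx : [c] <+: x) (m : ℕ) :
    iter σ m x ≠ [] := by
  obtain ⟨y, hy⟩ := h.start_iter hx m
  rw [← hy]; simp

theorem head_block (h : FirstReturn n σ c p c₀) {b : List ℕ} (hb : b ∈ returnBlocks σ c c₀) :
    [c] <+: b := by
  obtain ⟨j, hb⟩ := hb
  have h1 := prefix_of_mem_dec ((h.start_iter h.head j).trans (List.prefix_append _ _)) hb
  obtain ⟨a, l, rfl⟩ := List.exists_cons_of_ne_nil (ne_nil_of_mem_dec hb)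
  simpa using h1

theorem dec_block (h : FirstReturn n σ c p c₀) {b : List ℕ} (hb : b ∈ returnBlocks σ c c₀) :
    dec [c] b = [b] := by
  obtain ⟨j, hb⟩ := hb
  exact dec_eq_singleton ((h.start_iter h.head j).trans (List.prefix_append _ _)) hb

theorem mem_returnBlocks (h : FirstReturn n σ c p c₀) : c₀ ∈ returnBlocks σ c c₀ :=
  ⟨0, by rw [iter_zero, h.dec_eq]; simp⟩

theorem dec_iter_mem (h : FirstReturn n σ c p c₀) {b : List ℕ} (hb : b ∈ returnBlocks σ c c₀)
    (m : ℕ) : ∀ b' ∈ dec [c] (iter σ m b), b' ∈ returnBlocks σ c c₀ := by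
  obtain ⟨j, hb⟩ := hb
  intro b' hb'
  refine ⟨m + j, ?_⟩
  rw [iter_add, ← dec_flatten [c] (iter σ j c₀), iter_flatten, dec_flatMap fun x hx =>
    (h.start_iter (h.head_block ⟨j, hx⟩) m).trans (List.prefix_append _ _)]
  exact List.mem_flatMap.2 ⟨b, hb, hb'⟩

theorem append_mem (h : FirstReturn n σ c p c₀) {b : List ℕ} (hb : b ∈ returnBlocks σ c c₀) :
    b ++ [c] ∈ langSub n σ := by
  obtain ⟨j, hb⟩ := hb
  obtain ⟨x, y, e, hy⟩ := exists_append_of_mem_dec hb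
  have h1 : iter σ j (c₀ ++ [c]) ∈ langSub n σ := IsPrimSubst.iter_mem
    (IsPrimSubst.infix_mem (IsPrimSubst.iter_mem (IsPrimSubst.singleton_mem h.lt) p)
      h.pre.isInfix) j
  refine IsPrimSubst.infix_mem h1 ?_
  obtain ⟨z, hz⟩ := h.start_iter (List.prefix_refl [c]) j
  obtain ⟨u, hu⟩ := hy
  refine ⟨x, u ++ z, ?_⟩
  rw [iter_append, e, ← hz, ← List.append_assoc _ [c], List.append_assoc _ y, ← hu]
  simp

/-- Gaps between occurrences of `c` are bounded. A block longer than the bound would contain `c`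
again and be cut there, although blocks are indecomposable. -/
theorem finite_returnBlocks (h : FirstReturn n σ c p c₀) : (returnBlocks σ c c₀).Finite := by
  obtain ⟨M, hM⟩ := h.prim.isRecurrentLang.recurrent [c] (IsPrimSubst.singleton_mem h.lt)
  refine (finite_pairs h.prim (M + 1)).subset fun b hb => ⟨?_, ?_⟩
  · exact IsPrimSubst.infix_mem (h.append_mem hb) (List.prefix_append _ _).isInfix
  · by_contra hlen
    obtain ⟨y, rfl⟩ := h.head_block hb
    have h1 : [c] <+: y ∨ c ∈ y.tail := by
      have h2 := hM y (IsPrimSubst.infix_mem (h.append_mem hb) ⟨[c], [c], rfl⟩)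
        (by simp at hlen; omega)
      rw [List.singleton_infix_iff] at h2
      rcases y with _ | ⟨a, y⟩
      · simp at h2
      · rcases List.mem_cons.1 h2 with rfl | h2
        · exact Or.inl ⟨y, rfl⟩
        · exact Or.inr h2
    obtain ⟨u, v, rfl⟩ : ∃ u v, y = u ++ c :: v := by
      rcases h1 with ⟨v, rfl⟩ | h1
      · exact ⟨[], v, rfl⟩
      · exact List.append_of_mem (List.mem_of_mem_tail h1)
    have h2 := h.dec_block hb
    rw [← List.append_assoc, dec_append _ ⟨v ++ [c], by simp⟩] at h2
    have h3 := congrArg List.length h2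
    have h4 := List.length_pos_iff.2 (dec_ne_nil (w := [c]) (v := [c] ++ u) (by simp))
    have h5 := List.length_pos_iff.2 (dec_ne_nil (w := [c]) (v := c :: v) (by simp))
    simp only [List.length_append, List.length_singleton] at h3
    omega

/-- The additional exponent `p` is needed because σ^p(c) starts with `c₀`: the images of all words
starting with `c` then start with the same τ(σ^(pt)(c₀)). -/
theorem prefix_img (h : FirstReturn n σ c p c₀) (t : ℕ) {x : List ℕ} (hx : [c] <+: x) :
    img σ τ (p * t) c₀ <+: img σ τ (p * t + p) x := by
  rw [img_add]
  exact img_prefix _ (((List.prefix_append _ _).trans h.pre).trans (iter_prefix p hx))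

theorem prefix_img_append (h : FirstReturn n σ c p c₀) (t : ℕ) {x : List ℕ} (hx : [c] <+: x)
    (z : List ℕ) : img σ τ (p * t) c₀ <+: img σ τ (p * t + p) x ++ z :=
  (h.prefix_img t hx).trans (List.prefix_append _ _)

/-- The image of each return block starts with the word at which one cuts, so the cuts at the letter
`c` persist in the image and the decomposition proceeds block by block. -/
theorem dec_img_iter (h : FirstReturn n σ c p c₀) (t j : ℕ) {b : List ℕ}
    (hb : b ∈ returnBlocks σ c c₀) :
    dec (img σ τ (p * t) c₀) (img σ τ (p * t + p) (iter σ j b)) =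
      (dec [c] (iter σ j b)).flatMap (blockDec σ τ p c₀ t) := by
  conv_lhs => rw [← dec_flatten [c] (iter σ j b)]
  rw [img_flatten, dec_flatMap fun x hx => h.prefix_img_append t (h.head_block (h.dec_iter_mem hb j x hx)) _]
  rfl

/-- A return followed by τ(σ^(pt)(c₀)) occurs in the image of some σ^j(c₀), with cuts at both of its
ends. Its pieces are therefore among the blocks found there. -/
theorem mem_of_mem_dec_return (h : FirstReturn n σ c p c₀) (t : ℕ) {r : List ℕ}
    (hr : r ++ img σ τ (p * t) c₀ ∈ langMor n σ τ)
    (hw : img σ τ (p * t) c₀ <+: r ++ img σ τ (p * t) c₀) :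
    ∀ x ∈ dec (img σ τ (p * t) c₀) r,
      ∃ b ∈ returnBlocks σ c c₀, x ∈ blockDec σ τ p c₀ t b := by
  obtain ⟨z, hz, hrz⟩ := h.prim.exists_infix_img hr (p * t + p)
  obtain ⟨j, hj⟩ := h.prim.exists_infix_iter hz
  have hz' : z <:+: iter σ j c₀ :=
    (hj j le_rfl c h.lt).trans (iter_prefix j h.head).isInfix
  obtain ⟨u, v, huv⟩ := hrz.trans (img_infix _ hz')
  set w := img σ τ (p * t) c₀
  intro x hx
  have h1 := h.dec_img_iter (τ := τ) t j h.mem_returnBlocks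
  rw [← huv, show u ++ (r ++ w) ++ v = u ++ (r ++ (w ++ v)) by simp, dec_append, dec_append]
    at h1
  · have h2 : x ∈ (dec [c] (iter σ j c₀)).flatMap (blockDec σ τ p c₀ t) := by
      rw [← h1]; exact List.mem_append_right _ (List.mem_append_left _ hx)
    obtain ⟨b, hb, hxb⟩ := List.mem_flatMap.1 h2
    exact ⟨b, ⟨j, hb⟩, hxb⟩
  · rw [List.append_assoc]; exact List.prefix_append _ _
  · rw [← List.append_assoc, List.append_assoc]
    exact hw.trans (List.prefix_append _ _)

/-- In the aperiodic case, return words to `τ (σ ^ (p t) (c₀))` are long. -/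
theorem exists_length_lt (h : FirstReturn n σ c p c₀)
    (hap : ∀ d, 0 < d → ∃ T ∈ langMor n σ τ, T.length = d + 1 ∧ T[0]? ≠ T[d]?) :
    ∃ e, ∀ q t, p * t = q + e → ∀ r, r ≠ [] →
      img σ τ (p * t) c₀ <+: r ++ img σ τ (p * t) c₀ →
      ∃ b < n, (iter σ q [b]).length < r.length := by
  obtain ⟨e, he⟩ := (h.prim.eventually_infix (finite_pairs h.prim 2) fun u hu => hu.1).exists
  refine ⟨e, fun q t hqt r hr hw => ?_⟩
  -- If `|r|` is at most every `|σ^q(b)|`, a word `T` violating the period `|r|` fits in the image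
  -- under τσ^q of a two-letter word. All of these occur in σ^e(c₀), so `T` is a factor of
  -- τ(σ^(pt)(c₀)), which has period `|r|` since it is a prefix of `r` followed by itself.
  by_contra! hle
  obtain ⟨T, hT, hTl, hne⟩ := hap r.length (List.length_pos_iff.2 hr)
  rcases h.prim.infix_img_pair hT q with ⟨a, b, hab, hTq⟩ | ⟨b, hb, x, y, hx, hy, hTq⟩
  · have h1 : [a, b] <:+: iter σ e c₀ :=
      (he _ ⟨hab, by simp⟩ c h.lt).trans (iter_prefix e h.head).isInfix
    obtain ⟨x, y, hxy⟩ := hTq.trans (img_infix q h1)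
    rw [← img_add, ← hqt] at hxy
    have h2 : ∀ i < T.length, (img σ τ (p * t) c₀)[x.length + i]? = T[i]? := fun i hi => by
      rw [← hxy, List.append_assoc, List.getElem?_append_right (by omega),
        Nat.add_sub_cancel_left, List.getElem?_append_left hi]
    set w := img σ τ (p * t) c₀
    have hlen : x.length + T.length ≤ w.length := by rw [← hxy]; simp
    obtain ⟨z, hz⟩ := hw
    apply hne
    rw [← h2 0 (by omega), ← h2 r.length (by omega)]
    calc w[x.length + 0]? = (r ++ w)[r.length + x.length]? := by
          rw [List.getElem?_append_right (by omega), Nat.add_sub_cancel_left, add_zero]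
      _ = w[x.length + r.length]? := by
          rw [← hz, List.getElem?_append_left (by omega), add_comm]
  · have h1 := congrArg List.length hTq
    have h2 := List.length_pos_iff.2 hx
    have h3 := List.length_pos_iff.2 hy
    have h4 := hle b hb
    simp only [List.length_append, length_img] at h1
    omega

theorem prefix_of_mem_blockDec (h : FirstReturn n σ c p c₀) {t : ℕ} {b r : List ℕ}
    (hb : b ∈ returnBlocks σ c c₀) (hr : r ∈ blockDec σ τ p c₀ t b) :
    img σ τ (p * t) c₀ <+: r ++ img σ τ (p * t) c₀ :=
  prefix_of_mem_dec (h.prefix_img_append t (h.head_block hb) _) hr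

theorem pos (h : FirstReturn n σ c p c₀) : 0 < p := by
  rcases Nat.eq_zero_or_pos p with rfl | hp
  · have h1 := h.pre.length_le
    have h2 := h.head.length_le
    simp at h1 h2
    simp [h1] at h2
  · exact hp

-- Write pt = q + e. The image of `b` has length at most a constant times `|σ^q(b')|`, for any
-- letter b', while each of its blocks is longer than some `|σ^q(b')|`. So the number of blocks is
-- bounded independently of `t`.
open Filter in
theorem exists_blockDec_length_le (h : FirstReturn n σ c p c₀)
    (hap : ∀ d, 0 < d → ∃ T ∈ langMor n σ τ, T.length = d + 1 ∧ T[0]? ≠ T[d]?) :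
    ∃ κ, ∀ᶠ t in atTop, ∀ b ∈ returnBlocks σ c c₀, (blockDec σ τ p c₀ t b).length ≤ κ := by
  obtain ⟨e, he⟩ := h.exists_length_lt hap
  obtain ⟨κ, k, hκ⟩ := h.prim.exists_length_ratio (e + p)
  obtain ⟨M, hM⟩ : ∃ M, ∀ b ∈ returnBlocks σ c c₀, b.length ≤ M :=
    (h.finite_returnBlocks.image List.length).bddAbove.imp fun M hM b hb => hM ⟨b, hb, rfl⟩
  refine ⟨κ * M, eventually_atTop.2 ⟨k + e, fun t ht b hb => ?_⟩⟩
  have hpt : k + e ≤ p * t := ht.trans (Nat.le_mul_of_pos_left t h.pos)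
  obtain ⟨q, hq⟩ := Nat.exists_eq_add_of_le' (show e ≤ p * t by omega)
  have hfl : (blockDec σ τ p c₀ t b).flatten = img σ τ (p * t + p) b := dec_flatten _ _
  refine length_le_of_forall_le ?_ fun r hr => ?_
  · rw [hfl, ← List.length_pos_iff, length_img, List.length_pos_iff]
    exact h.iter_ne_nil (h.head_block hb) _
  · obtain ⟨b', hb', hlt⟩ := he q t hq r (ne_nil_of_mem_dec hr) (h.prefix_of_mem_blockDec hb hr)
    have hbn : ∀ a ∈ b, a < n := fun a ha => h.prim.lt_of_mem (h.append_mem hb) a (by simp [ha])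
    have h1 := hκ q (by omega) b hbn b' hb'
    rw [hfl, length_img, hq, show q + e + p = q + (e + p) by ring]
    exact h1.trans (Nat.mul_le_mul (Nat.mul_le_mul_left _ (hM b hb)) hlt.le)

open Filter in
theorem eventually_lt_length (h : FirstReturn n σ c p c₀)
    (hap : ∀ d, 0 < d → ∃ T ∈ langMor n σ τ, T.length = d + 1 ∧ T[0]? ≠ T[d]?) (l : ℕ) :
    ∀ᶠ t in atTop, ∀ b ∈ returnBlocks σ c c₀, ∀ r ∈ blockDec σ τ p c₀ t b, l < r.length := by
  obtain ⟨e, he⟩ := h.exists_length_lt hap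
  obtain ⟨k, hk⟩ := h.prim.exists_le_length l
  refine eventually_atTop.2 ⟨k + e, fun t ht b hb r hr => ?_⟩
  have hpt : k + e ≤ p * t := ht.trans (Nat.le_mul_of_pos_left t h.pos)
  obtain ⟨q, hq⟩ := Nat.exists_eq_add_of_le' (show e ≤ p * t by omega)
  obtain ⟨b', hb', hlt⟩ := he q t hq r (ne_nil_of_mem_dec hr) (h.prefix_of_mem_blockDec hb hr)
  exact (hk q (by omega) b' hb').trans_lt hlt

/-- Of the two additional exponents `p`, one is used by the left side itself, the other makes σ^p(c)
start with `c₀ c`. -/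
theorem img_append_prefix (h : FirstReturn n σ c p c₀) {t t' : ℕ} (ht : t + 2 ≤ t') :
    img σ τ (p * t + p) c₀ ++ img σ τ (p * t) c₀ <+: img σ τ (p * t') c₀ := by
  obtain ⟨j, rfl⟩ := Nat.exists_eq_add_of_le ht
  rw [show p * (t + 2 + j) = (p * t + p) + (p + p * j) by ring,
    img_add (p * t + p) (p + p * j)]
  have h1 : c₀ ++ [c] <+: iter σ (p + p * j) c₀ := by
    rw [iter_add]
    exact h.pre.trans (iter_prefix p (h.start_iter h.head _))
  refine List.IsPrefix.trans ?_ (img_prefix _ h1)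
  rw [img_append]
  exact (List.prefix_append_right_inj _).2 (h.prefix_img t List.prefix_rfl)

/-- All return words to a long prefix decompose into return words to a short one, starting with the
same one. -/
theorem head_dec_block (h : FirstReturn n σ c p c₀) {t t' : ℕ} (ht : t + 2 ≤ t')
    {b r : List ℕ} (hb : b ∈ returnBlocks σ c c₀) (hr : r ∈ blockDec σ τ p c₀ t' b) :
    (dec (img σ τ (p * t) c₀) r).head? = (blockDec σ τ p c₀ t c₀).head? := by
  obtain ⟨y, hy⟩ := h.img_append_prefix (τ := τ) ht
  obtain ⟨x, hx⟩ := h.prefix_of_mem_blockDec hb hr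
  have hww : img σ τ (p * t) c₀ <+: img σ τ (p * t') c₀ := by
    rw [← hy, List.append_assoc]
    exact h.prefix_img_append t h.head _
  -- The word r τ(σ^(pt')(c₀)) is decomposed in two ways, once starting with the blocks of `r` and
  -- once with those of τ(σ^(pt+p)(c₀)); the first blocks must agree.
  have e1 := dec_append r (hww.trans (List.prefix_append _ (img σ τ (p * t) c₀)))
  have e2 := dec_append (w := img σ τ (p * t) c₀) (img σ τ (p * t + p) c₀)
    (v := img σ τ (p * t) c₀ ++ (y ++ x)) (by
      rw [List.append_assoc]; exact List.prefix_append _ _)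
  have e3 : img σ τ (p * t + p) c₀ ++ (img σ τ (p * t) c₀ ++ (y ++ x)) =
      r ++ img σ τ (p * t') c₀ := by
    rw [← hx, ← hy]; simp
  rw [e3, e1] at e2
  have e4 := congrArg List.head? e2
  rw [List.head?_append_of_ne_nil _ (dec_ne_nil (ne_nil_of_mem_dec hr)),
    List.head?_append_of_ne_nil] at e4
  · exact e4
  · refine dec_ne_nil ?_
    rw [← List.length_pos_iff, length_img, List.length_pos_iff]
    exact h.iter_ne_nil h.head _

/-- Both sides cut τ(σ^(pt'+p)(b)) at τ(σ^(pt)(c₀)), the left one through the returns at level t',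
the right one through the return blocks of σ^(p(t'-t))(b). This becomes the intertwining relation
between σ and ρ. -/
theorem dec_blockDec (h : FirstReturn n σ c p c₀) {t t' : ℕ} (ht : t + 2 ≤ t') {b : List ℕ}
    (hb : b ∈ returnBlocks σ c c₀) :
    (blockDec σ τ p c₀ t' b).flatMap (dec (img σ τ (p * t) c₀)) =
      (dec [c] (iter σ (p * (t' - t)) b)).flatMap (blockDec σ τ p c₀ t) := by
  have hww : img σ τ (p * t) c₀ <+: img σ τ (p * t') c₀ := by
    refine List.IsPrefix.trans ?_ (h.img_append_prefix ht)
    exact h.prefix_img_append t h.head _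
  rw [← h.dec_img_iter t _ hb, ← img_add, show p * t + p + p * (t' - t) = p * t' + p by
    rw [add_right_comm, ← mul_add, Nat.add_sub_cancel' (by omega)]]
  rw [← dec_flatten_of_prefix]
  · rw [blockDec, dec_flatten]
  · intro r hr
    have h1 := hww.trans (h.prefix_of_mem_blockDec hb hr)
    refine List.prefix_of_prefix_length_le h1 ((List.prefix_append_right_inj r).2 hww) (by simp)

end FirstReturn

/-! ### Existence of certificates: the aperiodic case -/

open Filter in
/-- A function that eventually takes its values in a finite set takes some value infinitely
often. -/
theorem exists_frequently_eq {γ : Type*} {F : ℕ → γ} {S : Set γ} (hS : S.Finite)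
    (h : ∀ᶠ t in atTop, F t ∈ S) : ∃ x, ∃ᶠ t in atTop, F t = x := by
  by_contra! hx
  have h1 : ∀ᶠ t in atTop, ∀ x ∈ S, F t ≠ x :=
    (eventually_all_finite hS).2 fun x _ => hx x
  obtain ⟨t, ht⟩ := (h.and h1).exists
  exact ht.2 _ ht.1 rfl

theorem infix_pair_of_append {α : Type*} {x y : List α} {r : α} {l : List α}
    (e : l = x ++ r :: y) (hy : y ≠ []) : ∃ r' ∈ l, [r, r'] <:+: l := by
  obtain ⟨a, y, rfl⟩ := List.exists_cons_of_ne_nil hy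
  exact ⟨a, by simp [e], x, y, by simp [e]⟩

namespace FirstReturn

variable {n : ℕ} {σ : ℕ → List ℕ} {τ : ℕ → ℕ} {c p : ℕ} {c₀ : List ℕ}
  {G : Type*} [Group G] {ι : G → ℕ} {mul : ℕ → ℕ → ℕ} {g : ℕ → G} {gn : ℕ → ℕ}

-- For large m the word σ^m(c₀) contains every b c; the final c guarantees that b appears as a block
-- and is not the last one.
open Filter in
theorem exists_infix_dec (h : FirstReturn n σ c p c₀) :
    ∃ m, ∀ b ∈ returnBlocks σ c c₀, ∃ x y, y ≠ [] ∧ dec [c] (iter σ m c₀) = x ++ b :: y := by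
  obtain ⟨m, hm⟩ := (h.prim.eventually_infix (F := (· ++ [c]) '' returnBlocks σ c c₀)
    (h.finite_returnBlocks.image _) (by rintro _ ⟨b, hb, rfl⟩; exact h.append_mem hb)).exists
  refine ⟨m, fun b hb => ?_⟩
  obtain ⟨u, v, huv⟩ := (hm _ ⟨b, hb, rfl⟩ c h.lt).trans (iter_prefix m h.head).isInfix
  refine ⟨dec [c] u, dec [c] (c :: v), dec_ne_nil (by simp), ?_⟩
  have e : u ++ (b ++ [c]) ++ v = u ++ (b ++ (c :: v)) := by simp
  rw [← huv, e, dec_append u, dec_append b, h.dec_block hb]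
  · simp
  · exact ⟨v ++ [c], by simp⟩
  · rw [List.append_assoc]
    exact (h.head_block hb).trans (List.prefix_append _ _)

theorem exists_list (h : FirstReturn n σ c p c₀) :
    ∃ cs : List (List ℕ), ∀ b, b ∈ cs ↔ b ∈ returnBlocks σ c c₀ := by
  classical
  exact ⟨h.finite_returnBlocks.toFinset.toList, fun b => by simp⟩

/-- The list of all return words to `τ (σ ^ (p t) (c₀))`. -/
def blocks (σ : ℕ → List ℕ) (τ : ℕ → ℕ) (p : ℕ) (c₀ : List ℕ) (cs : List (List ℕ)) (t : ℕ) :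
    List (List ℕ) :=
  (cs.flatMap (blockDec σ τ p c₀ t)).dedup

theorem mem_blocks {cs : List (List ℕ)} {t : ℕ} {r : List ℕ} :
    r ∈ blocks σ τ p c₀ cs t ↔ ∃ b ∈ cs, r ∈ blockDec σ τ p c₀ t b := by
  simp [blocks]

/-- The coding of the images of the letters by return words, and the values of these. -/
def codeAt (g : ℕ → G) (σ : ℕ → List ℕ) (τ : ℕ → ℕ) (p : ℕ) (c₀ : List ℕ) (cs : List (List ℕ))
    (t : ℕ) : List (List ℕ) × List G :=
  (cs.map fun b => (blockDec σ τ p c₀ t b).map fun r => (blocks σ τ p c₀ cs t).idxOf r,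
    (blocks σ τ p c₀ cs t).map (val g))

-- The number of blocks is bounded independently of `t` and `G` is finite, so the coding takes
-- finitely many values for large `t` and some value recurs infinitely often. The later level t' can
-- be chosen so far away that all its blocks are longer than those at level t.
open Filter in
theorem exists_codeAt_eq [Finite G] (h : FirstReturn n σ c p c₀)
    (hap : ∀ d, 0 < d → ∃ T ∈ langMor n σ τ, T.length = d + 1 ∧ T[0]? ≠ T[d]?)
    {cs : List (List ℕ)} (hcs : ∀ b, b ∈ cs ↔ b ∈ returnBlocks σ c c₀) (g : ℕ → G) :
    ∃ t t', t + 2 ≤ t' ∧ codeAt g σ τ p c₀ cs t = codeAt g σ τ p c₀ cs t' ∧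
      ∀ r ∈ blocks σ τ p c₀ cs t, ∀ r' ∈ blocks σ τ p c₀ cs t', r.length < r'.length := by
  obtain ⟨κ, hκ⟩ := h.exists_blockDec_length_le hap
  have hlen : ∀ t, (∀ b ∈ returnBlocks σ c c₀, (blockDec σ τ p c₀ t b).length ≤ κ) →
      (blocks σ τ p c₀ cs t).length ≤ cs.length * κ := by
    intro t ht
    refine ((List.dedup_sublist _).length_le).trans ?_
    rw [List.length_flatMap]
    refine (List.sum_le_card_nsmul _ κ ?_).trans (by simp)
    intro x hx
    obtain ⟨b, hb, rfl⟩ := List.mem_map.1 hx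
    exact ht b ((hcs b).1 hb)
  have hfin := ((finite_lists (finite_lists (Set.finite_Iio (cs.length * κ)) κ) cs.length).prod
    (finite_lists (Set.finite_univ (α := G)) (cs.length * κ)))
  obtain ⟨x, hx⟩ := exists_frequently_eq (F := codeAt g σ τ p c₀ cs) hfin (by
    filter_upwards [hκ] with t ht
    refine ⟨⟨by simp [codeAt], ?_⟩, by simpa [codeAt] using hlen t ht, by simp⟩
    intro l hl
    obtain ⟨b, hb, rfl⟩ := List.mem_map.1 hl
    refine ⟨by simpa using ht b ((hcs b).1 hb), fun i hi => ?_⟩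
    obtain ⟨r, hr, rfl⟩ := List.mem_map.1 hi
    exact (List.idxOf_lt_length_of_mem (mem_blocks.2 ⟨b, hb, hr⟩)).trans_le (hlen t ht))
  obtain ⟨t, ht⟩ := hx.exists
  obtain ⟨l, hl⟩ : ∃ l, ∀ r ∈ blocks σ τ p c₀ cs t, r.length ≤ l :=
    ⟨((blocks σ τ p c₀ cs t).map List.length).sum, fun r hr =>
      List.single_le_sum (by simp) _ (List.mem_map_of_mem hr)⟩
  obtain ⟨t', ht', h1, h2⟩ := (hx.and_eventually
    ((eventually_ge_atTop (t + 2)).and (h.eventually_lt_length hap l))).exists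
  refine ⟨t, t', h1, ht.trans ht'.symm, fun r hr r' hr' => ?_⟩
  obtain ⟨b, hb, hr'⟩ := mem_blocks.1 hr'
  exact (hl r hr).trans_lt (h2 b ((hcs b).1 hb) r' hr')

/-- The coding of the words `b` in `cs`. -/
def codeTable (σ : ℕ → List ℕ) (τ : ℕ → ℕ) (c p : ℕ) (c₀ : List ℕ) (cs : List (List ℕ))
    (J t : ℕ) : List (List ℕ × List ℕ × List ℕ) :=
  cs.map fun b => (b, (dec [c] (iter σ J b)).map fun b' => cs.idxOf b',
    (blockDec σ τ p c₀ t b).map fun r => (blocks σ τ p c₀ cs t).idxOf r)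

/-- The return words for `t`, together with the decompositions of those for `t'`. -/
def returnTable (σ : ℕ → List ℕ) (τ : ℕ → ℕ) (p : ℕ) (c₀ : List ℕ) (cs : List (List ℕ))
    (t t' : ℕ) : List (List ℕ × List ℕ) :=
  List.zip (blocks σ τ p c₀ cs t) ((blocks σ τ p c₀ cs t').map fun r' =>
    (dec (img σ τ (p * t) c₀) r').map fun r => (blocks σ τ p c₀ cs t).idxOf r)

section Tables

variable {cs : List (List ℕ)} {J t t' : ℕ}

theorem tabFst_codeTable {b : List ℕ} (hb : b ∈ cs) :
    tabFst (codeTable σ τ c p c₀ cs J t) (cs.idxOf b) = b := by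
  rw [tabFst, codeTable, List.map_map]
  exact getD_map_idxOf hb _ _

theorem tabSnd_map_snd_codeTable {b : List ℕ} (hb : b ∈ cs) :
    tabSnd ((codeTable σ τ c p c₀ cs J t).map Prod.snd) (cs.idxOf b) =
      (blockDec σ τ p c₀ t b).map fun r => (blocks σ τ p c₀ cs t).idxOf r := by
  rw [tabSnd, codeTable, List.map_map, List.map_map]
  exact getD_map_idxOf hb _ _

theorem map_fst_returnTable
    (hl : (blocks σ τ p c₀ cs t).length = (blocks σ τ p c₀ cs t').length) :
    (returnTable σ τ p c₀ cs t t').map Prod.fst = blocks σ τ p c₀ cs t :=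
  List.map_fst_zip (by simp [hl])

theorem tabFst_returnTable
    (hl : (blocks σ τ p c₀ cs t).length = (blocks σ τ p c₀ cs t').length) {r : List ℕ}
    (hr : r ∈ blocks σ τ p c₀ cs t) :
    tabFst (returnTable σ τ p c₀ cs t t') ((blocks σ τ p c₀ cs t).idxOf r) = r := by
  rw [tabFst, map_fst_returnTable hl]
  simpa using getD_map_idxOf hr id []

theorem tabSnd_returnTable
    (hl : (blocks σ τ p c₀ cs t).length = (blocks σ τ p c₀ cs t').length) {r' : List ℕ}
    (hr' : r' ∈ blocks σ τ p c₀ cs t') :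
    tabSnd (returnTable σ τ p c₀ cs t t') ((blocks σ τ p c₀ cs t').idxOf r') =
      (dec (img σ τ (p * t) c₀) r').map fun r => (blocks σ τ p c₀ cs t).idxOf r := by
  rw [tabSnd, returnTable, List.map_snd_zip (by simp [hl])]
  exact getD_map_idxOf hr' _ _

end Tables

-- Equality of the codings identifies the d-th block at level t with the d-th block at level t'. Let
-- Θ(d) be the former and ρ(d) the coded decomposition of the latter, so that Θ(ρ(d)) is the latter
-- and has the same value in `G` as Θ(d).
open Filter in
theorem exists_presentationCert [Finite G] (hmul : ∀ x y, mul (ι x) (ι y) = ι (x * y))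
    (hg : ∀ a, ι (g a) = gn a) (h : FirstReturn n σ c p c₀)
    (hap : ∀ d, 0 < d → ∃ T ∈ langMor n σ τ, T.length = d + 1 ∧ T[0]? ≠ T[d]?) :
    ∃ E N w R J N' z y C, ∀ᶠ i in atTop,
      UpperCert σ τ n mul gn (ι 1) (iter σ i [0]) N w (elems mul gn (ι 1) E R) ∧
      PresentationCert σ τ mul gn (ι 1) (iter σ i [0]) J N' z y C R := by
  obtain ⟨cs, hcs⟩ := h.exists_list
  obtain ⟨t, t', htt, hcode, hlt⟩ := h.exists_codeAt_eq hap hcs g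
  obtain ⟨m, hm⟩ := h.exists_infix_dec
  have h0 : 0 < n := by have := h.lt; omega
  set bt := blocks σ τ p c₀ cs t with hbt
  set bt' := blocks σ τ p c₀ cs t' with hbt'
  have hval : bt.map (val g) = bt'.map (val g) := congrArg Prod.snd hcode
  have hl : bt.length = bt'.length := by simpa using congrArg List.length hval
  have hmemt : ∀ b ∈ cs, ∀ r ∈ blockDec σ τ p c₀ t b, r ∈ bt := fun b hb r hr =>
    mem_blocks.2 ⟨b, hb, hr⟩
  have hmemt' : ∀ b ∈ cs, ∀ r ∈ blockDec σ τ p c₀ t' b, r ∈ bt' := fun b hb r hr =>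
    mem_blocks.2 ⟨b, hb, hr⟩
  have hcode' : ∀ b ∈ cs, (blockDec σ τ p c₀ t b).map (fun r => bt.idxOf r) =
      (blockDec σ τ p c₀ t' b).map fun r => bt'.idxOf r := fun b hb =>
    List.map_inj_left.1 (congrArg Prod.fst hcode) b hb
  have hdec : ∀ b ∈ cs, ∀ j, ∀ b' ∈ dec [c] (iter σ j b), b' ∈ cs := fun b hb j b' hb' =>
    (hcs b').2 (h.dec_iter_mem ((hcs b).1 hb) j b' hb')
  have hc₀ : c₀ ∈ cs := (hcs c₀).2 h.mem_returnBlocks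
  have hdec' : ∀ r' ∈ bt', ∀ r ∈ dec (img σ τ (p * t) c₀) r', r ∈ bt := by
    intro r' hr' r hr
    obtain ⟨b, hb, hr'⟩ := mem_blocks.1 hr'
    have h1 : r ∈ (blockDec σ τ p c₀ t' b).flatMap (dec (img σ τ (p * t) c₀)) :=
      List.mem_flatMap.2 ⟨r', hr', hr⟩
    rw [h.dec_blockDec htt ((hcs b).1 hb)] at h1
    obtain ⟨b', hb', hr⟩ := List.mem_flatMap.1 h1
    exact hmemt b' (hdec b hb _ b' hb') r hr
  obtain ⟨r₀, rest, hr₀⟩ : ∃ r₀ rest, blockDec σ τ p c₀ t c₀ = r₀ :: rest := by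
    refine List.exists_cons_of_ne_nil (dec_ne_nil ?_)
    rw [← List.length_pos_iff, length_img, List.length_pos_iff]
    exact h.iter_ne_nil h.head _
  have hr₀t : r₀ ∈ bt := hmemt c₀ hc₀ r₀ (by rw [hr₀]; simp)
  set R := returnTable σ τ p c₀ cs t t' with hR
  set C := codeTable σ τ c p c₀ cs (p * (t' - t)) t with hC
  have hRl : R.length = bt.length := by
    rw [← List.length_map (f := Prod.fst), hR, map_fst_returnTable hl]
  have hR1 : ∀ r ∈ bt, tabFst R (bt.idxOf r) = r := fun r hr => tabFst_returnTable hl hr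
  have hR2 : ∀ r' ∈ bt', tabSnd R (bt'.idxOf r') =
      (dec (img σ τ (p * t) c₀) r').map fun r => bt.idxOf r := fun r' hr' =>
    tabSnd_returnTable hl hr'
  have hflat : ∀ x : List (List ℕ), (∀ r ∈ x, r ∈ bt) →
      (x.map fun r => bt.idxOf r).flatMap (tabFst R) = x.flatten := by
    intro x hx
    rw [flatMap_map_idxOf (f := id) hR1 hx, List.flatMap_id]
  have hflatC : ∀ x : List (List ℕ), (∀ b ∈ x, b ∈ cs) →
      (x.map fun b => cs.idxOf b).flatMap (tabFst C) = x.flatten := by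
    intro x hx
    rw [flatMap_map_idxOf (f := id) (fun b hb => tabFst_codeTable hb) hx, List.flatMap_id]
  have hflatP : ∀ x : List (List ℕ), (∀ b ∈ x, b ∈ cs) →
      (x.map fun b => cs.idxOf b).flatMap (tabSnd (C.map Prod.snd)) =
        (x.flatMap (blockDec σ τ p c₀ t)).map fun r => bt.idxOf r := by
    intro x hx
    rw [flatMap_map_idxOf (fun b hb => tabSnd_map_snd_codeTable hb) hx, List.map_flatMap]
  obtain ⟨E, N, hupper⟩ := exists_upperCert (R := R) hmul hg h.prim
    (img_mem (τ := τ) h.mem_langSub (p * t)) fun r hr hwr => by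
      rw [← dec_flatten (img σ τ (p * t) c₀) r, ← List.flatMap_id, val_flatMap]
      refine val_mem fun x hx => Subgroup.subset_closure ⟨x, ?_, rfl⟩
      obtain ⟨b, hb, hxb⟩ := h.mem_of_mem_dec_return t hr hwr x hx
      change x ∈ R.map Prod.fst
      rw [hR, map_fst_returnTable hl]
      exact hmemt b ((hcs b).2 hb) x hxb
  refine ⟨E, N, img σ τ (p * t) c₀, R, p * (t' - t), p * t + p, bt.idxOf r₀,
    (dec [c] (iter σ m c₀)).map (fun b => cs.idxOf b), C, ?_⟩
  filter_upwards [hupper, h.prim.eventually_infix (Set.finite_singleton (iter σ m c₀))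
    (by simpa using IsPrimSubst.iter_mem h.mem_langSub m)] with i hi hinf
  refine ⟨hi, ?_, ?_, ?_, ?_, ?_⟩
  · intro x hx
    obtain ⟨b, hb, rfl⟩ := List.mem_map.1 hx
    dsimp only
    refine ⟨?_, ?_, ?_⟩
    · rw [hflatC _ (hdec b hb _), dec_flatten]
    -- The coding of `b` at level t is reread as its coding at level t', to which ρ applies as
    -- decomposition.
    · rw [hflatP _ (hdec b hb _), ← h.dec_blockDec htt ((hcs b).1 hb), hcode' b hb,
        flatMap_map_idxOf hR2 (hmemt' b hb), List.map_flatMap]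
    · rw [hflat _ (hmemt b hb), blockDec, dec_flatten]
  · rw [hflatC _ (hdec c₀ hc₀ m), dec_flatten]
    exact hinf _ rfl 0 h0
  · intro d hd
    rw [hRl] at hd
    rw [hflatP _ (hdec c₀ hc₀ m), hRl]
    obtain ⟨b, hb, hr⟩ := mem_blocks.1 (show bt[d] ∈ blocks σ τ p c₀ cs t from List.getElem_mem hd)
    obtain ⟨x, y, hy, e⟩ := hm b ((hcs b).1 hb)
    obtain ⟨u, v, huv⟩ := List.append_of_mem hr
    have hyc : ∀ b' ∈ y, b' ∈ cs := fun b' hb' => hdec c₀ hc₀ m b' (by rw [e]; simp [hb'])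
    -- If the given return word ends the decomposition of `b`, its successor comes from the next
    -- block, which exists because `b` is not the last one.
    have hne : v ++ y.flatMap (blockDec σ τ p c₀ t) ≠ [] := by
      obtain ⟨b', y, rfl⟩ := List.exists_cons_of_ne_nil hy
      have : blockDec σ τ p c₀ t b' ≠ [] := by
        refine dec_ne_nil ?_
        rw [← List.length_pos_iff, length_img, List.length_pos_iff]
        exact h.iter_ne_nil (h.head_block ((hcs b').1 (hyc b' (by simp)))) _
      simp [this]
    obtain ⟨r', hr', hrr⟩ := infix_pair_of_append
      (l := (dec [c] (iter σ m c₀)).flatMap (blockDec σ τ p c₀ t))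
      (x := x.flatMap (blockDec σ τ p c₀ t) ++ u) (r := bt[d]) (by rw [e]; simp [huv]) hne
    obtain ⟨b', hb', hr'⟩ := List.mem_flatMap.1 hr'
    have hr'' := hmemt b' (hdec c₀ hc₀ m b' hb') r' hr'
    refine ⟨bt.idxOf r', List.idxOf_lt_length_of_mem hr'', ?_⟩
    have h1 := hrr.map fun r => bt.idxOf r
    have h2 : bt.idxOf bt[d] = d := (List.nodup_dedup _).idxOf_getElem d hd
    simpa [h2] using h1
  · rw [hRl]
    exact List.idxOf_lt_length_of_mem hr₀t
  · intro x hx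
    obtain ⟨d, hd, rfl⟩ := List.mem_iff_getElem.1 hx
    have hd1 : d < bt.length := by rwa [← hRl]
    have hd2 : d < bt'.length := by rwa [← hl]
    have e1 : R[d].1 = bt[d] := by simp [hR, returnTable, hbt]
    have e2 : R[d].2 = (dec (img σ τ (p * t) c₀) bt'[d]).map fun r => bt.idxOf r := by
      simp [hR, returnTable, hbt, hbt']
    have hmem := List.getElem_mem hd1
    have hmem' := List.getElem_mem hd2
    obtain ⟨b, hb, hr⟩ := mem_blocks.1 hmem
    obtain ⟨b', hb', hr'⟩ := mem_blocks.1 hmem'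
    rw [e1, e2, hRl]
    refine ⟨ne_nil_of_mem_dec hr, ?_, ?_, ?_, ?_⟩
    · rw [List.head?_map, h.head_dec_block htt ((hcs b').1 hb') hr', hr₀]; rfl
    · rw [List.length_map]
      -- A one-piece decomposition would make a block at level t' equal to a block at level t,
      -- against the strict inequality of lengths.
      by_contra hlen
      have h1 := List.length_pos_iff.2 (dec_ne_nil (w := img σ τ (p * t) c₀)
        (ne_nil_of_mem_dec hr'))
      obtain ⟨a, ha⟩ := List.length_eq_one_iff.1 (show
        (dec (img σ τ (p * t) c₀) bt'[d]).length = 1 by omega)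
      have h2 := dec_flatten (img σ τ (p * t) c₀) bt'[d]
      rw [ha] at h2
      simp only [List.flatten_cons, List.flatten_nil, List.append_nil] at h2
      have h3 := hlt a (hdec' _ hmem' a (by rw [ha]; simp)) _ hmem'
      rw [← h2] at h3
      omega
    · intro i hi
      obtain ⟨r, hr, rfl⟩ := List.mem_map.1 hi
      exact List.idxOf_lt_length_of_mem (hdec' _ hmem' r hr)
    · rw [hflat _ (hdec' _ hmem'), dec_flatten, wordNum_eq hmul hg rfl, wordNum_eq hmul hg rfl]
      have h1 := congrArg (fun l : List G => l[d]?) hval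
      simp [hd1, hd2] at h1
      rw [h1]

end FirstReturn

open Filter in
/-- Every primitive substitution has certificates. -/
theorem exists_cert {n : ℕ} {σ : ℕ → List ℕ} {τ : ℕ → ℕ} {G : Type*} [Group G] [Finite G]
    {ι : G → ℕ} {mul : ℕ → ℕ → ℕ} {g : ℕ → G} {gn : ℕ → ℕ}
    (hmul : ∀ x y, mul (ι x) (ι y) = ι (x * y))
    (hg : ∀ a, ι (g a) = gn a) (hσ : IsPrimSubst n σ) :
    ∃ i E N w R J N' z y C,
      UpperCert σ τ n mul gn (ι 1) (iter σ i [0]) N w (elems mul gn (ι 1) E R) ∧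
      (PresentationCert σ τ mul gn (ι 1) (iter σ i [0]) J N' z y C R ∨
        PeriodicCert σ τ (iter σ i [0]) N w R) := by
  by_cases hper : ∃ d, 0 < d ∧ ∀ T ∈ langMor n σ τ, T.length = d + 1 → T[0]? = T[d]?
  · obtain ⟨E, N, w, R, h⟩ := exists_cert_of_periodic hmul hg hσ hper
    obtain ⟨i, h1, h2⟩ := h.exists
    -- The zeros and empty lists fill the presentation data, which play no role in the periodic
    -- case.
    exact ⟨i, E, N, w, R, 0, 0, 0, [], [], h1, Or.inr h2⟩
  · push Not at hper
    obtain ⟨c, p, c₀, hF⟩ := hσ.exists_firstReturn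
    obtain ⟨E, N, w, R, J, N', z, y, C, h⟩ := hF.exists_presentationCert hmul hg hper
    obtain ⟨i, h1, h2⟩ := h.exists
    exact ⟨i, E, N, w, R, J, N', z, y, C, h1, Or.inl h2⟩

/-! ### The language of a substitutive shift space -/

theorem getElem?_factorInt {A : Type*} (z : ℤ → A) (i : ℤ) (n k : ℕ) :
    (factorInt z i n)[k]? = if k < n then some (z (i + k)) else none := by
  rw [factorInt, List.getElem?_map]
  split_ifs with h
  · simp [h]
  · simp [not_lt.1 h]

/-- Starting from `u`, add one letter on each side repeatedly. The words obtained converge to a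
two-sided infinite word with all its factors in `L`. -/
theorem lang_of_extendable {A : Type*} {L : Set (List A)}
    (hinf : ∀ u v : List A, v ∈ L → u <:+: v → u ∈ L) (hr : ∀ u ∈ L, ∃ a, u ++ [a] ∈ L)
    (hl : ∀ u ∈ L, ∃ a, a :: u ∈ L) : lang {z | langInt z ⊆ L} = L := by
  ext u
  simp only [lang, Set.mem_iUnion]
  constructor
  · rintro ⟨z, hz, hu⟩
    exact hz hu
  intro hu
  have hstep : ∀ v ∈ L, ∃ a b, a :: (v ++ [b]) ∈ L := by
    intro v hv
    obtain ⟨b, hb⟩ := hr v hv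
    obtain ⟨a, ha⟩ := hl _ hb
    exact ⟨a, b, ha⟩
  have : Nonempty A := ⟨(hr u hu).choose⟩
  choose! fa fb hf using hstep
  let U : ℕ → List A := fun k => (fun v => fa v :: (v ++ [fb v]))^[k] u
  have hU0 : U 0 = u := rfl
  have hU1 : ∀ k, U (k + 1) = fa (U k) :: (U k ++ [fb (U k)]) := fun k =>
    Function.iterate_succ_apply' _ _ _
  have hUL : ∀ k, U k ∈ L := by
    intro k
    induction k with
    | zero => exact hu
    | succ k ih => rw [hU1]; exact hf _ ih
  have hlen : ∀ k, (U k).length = u.length + 2 * k := by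
    intro k
    induction k with
    | zero => simp [hU0]
    | succ k ih => rw [hU1]; simp [ih]; ring
  have hshift : ∀ j k p, p < (U k).length → (U (k + j))[p + j]? = (U k)[p]? := by
    intro j k p hp
    induction j with
    | zero => rfl
    | succ j ih =>
      rw [← add_assoc, ← add_assoc, hU1, List.getElem?_cons_succ, List.getElem?_append_left, ih]
      rw [hlen] at hp ⊢; omega
  -- In `U k` the word `u` starts at position `k`, so the letter at coordinate `i` is at position `i
  -- + k`; `k = |i| + 1` is large enough even if `u` is empty.
  have hex : ∀ i : ℤ, ∃ a, (U (i.natAbs + 1))[(i + (i.natAbs + 1 : ℕ)).toNat]? = some a := by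
    intro i
    exact ⟨_, List.getElem?_eq_getElem (by rw [hlen]; omega)⟩
  choose z hz using hex
  have hzU : ∀ (k : ℕ) (i : ℤ), 0 ≤ i + k → i + k < (U k).length →
      (U k)[(i + k).toNat]? = some (z i) := by
    intro k i h0 h1
    rw [← hz, ← hshift (i.natAbs + 1) k _ (by omega), ← hshift k (i.natAbs + 1) _ (by
      rw [hlen]; omega), add_comm k]
    congr 1
    omega
  have hfac : ∀ (i : ℤ) (n : ℕ), factorInt z i n <:+: U (i.natAbs + n) := by
    intro i n
    have e : factorInt z i n = ((U (i.natAbs + n)).drop (i + (i.natAbs + n : ℕ)).toNat).take n := by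
      apply List.ext_getElem?
      intro k
      rw [getElem?_factorInt, List.getElem?_take]
      split_ifs with hk
      · rw [List.getElem?_drop, ← hzU (i.natAbs + n) (i + k) (by omega) (by rw [hlen]; omega)]
        congr 1
        omega
      · rfl
    rw [e]
    exact (List.take_prefix _ _).isInfix.trans (List.drop_suffix _ _).isInfix
  refine ⟨z, ?_, 0, u.length, ?_⟩
  · rintro _ ⟨i, n, rfl⟩
    exact hinf _ _ (hUL _) (hfac i n)
  · apply List.ext_getElem?
    intro k
    rw [getElem?_factorInt]
    split_ifs with hk
    · have := hzU 0 k (by omega) (by rw [hlen]; omega)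
      rw [zero_add, ← this, hU0]
      simp
    · simp [not_lt.1 hk]

theorem ret_image_map {A α : Type*} {f : A → α} (hf : Function.Injective f)
    (L : Set (List A)) (u : List A) :
    ret (List.map f '' L) (u.map f) = List.map f '' ret L u := by
  have hf' := List.map_injective_iff.2 hf
  ext r
  constructor
  · rintro ⟨h0, ⟨v, hv, e⟩, hp, hn⟩
    obtain ⟨r, u', rfl, rfl, hu'⟩ := List.map_eq_append_iff.1 e
    obtain rfl := hf' hu'
    refine ⟨r, ⟨by simpa using h0, hv, ?_, ?_⟩, rfl⟩
    · obtain ⟨t, ht⟩ := hp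
      rw [← List.map_append] at ht
      obtain ⟨x, t, h1, h2, -⟩ := List.map_eq_append_iff.1 ht.symm
      obtain rfl := hf' h2
      exact ⟨t, h1.symm⟩
    · rintro ⟨p, s, hp, hs, e⟩
      exact hn ⟨p.map f, s.map f, by simpa, by simpa, by
        rw [← List.map_append, e]; simp⟩
  · rintro ⟨r, ⟨h0, h1, hp, hn⟩, rfl⟩
    refine ⟨by simpa, ⟨_, h1, by simp⟩, by rw [← List.map_append]; exact hp.map f, ?_⟩
    rintro ⟨p, s, hp0, hs0, e⟩
    rw [← List.map_append] at e
    obtain ⟨x, s, h2, h3, rfl⟩ := List.map_eq_append_iff.1 e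
    obtain ⟨p, u', rfl, rfl, h4⟩ := List.map_eq_append_iff.1 h3
    obtain rfl := hf' h4
    exact hn ⟨p, s, by simpa using hp0, by simpa using hs0, h2⟩

theorem map_returnGroup {A G : Type*} [Group G] (φ : FreeGroup A →* G) (X : Set (ℤ → A))
    {f : A → ℕ} (hf : Function.Injective f) {g : ℕ → G}
    (hg : ∀ a, g (f a) = φ (FreeGroup.of a)) (u : List A) :
    (returnGroup X u).map φ = retImage g (List.map f '' lang X) (u.map f) := by
  rw [returnGroup, MonoidHom.map_closure, retImage, ret_image_map hf, Set.image_image,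
    Set.image_image]
  congr 1
  refine Set.image_congr fun r _ => ?_
  rw [toFreeGroup, map_list_prod, val]
  simp [hg, Function.comp_def]

/-! ### Transfer from the given alphabets to natural numbers -/

section Bridge

variable {A B : Type*} {m n : ℕ} {eA : A ≃ Fin m} {eB : B ≃ Fin n} {σ : B → List B} {τ : B → A}
  {σ' : ℕ → List ℕ} {τ' : ℕ → ℕ}

theorem iter_map_equiv (hσ : ∀ b, σ' (eB b) = (σ b).map fun b => (eB b : ℕ)) (k : ℕ)
    (z : List B) :
    iter σ' k (z.map fun b => (eB b : ℕ)) = (iter σ k z).map fun b => (eB b : ℕ) := by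
  induction k generalizing z with
  | zero => rfl
  | succ k ih =>
    rw [iter_add, iter_add, ← ih, iter_one, iter_one, List.flatMap_map, List.map_flatMap]
    simp only [hσ]

theorem exists_eq_map {u : List ℕ} (h : ∀ a ∈ u, a < n) :
    ∃ v : List B, u = v.map fun b => (eB b : ℕ) := by
  refine ⟨u.attach.map fun a => eB.symm ⟨a.1, h a.1 a.2⟩, ?_⟩
  simp

/-- The starting letter is `y 0`: two consecutive iterates start with it, hence so does its image.
If the image were just `y 0`, primitivity would leave a single letter with constant iterates, which
cannot converge to an infinite word. -/
theorem isPrimSubst_of_convergesTo (hσ : ∀ b, σ' (eB b) = (σ b).map fun b => (eB b : ℕ))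
    (hp : IsPrimitive σ) {b : B} {y : ℕ → B} (hy : ConvergesTo σ b y) : IsPrimSubst n σ' := by
  have hsurj : ∀ b < n, ∃ c : B, (eB c : ℕ) = b := fun b hb => ⟨eB.symm ⟨b, hb⟩, by simp⟩
  obtain ⟨k, hk, hprim⟩ := hp
  have hne : σ (y 0) ≠ [] := by
    intro h
    obtain ⟨k, rfl⟩ := Nat.exists_eq_add_of_lt hk
    have h1 := hprim (y 0) (y 0)
    change y 0 ∈ iter σ (0 + k + 1) [y 0] at h1
    rw [iter_add, iter_one, List.flatMap_singleton, h, iter_nil] at h1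
    simp at h1
  obtain ⟨N, hN⟩ := hy 1
  obtain ⟨N2, hN2⟩ := hy 2
  obtain ⟨x, hx⟩ : ∃ x, σ (y 0) = y 0 :: x := by
    obtain ⟨t, ht⟩ := hN N le_rfl
    obtain ⟨t', ht'⟩ := hN (N + 1) (by omega)
    change _ = iter σ N [b] at ht
    change _ = iter σ (N + 1) [b] at ht'
    rw [add_comm, iter_add, ← ht, iter_one] at ht'
    obtain ⟨a, x, hax⟩ := List.exists_cons_of_ne_nil hne
    simp [factorNat, hax] at ht'
    exact ⟨x, by rw [hax, ht'.1]⟩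
  have hx0 : x ≠ [] := by
    rintro rfl
    have h1 : ∀ j, iter σ j [y 0] = [y 0] := by
      intro j
      induction j with
      | zero => rfl
      | succ j ih => rw [iter_add, iter_one, List.flatMap_singleton, hx, ih]
    have h2 : ∀ a, a = y 0 := by
      intro a
      have h3 : a ∈ iter σ k [y 0] := hprim a (y 0)
      rw [h1] at h3
      simpa using h3
    have h4 := (hN2 N2 le_rfl).length_le
    rw [h2 b] at h4
    change _ ≤ (iter σ N2 [y 0]).length at h4
    rw [h1] at h4
    simp [factorNat] at h4
  refine ⟨?_, ⟨k, ?_⟩, eB (y 0), (eB (y 0)).2, x.map fun b => (eB b : ℕ), by simpa, ?_⟩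
  · intro b hb a ha
    obtain ⟨b, rfl⟩ := hsurj b hb
    rw [hσ] at ha
    obtain ⟨c, -, rfl⟩ := List.mem_map.1 ha
    exact (eB c).2
  · intro a ha b hb
    obtain ⟨a, rfl⟩ := hsurj a ha
    obtain ⟨b, rfl⟩ := hsurj b hb
    have := iter_map_equiv (eB := eB) hσ k [b]
    rw [List.map_singleton] at this
    rw [this]
    exact List.mem_map_of_mem (hprim a b)
  · rw [hσ, hx]; rfl

/-- Prefixes of `y` are prefixes of iterates, and conversely every word of the substitutive language
occurs in a long prefix of `y` by uniform recurrence. Extendability on both sides then makes this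
language that of the two-sided shift. -/
theorem langMor_eq_of_isGeneratedBy (hσ : ∀ b, σ' (eB b) = (σ b).map fun b => (eB b : ℕ))
    (hτ : ∀ b, τ' (eB b) = eA (τ b)) (hp : IsPrimitive σ) {X : Set (ℤ → A)}
    (hX : IsGeneratedBy X σ τ) :
    IsPrimSubst n σ' ∧ langMor n σ' τ' = List.map (fun a => (eA a : ℕ)) '' lang X := by
  obtain ⟨b, y, hy, rfl⟩ := hX
  have hσ' : IsPrimSubst n σ' := isPrimSubst_of_convergesTo hσ hp hy
  refine ⟨hσ', ?_⟩
  have hinj : Function.Injective fun a : A => (eA a : ℕ) := fun a b h =>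
    eA.injective (Fin.ext h)
  have hinj' := List.map_injective_iff.2 hinj
  have hmapτ : ∀ z : List B, (z.map fun b => (eB b : ℕ)).map τ' =
      (z.map τ).map fun a => (eA a : ℕ) := by
    intro z
    simp [List.map_map, Function.comp_def, hτ]
  have hpre : ∀ k, (factorNat y 0 k).map (fun b => (eB b : ℕ)) ∈ langSub n σ' := by
    intro k
    obtain ⟨N, hN⟩ := hy k
    refine ⟨N, eB b, (eB b).2, ?_⟩
    have := iter_map_equiv (eB := eB) hσ N [b]
    rw [List.map_singleton] at this
    rw [this]
    exact ((hN N le_rfl).map _).isInfix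
  have hfac : ∀ i k, factorNat y i k <:+: factorNat y 0 (i + k) := by
    intro i k
    refine List.IsSuffix.isInfix ⟨factorNat y 0 i, ?_⟩
    simp [factorNat, List.range_add, Function.comp_def]
  have hmapf : ∀ i k, factorNat (τ ∘ y) i k = (factorNat y i k).map τ := by
    intro i k
    simp [factorNat, Function.comp_def]
  have hlang : ∀ u, u ∈ langNat (τ ∘ y) ↔ u.map (fun a => (eA a : ℕ)) ∈ langMor n σ' τ' := by
    intro u
    constructor
    · rintro ⟨i, k, rfl⟩
      rw [hmapf, ← hmapτ]
      exact ⟨_, IsPrimSubst.infix_mem (hpre (i + k)) ((hfac i k).map _), rfl⟩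
    · rintro ⟨v, hv, e⟩
      obtain ⟨v', rfl⟩ := exists_eq_map (eB := eB) (hσ'.lt_of_mem hv)
      rw [hmapτ] at e
      obtain rfl := hinj' e
      obtain ⟨M, hM⟩ := hσ'.isRecurrentLang.recurrent _ hv
      obtain ⟨s, t, h⟩ := hM _ (hpre M) (by simp [factorNat])
      obtain ⟨x, t', h1, h2, -⟩ := List.map_eq_append_iff.1 h.symm
      obtain ⟨s', v'', rfl, -, h3⟩ := List.map_eq_append_iff.1 h2
      have hinjB : Function.Injective fun b : B => (eB b : ℕ) := fun a b h =>
        eB.injective (Fin.ext h)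
      obtain rfl := List.map_injective_iff.2 hinjB h3
      refine ⟨s'.length, v''.length, ?_⟩
      rw [hmapf]
      congr 1
      apply List.ext_getElem?
      intro k
      rcases lt_or_ge k v''.length with hk | hk
      · have h4 := congrArg (fun l => l[s'.length + k]?) h1
        have h5 := congrArg List.length h1
        simp only [factorNat, List.length_map, List.length_range, List.length_append] at h5
        simp only [List.append_assoc] at h4
        rw [List.getElem?_append_right (by omega), Nat.add_sub_cancel_left,
          List.getElem?_append_left hk] at h4
        rw [← h4]
        simp [factorNat, hk, show s'.length + k < M by omega]
      · simp [factorNat, hk]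
  have hL : IsRecurrentLang (langMor n σ' τ') := hσ'.isRecurrentLang_langMor
  have hltm : ∀ v ∈ langMor n σ' τ', ∃ u : List A, v = u.map fun a => (eA a : ℕ) := by
    rintro _ ⟨v, hv, rfl⟩
    obtain ⟨v', rfl⟩ := exists_eq_map (eB := eB) (hσ'.lt_of_mem hv)
    exact ⟨_, hmapτ v'⟩
  rw [lang_of_extendable]
  · ext v
    constructor
    · intro hv
      obtain ⟨u, rfl⟩ := hltm v hv
      exact ⟨u, (hlang u).2 hv, rfl⟩
    · rintro ⟨u, hu, rfl⟩
      exact (hlang u).1 hu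
  · intro u v hv huv
    exact (hlang u).2 (hL.infix_mem ((hlang v).1 hv) (huv.map _))
  · intro u hu
    obtain ⟨a, ha⟩ := hL.extend _ ((hlang u).1 hu)
    obtain ⟨v, hv⟩ := hltm _ ha
    obtain ⟨x, z, rfl, h1, h2⟩ := List.map_eq_append_iff.1 hv.symm
    obtain rfl := hinj' h1
    obtain ⟨a', rfl⟩ := List.length_eq_one_iff.1
      (show z.length = 1 by simpa using congrArg List.length h2)
    exact ⟨a', (hlang _).2 (hv ▸ ha)⟩
  · intro u hu
    obtain ⟨a, ha⟩ := hσ'.langMor_cons_mem ((hlang u).1 hu)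
    obtain ⟨v, hv⟩ := hltm _ ha
    rcases v with _ | ⟨a', v⟩
    · simp at hv
    · simp only [List.map_cons, List.cons.injEq] at hv
      obtain rfl := hinj' hv.2
      exact ⟨a', (hlang _).2 (by rw [List.map_cons, ← hv.1]; exact ha)⟩

theorem stabilizesOver_of_card_minimal {A G : Type*} [Group G] [Finite G]
    {φ : FreeGroup A →* G} {X : Set (ℤ → A)}
    {f : A → ℕ} (hf : Function.Injective f) {g : ℕ → G}
    (hg : ∀ a, g (f a) = φ (FreeGroup.of a)) (hL : IsRecurrentLang (List.map f '' lang X))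
    {w : List ℕ} (hw : w ∈ List.map f '' lang X)
    (hmin : ∀ u ∈ List.map f '' lang X, Nat.card (retImage g (List.map f '' lang X) w) ≤
      Nat.card (retImage g (List.map f '' lang X) u)) :
    StabilizesOver φ X (retImage g (List.map f '' lang X) w) := by
  obtain ⟨M, h1, h2, h3⟩ := stabilizes_of_card_minimal hL hw hmin
  refine ⟨M, ?_, ?_, ?_⟩
  · intro v hv hvM u hu hvu
    rw [map_returnGroup φ X hf hg, map_returnGroup φ X hf hg]
    exact h1 _ ⟨v, hv, rfl⟩ (by simpa) _ ⟨u, hu, rfl⟩ (hvu.map f)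
  · intro u hu hMu
    rw [map_returnGroup φ X hf hg]
    exact h2 _ ⟨u, hu, rfl⟩ (by simpa)
  · obtain ⟨_, ⟨u, hu, rfl⟩, hMu, h⟩ := h3
    exact ⟨u, hu, by simpa using hMu, by rw [map_returnGroup φ X hf hg]; exact h⟩

theorem hasStableReturnGroups_iff {A G : Type*} [Group G]
    {φ : FreeGroup A →* G} {X : Set (ℤ → A)}
    {f : A → ℕ} (hf : Function.Injective f) {g : ℕ → G}
    (hg : ∀ a, g (f a) = φ (FreeGroup.of a)) (hL : IsRecurrentLang (List.map f '' lang X))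
    (hX : (lang X).Nonempty) :
    HasStableReturnGroups φ X ↔ ∀ u ∈ List.map f '' lang X,
      retImage g (List.map f '' lang X) u = retImage g (List.map f '' lang X) [] := by
  have h0 : [] ∈ lang X := by
    obtain ⟨u, hu⟩ := hX
    obtain ⟨v, hv, e⟩ := hL.infix_mem ⟨u, hu, rfl⟩ List.nil_infix
    rw [List.map_eq_nil_iff] at e
    exact e ▸ hv
  constructor
  · rintro h _ ⟨u, hu, rfl⟩
    have := h [] h0 rfl u hu List.nil_prefix
    rwa [map_returnGroup φ X hf hg, map_returnGroup φ X hf hg] at this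
  · intro h w _ hw0 u hu _
    obtain rfl := List.length_eq_zero_iff.1 hw0
    rw [map_returnGroup φ X hf hg, map_returnGroup φ X hf hg]
    exact h _ ⟨u, hu, rfl⟩

end Bridge

/-! ### The check of certificates is primitive recursive -/

section Primrec

variable {α β : Type*} [Primcodable α] [Primcodable β]

theorem primrecPred_forall_mem {f : α → List β} (hf : Primrec f) {R : α → β → Prop}
    (hR : PrimrecPred fun p : α × β => R p.1 p.2) : PrimrecPred fun a => ∀ b ∈ f a, R a b :=
  (PrimrecRel.forall_mem_list (R := fun b a => R a b)
    (PrimrecPred.comp hR (Primrec.snd.pair Primrec.fst))).comp hf Primrec.id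

theorem primrecPred_exists_mem {f : α → List β} (hf : Primrec f) {R : α → β → Prop}
    (hR : PrimrecPred fun p : α × β => R p.1 p.2) : PrimrecPred fun a => ∃ b ∈ f a, R a b :=
  (PrimrecRel.exists_mem_list (R := fun b a => R a b)
    (PrimrecPred.comp hR (Primrec.snd.pair Primrec.fst))).comp hf Primrec.id

theorem primrecPred_forall_lt {f : α → ℕ} (hf : Primrec f) {R : α → ℕ → Prop}
    (hR : PrimrecPred fun p : α × ℕ => R p.1 p.2) : PrimrecPred fun a => ∀ k < f a, R a k :=
  (primrecPred_forall_mem (Primrec.list_range.comp hf) hR).of_eq fun a => by simp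

theorem primrecPred_exists_lt {f : α → ℕ} (hf : Primrec f) {R : α → ℕ → Prop}
    (hR : PrimrecPred fun p : α × ℕ => R p.1 p.2) : PrimrecPred fun a => ∃ k < f a, R a k :=
  (primrecPred_exists_mem (Primrec.list_range.comp hf) hR).of_eq fun a => by simp

theorem primrecPred_imp {p q : α → Prop} (hp : PrimrecPred p) (hq : PrimrecPred q) :
    PrimrecPred fun a => p a → q a :=
  (hp.not.or hq).of_eq fun a => by tauto

theorem primrecPred_mem {f : α → β} {l : α → List β} (hf : Primrec f) (hl : Primrec l) :
    PrimrecPred fun a => f a ∈ l a :=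
  (primrecPred_exists_mem hl (R := fun a b => b = f a)
    (Primrec.eq.comp Primrec.snd (hf.comp Primrec.fst))).of_eq fun a => by simp

theorem primrecPred_prefix {u v : α → List β} (hu : Primrec u) (hv : Primrec v) :
    PrimrecPred fun a => u a <+: v a :=
  (Primrec.eq.comp hu (Primrec.list_take.comp (Primrec.list_length.comp hu) hv)).of_eq
    fun _ => List.prefix_iff_eq_take.symm

theorem primrecPred_infix {u v : α → List β} (hu : Primrec u) (hv : Primrec v) :
    PrimrecPred fun a => u a <:+: v a := by
  refine (primrecPred_exists_lt (Primrec.succ.comp (Primrec.list_length.comp hv))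
    (R := fun a k => u a <+: (v a).drop k)
    (primrecPred_prefix (hu.comp Primrec.fst)
      (Primrec.list_drop.comp Primrec.snd (hv.comp Primrec.fst)))).of_eq fun a => ?_
  constructor
  · rintro ⟨k, -, h⟩
    exact h.isInfix.trans (List.drop_suffix _ _).isInfix
  · rintro ⟨p, q, h⟩
    refine ⟨p.length, by rw [← h]; simp, ?_⟩
    rw [← h, List.append_assoc, List.drop_left]
    exact List.prefix_append _ _

/-- The substitution with a given list of images of the letters. -/
def substOf (S : List (List ℕ)) (b : ℕ) : List ℕ :=
  S.getD b []

/-- The map with a given list of images of the letters. -/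
def letterOf (T : List ℕ) (b : ℕ) : ℕ :=
  T.getD b 0

/-- The multiplication with a given table. -/
def mulOf (M : List (List ℕ)) (x y : ℕ) : ℕ :=
  (M.getD x []).getD y 0

variable {S M E : α → List (List ℕ)} {T Φ s w l z y : α → List ℕ} {n e N J N' k : α → ℕ}
  {C : α → List (List ℕ × List ℕ × List ℕ)} {R : α → List (List ℕ × List ℕ)}

theorem primrec_substOf (hS : Primrec S) (hk : Primrec k) :
    Primrec fun a => substOf (S a) (k a) :=
  (Primrec.list_getD []).comp hS hk

theorem primrec_letterOf (hT : Primrec T) (hk : Primrec k) :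
    Primrec fun a => letterOf (T a) (k a) :=
  (Primrec.list_getD 0).comp hT hk

theorem primrec_mulOf (hM : Primrec M) (hn : Primrec n) (hk : Primrec k) :
    Primrec fun a => mulOf (M a) (n a) (k a) :=
  (Primrec.list_getD 0).comp ((Primrec.list_getD []).comp hM hn) hk

theorem primrec_flatMap_substOf (hS : Primrec S) (hz : Primrec z) :
    Primrec fun a => (z a).flatMap (substOf (S a)) :=
  Primrec.list_flatMap hz (primrec_substOf (hS.comp Primrec.fst) Primrec.snd).to₂

theorem primrec_iter (hS : Primrec S) (hk : Primrec k) (hz : Primrec z) :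
    Primrec fun a => iter (substOf (S a)) (k a) (z a) :=
  Primrec.nat_iterate hk hz
    (primrec_flatMap_substOf (hS.comp Primrec.fst) Primrec.snd).to₂

theorem primrec_img (hS : Primrec S) (hT : Primrec T) (hk : Primrec k) (hz : Primrec z) :
    Primrec fun a => img (substOf (S a)) (letterOf (T a)) (k a) (z a) :=
  Primrec.list_map (primrec_iter hS hk hz)
    (primrec_letterOf (hT.comp Primrec.fst) Primrec.snd).to₂

theorem primrec_wordNum (hM : Primrec M) (hΦ : Primrec Φ) (he : Primrec e) (hz : Primrec z) :
    Primrec fun a => wordNum (mulOf (M a)) (letterOf (Φ a)) (e a) (z a) :=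
  Primrec.list_foldl hz he (primrec_mulOf (hM.comp Primrec.fst)
    (Primrec.fst.comp Primrec.snd)
    (primrec_letterOf (hΦ.comp Primrec.fst) (Primrec.snd.comp Primrec.snd))).to₂

theorem primrec_flatMap_tabFst {R : α → List (List ℕ × β)} (hR : Primrec R) (hz : Primrec z) :
    Primrec fun a => (z a).flatMap (tabFst (R a)) :=
  primrec_flatMap_substOf (Primrec.list_map hR (Primrec.fst.comp Primrec.snd).to₂) hz

theorem primrec_flatMap_tabSnd (hR : Primrec R) (hz : Primrec z) :
    Primrec fun a => (z a).flatMap (tabSnd (R a)) :=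
  primrec_flatMap_substOf (Primrec.list_map hR (Primrec.snd.comp Primrec.snd).to₂) hz

theorem primrec_elems (hM : Primrec M) (hΦ : Primrec Φ) (he : Primrec e) (hE : Primrec E)
    (hR : Primrec R) :
    Primrec fun a => elems (mulOf (M a)) (letterOf (Φ a)) (e a) (E a) (R a) :=
  Primrec.list_map hE (primrec_wordNum (hM.comp Primrec.fst) (hΦ.comp Primrec.fst)
    (he.comp Primrec.fst) (primrec_flatMap_tabFst (hR.comp Primrec.fst) Primrec.snd)).to₂

theorem primrecPred_pairClosed (hS : Primrec S) (hs : Primrec s) :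
    PrimrecPred fun a => PairClosed (substOf (S a)) (s a) :=
  have h := primrec_flatMap_substOf hS hs
  primrecPred_forall_lt (Primrec.list_length.comp h) <|
    primrecPred_infix (Primrec.list_take.comp (Primrec.const 2)
      (Primrec.list_drop.comp Primrec.snd (h.comp Primrec.fst))) (hs.comp Primrec.fst)

theorem primrecPred_upperCert (hS : Primrec S) (hT : Primrec T) (hn : Primrec n)
    (hM : Primrec M) (hΦ : Primrec Φ) (he : Primrec e) (hs : Primrec s) (hN : Primrec N)
    (hw : Primrec w) (hl : Primrec l) :
    PrimrecPred fun a => UpperCert (substOf (S a)) (letterOf (T a)) (n a) (mulOf (M a))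
      (letterOf (Φ a)) (e a) (s a) (N a) (w a) (l a) := by
  have hv := primrec_img hS hT hN hs
  have h1 : Primrec fun p : (α × ℕ) × ℕ => p.1.1 := Primrec.fst.comp Primrec.fst
  have h2 : Primrec fun p : (α × ℕ) × ℕ => p.1.2 := Primrec.snd.comp Primrec.fst
  refine (Primrec.eq.comp (primrec_mulOf hM he he) he).and
    ((primrecPred_pairClosed hS hs).and (.and ?_ (.and ?_ ?_)))
  · exact primrecPred_forall_lt hn <| primrecPred_infix (hw.comp Primrec.fst)
      (primrec_img (hS.comp Primrec.fst) (hT.comp Primrec.fst) (hN.comp Primrec.fst)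
        (Primrec.list_cons.comp Primrec.snd (Primrec.const [])))
  · refine primrecPred_forall_lt (Primrec.succ.comp (Primrec.list_length.comp hv)) <|
      primrecPred_forall_lt (Primrec.succ.comp Primrec.snd) <|
        primrecPred_imp (primrecPred_prefix (hw.comp h1)
          (Primrec.list_drop.comp Primrec.snd (hv.comp h1))) <|
        primrecPred_imp (primrecPred_prefix (hw.comp h1)
          (Primrec.list_drop.comp h2 (hv.comp h1))) <|
        primrecPred_mem (primrec_wordNum (hM.comp h1) (hΦ.comp h1) (he.comp h1)
          (Primrec.list_take.comp (Primrec.nat_sub.comp h2 Primrec.snd)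
            (Primrec.list_drop.comp Primrec.snd (hv.comp h1)))) (hl.comp h1)
  · exact primrecPred_forall_mem hl <| primrecPred_forall_mem (hl.comp Primrec.fst) <|
      primrecPred_mem (primrec_mulOf (hM.comp h1) h2 Primrec.snd) (hl.comp h1)

theorem primrecPred_presentationCert (hS : Primrec S) (hT : Primrec T)
    (hM : Primrec M) (hΦ : Primrec Φ) (he : Primrec e) (hs : Primrec s) (hJ : Primrec J)
    (hN : Primrec N) (hk : Primrec k) (hy : Primrec y) (hC : Primrec C) (hR : Primrec R) :
    PrimrecPred fun a => PresentationCert (substOf (S a)) (letterOf (T a)) (mulOf (M a))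
      (letterOf (Φ a)) (e a) (s a) (J a) (N a) (k a) (y a) (C a) (R a) := by
  have hC2 : Primrec fun a => (C a).map Prod.snd :=
    Primrec.list_map hC (Primrec.snd.comp Primrec.snd).to₂
  have hRl := Primrec.list_length.comp hR
  refine .and ?_ (.and ?_ (.and ?_ (.and ?_ ?_)))
  · have h1 : Primrec fun p : α × List ℕ × List ℕ × List ℕ => p.1 := Primrec.fst
    have hc1 : Primrec fun p : α × List ℕ × List ℕ × List ℕ => p.2.1 :=
      Primrec.fst.comp Primrec.snd
    have hc2 : Primrec fun p : α × List ℕ × List ℕ × List ℕ => p.2.2.1 :=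
      Primrec.fst.comp (Primrec.snd.comp Primrec.snd)
    have hc3 : Primrec fun p : α × List ℕ × List ℕ × List ℕ => p.2.2.2 :=
      Primrec.snd.comp (Primrec.snd.comp Primrec.snd)
    refine primrecPred_forall_mem hC (.and ?_ (.and ?_ ?_))
    · exact Primrec.eq.comp (primrec_iter (hS.comp h1) (hJ.comp h1) hc1)
        (primrec_flatMap_tabFst (hC.comp h1) hc2)
    · exact Primrec.eq.comp (primrec_flatMap_tabSnd (hR.comp h1) hc3)
        (primrec_flatMap_tabSnd (hC2.comp h1) hc2)
    · exact Primrec.eq.comp (primrec_flatMap_tabFst (hR.comp h1) hc3)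
        (primrec_img (hS.comp h1) (hT.comp h1) (hN.comp h1) hc1)
  · exact primrecPred_infix (primrec_flatMap_tabFst hC hy) hs
  · have h1 : Primrec fun p : (α × ℕ) × ℕ => p.1.1 := Primrec.fst.comp Primrec.fst
    refine primrecPred_forall_lt hRl <| primrecPred_exists_lt (hRl.comp Primrec.fst) <|
      primrecPred_infix (Primrec.list_cons.comp (Primrec.snd.comp Primrec.fst)
        (Primrec.list_cons.comp Primrec.snd (Primrec.const []))) ?_
    exact (primrec_flatMap_tabSnd hC2 hy).comp h1
  · exact Primrec.nat_lt.comp hk hRl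
  · have h1 : Primrec fun p : α × List ℕ × List ℕ => p.1 := Primrec.fst
    have hr1 : Primrec fun p : α × List ℕ × List ℕ => p.2.1 := Primrec.fst.comp Primrec.snd
    have hr2 : Primrec fun p : α × List ℕ × List ℕ => p.2.2 := Primrec.snd.comp Primrec.snd
    refine primrecPred_forall_mem hR (.and ?_ (.and ?_ (.and ?_ (.and ?_ ?_))))
    · exact (Primrec.eq.comp hr1 (Primrec.const [])).not
    · exact Primrec.eq.comp (Primrec.list_head?.comp hr2) (Primrec.option_some.comp (hk.comp h1))
    · exact Primrec.nat_le.comp (Primrec.const 2) (Primrec.list_length.comp hr2)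
    · exact primrecPred_forall_mem hr2 <|
        Primrec.nat_lt.comp Primrec.snd ((hRl.comp h1).comp Primrec.fst)
    · exact Primrec.eq.comp (primrec_wordNum (hM.comp h1) (hΦ.comp h1) (he.comp h1)
        (primrec_flatMap_tabFst (hR.comp h1) hr2))
        (primrec_wordNum (hM.comp h1) (hΦ.comp h1) (he.comp h1) hr1)

theorem primrecPred_periodicCert (hS : Primrec S) (hT : Primrec T) (hs : Primrec s)
    (hN : Primrec N) (hw : Primrec w) (hR : Primrec R) :
    PrimrecPred fun a => PeriodicCert (substOf (S a)) (letterOf (T a)) (s a) (N a) (w a)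
      (R a) := by
  have hv := primrec_img hS hT hN hs
  have hvl := Primrec.list_length.comp hv
  have hsum : Primrec fun p : α × ℕ => p.2 + (w p.1).length :=
    Primrec.nat_add.comp Primrec.snd ((Primrec.list_length.comp hw).comp Primrec.fst)
  refine .and ?_ ?_
  · exact primrecPred_forall_mem hR <| Primrec.eq.comp (Primrec.fst.comp Primrec.snd)
      (hw.comp Primrec.fst)
  · exact primrecPred_forall_lt hvl <| primrecPred_imp
      (Primrec.nat_lt.comp hsum (hvl.comp Primrec.fst))
      (Primrec.eq.comp (Primrec.list_getElem?.comp (hv.comp Primrec.fst) Primrec.snd)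
        (Primrec.list_getElem?.comp (hv.comp Primrec.fst) hsum))

end Primrec

/-! ### The algorithms -/

/-- The data `(i, e, N), (w, E), (J, N', z, y), C, R` of a certificate. -/
abbrev Cert : Type :=
  (ℕ × ℕ × ℕ) × (List ℕ × List (List ℕ)) × (ℕ × ℕ × ℕ × List ℕ) ×
    List (List ℕ × List ℕ × List ℕ) × List (List ℕ × List ℕ)

/-- The word `σ ^ i (0)` of a certificate. -/
def certWord (a : Code × Cert) : List ℕ :=
  iter (substOf a.1.1) a.2.1.1 [0]

/-- The list of elements of a certificate. -/
def certElems (a : Code × Cert) : List ℕ :=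
  elems (mulOf a.1.2.2.1) (letterOf a.1.2.2.2) a.2.1.2.1 a.2.2.1.2 a.2.2.2.2.2

/-- Whether the elements of a certificate contain the values of all letters. -/
def CertStable (a : Code × Cert) : Prop :=
  ∀ x ∈ img (substOf a.1.1) (letterOf a.1.2.1) a.2.1.2.2 (certWord a),
    letterOf a.1.2.2.2 x ∈ certElems a

/-- The validity of a certificate. -/
def CertValid (a : Code × Cert) : Prop :=
  a.2.1.2.1 < a.1.2.2.1.length ∧
  UpperCert (substOf a.1.1) (letterOf a.1.2.1) a.1.1.length (mulOf a.1.2.2.1)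
    (letterOf a.1.2.2.2) a.2.1.2.1 (certWord a) a.2.1.2.2 a.2.2.1.1 (certElems a) ∧
  (PresentationCert (substOf a.1.1) (letterOf a.1.2.1) (mulOf a.1.2.2.1)
      (letterOf a.1.2.2.2) a.2.1.2.1 (certWord a) a.2.2.2.1.1 a.2.2.2.1.2.1 a.2.2.2.1.2.2.1
      a.2.2.2.1.2.2.2 a.2.2.2.2.1 a.2.2.2.2.2 ∨
    PeriodicCert (substOf a.1.1) (letterOf a.1.2.1) (certWord a) a.2.1.2.2 a.2.2.1.1
      a.2.2.2.2.2)

section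

open Primrec

theorem primrec_certWord : Primrec certWord :=
  primrec_iter (fst.comp fst) (fst.comp (fst.comp snd)) (Primrec.const [0])

theorem primrec_certElems : Primrec certElems :=
  primrec_elems (fst.comp (snd.comp (snd.comp fst))) (snd.comp (snd.comp (snd.comp fst)))
    (fst.comp (snd.comp (fst.comp snd))) (snd.comp (fst.comp (snd.comp snd)))
    (snd.comp (snd.comp (snd.comp (snd.comp snd))))

theorem primrecPred_certStable : PrimrecPred CertStable :=
  primrecPred_forall_mem
    (primrec_img (fst.comp fst) (fst.comp (snd.comp fst)) (snd.comp (snd.comp (fst.comp snd)))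
      primrec_certWord) <|
    primrecPred_mem (primrec_letterOf ((snd.comp (snd.comp (snd.comp fst))).comp fst) snd)
      (primrec_certElems.comp fst)

theorem primrecPred_certValid : PrimrecPred CertValid := by
  have hS : Primrec fun a : Code × Cert => a.1.1 := fst.comp fst
  have hT : Primrec fun a : Code × Cert => a.1.2.1 := fst.comp (snd.comp fst)
  have hM : Primrec fun a : Code × Cert => a.1.2.2.1 := fst.comp (snd.comp (snd.comp fst))
  have hΦ : Primrec fun a : Code × Cert => a.1.2.2.2 := snd.comp (snd.comp (snd.comp fst))
  have he : Primrec fun a : Code × Cert => a.2.1.2.1 := fst.comp (snd.comp (fst.comp snd))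
  have hN : Primrec fun a : Code × Cert => a.2.1.2.2 := snd.comp (snd.comp (fst.comp snd))
  have hw : Primrec fun a : Code × Cert => a.2.2.1.1 := fst.comp (fst.comp (snd.comp snd))
  have hp : Primrec fun a : Code × Cert => a.2.2.2.1 := fst.comp (snd.comp (snd.comp snd))
  have hq : Primrec fun a : Code × Cert => a.2.2.2.2 := snd.comp (snd.comp (snd.comp snd))
  exact (nat_lt.comp he (list_length.comp hM)).and
    ((primrecPred_upperCert hS hT (list_length.comp hS) hM hΦ he primrec_certWord hN hw
      primrec_certElems).and
    ((primrecPred_presentationCert hS hT hM hΦ he primrec_certWord (fst.comp hp)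
      (fst.comp (snd.comp hp)) (fst.comp (snd.comp (snd.comp hp)))
      (snd.comp (snd.comp (snd.comp hp))) (fst.comp hq) (snd.comp hq)).or
    (primrecPred_periodicCert hS hT primrec_certWord hN hw (snd.comp hq))))

/-- Unbounded search for a valid certificate. -/
theorem exists_partrec_of_certValid {δ : Type} [Primcodable δ] {out : Code × Cert → δ}
    (hout : Primrec out) :
    ∃ f : Code →. δ, Partrec f ∧ ∀ code, (∃ c, CertValid (code, c)) →
      ∃ o ∈ f code, ∃ c, CertValid (code, c) ∧ o = out (code, c) := by
  classical
  let F : Code → ℕ → Option δ := fun code k => (Encodable.decode (α := Cert) k).bind fun c =>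
    if CertValid (code, c) then some (out (code, c)) else none
  have hF : Primrec₂ F := by
    have hpair : Primrec fun q : (Code × ℕ) × Cert => (q.1.1, q.2) :=
      (fst.comp fst).pair snd
    exact Primrec.option_bind (Primrec.decode.comp snd)
      (Primrec.ite (primrecPred_certValid.comp hpair) (option_some.comp (hout.comp hpair))
        (Primrec.const none)).to₂
  -- All natural numbers are tried as encodings of certificates until one decodes to a valid one.
  refine ⟨fun code => Nat.rfindOpt (F code), Partrec.rfindOpt hF.to_comp, fun code hc => ?_⟩
  obtain ⟨c, hc⟩ := hc
  have hdom : (Nat.rfindOpt (F code)).Dom :=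
    Nat.rfindOpt_dom.2 ⟨Encodable.encode c, out (code, c), by
      simp only [F, Encodable.encodek, Option.bind_some, if_pos hc, Option.mem_def]⟩
  obtain ⟨k, hk⟩ := Nat.rfindOpt_spec ⟨hdom, rfl⟩
  refine ⟨_, ⟨hdom, rfl⟩, ?_⟩
  obtain ⟨c, -, hc⟩ := Option.bind_eq_some_iff.1 hk
  split_ifs at hc with hv
  exact ⟨c, hv, (Option.some.inj hc).symm⟩

end

/-- Existence makes the search halt; correctness is needed for every valid certificate, since there
is no control over which one the search meets first. -/
theorem encodeInput_spec {A B G : Type*} [Group G] {m n N : ℕ}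
    (eA : A ≃ Fin m) (eB : B ≃ Fin n) (eG : G ≃ Fin N)
    (σ : B → List B) (τ : B → A) (φ : FreeGroup A →* G) (X : Set (ℤ → A))
    (hσ : IsPrimitive σ) (hX : IsGeneratedBy X σ τ) :
    (∃ c, CertValid (encodeInput eA eB eG σ τ φ, c)) ∧
    ∀ c, CertValid (encodeInput eA eB eG σ τ φ, c) →
      ∃ H : Subgroup G, (∀ k : ℕ, k ∈ certElems (encodeInput eA eB eG σ τ φ, c) ↔
          ∃ h ∈ H, (eG h : ℕ) = k) ∧
        StabilizesOver φ X H ∧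
        (CertStable (encodeInput eA eB eG σ τ φ, c) ↔ HasStableReturnGroups φ X) := by
  have : Finite G := Finite.of_equiv _ eG.symm
  obtain ⟨S, T, M, Φ, hcode⟩ : ∃ S T M Φ, encodeInput eA eB eG σ τ φ = (S, T, M, Φ) :=
    ⟨_, _, _, _, rfl⟩
  have hS : S = List.ofFn fun i : Fin n => (σ (eB.symm i)).map fun b => (eB b : ℕ) :=
    (congrArg (fun c : Code => c.1) hcode).symm
  have hT : T = List.ofFn fun i : Fin n => (eA (τ (eB.symm i)) : ℕ) :=
    (congrArg (fun c : Code => c.2.1) hcode).symm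
  have hM : M = List.ofFn fun i : Fin N => List.ofFn fun j : Fin N =>
      (eG (eG.symm i * eG.symm j) : ℕ) :=
    (congrArg (fun c : Code => c.2.2.1) hcode).symm
  have hΦ : Φ = List.ofFn fun i : Fin m => (eG (φ (FreeGroup.of (eA.symm i))) : ℕ) :=
    (congrArg (fun c : Code => c.2.2.2) hcode).symm
  have hSn : S.length = n := by simp [hS]
  have hMN : M.length = N := by simp [hM]
  have hsub : ∀ b, substOf S (eB b) = (σ b).map fun b => (eB b : ℕ) := by
    intro b; simp [substOf, hS]
  have hlet : ∀ b, letterOf T (eB b) = eA (τ b) := by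
    intro b; simp [letterOf, hT]
  have hmul : ∀ x y : G, mulOf M (eG x) (eG y) = (eG (x * y) : ℕ) := by
    intro x y; simp [mulOf, hM]
  have hΦA : ∀ a, letterOf Φ (eA a) = (eG (φ (FreeGroup.of a)) : ℕ) := by
    intro a; simp [letterOf, hΦ]
  have hΦN : ∀ a, letterOf Φ a < N := by
    intro a
    rcases lt_or_ge a m with ha | ha
    · have := hΦA (eA.symm ⟨a, ha⟩)
      simp only [Equiv.apply_symm_apply] at this
      rw [this]; exact (eG _).2
    · rw [letterOf, List.getD_eq_default _ _ (by simpa [hΦ] using ha)]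
      -- Numbers that encode no letter get the default value 0, which is the number of a group
      -- element since `G` is nonempty; so `g` can be defined on all of `ℕ`.
      exact Nat.zero_lt_of_lt (eG 1).2
  obtain ⟨g, hg⟩ : ∃ g : ℕ → G, ∀ a, (eG (g a) : ℕ) = letterOf Φ a :=
    ⟨fun a => eG.symm ⟨_, hΦN a⟩, fun a => by simp⟩
  have hι : Function.Injective fun x : G => (eG x : ℕ) := fun x y h => eG.injective (Fin.ext h)
  have hgA : ∀ a, g (eA a) = φ (FreeGroup.of a) := fun a => hι (by
    simp only [hg, hΦA])
  have hf : Function.Injective fun a : A => (eA a : ℕ) := fun a b h => eA.injective (Fin.ext h)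
  obtain ⟨hprim, hlang⟩ := langMor_eq_of_isGeneratedBy (eA := eA) (eB := eB) hsub hlet hσ hX
  obtain ⟨c₁, hc₁, -⟩ := hprim.start
  have h0 : 0 < n := by omega
  have hL : IsRecurrentLang (List.map (fun a => (eA a : ℕ)) '' lang X) :=
    hlang ▸ hprim.isRecurrentLang_langMor
  rw [hcode]
  constructor
  · obtain ⟨i, E, N₁, w, R, J, N', z, y, C, h1, h2⟩ :=
      exists_cert (τ := letterOf T) (ι := fun x => (eG x : ℕ)) hmul hg hprim
    refine ⟨((i, eG 1, N₁), (w, E), (J, N', z, y), C, R), ?_, ?_, h2⟩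
    · rw [hMN]; exact (eG 1).2
    · simp only [hSn]; exact h1
  · rintro c ⟨hc1, hc2, hc3⟩
    simp only [hSn, hMN] at hc1 hc2 hc3
    obtain ⟨hw, hmin, hK, hmem⟩ := exists_subgroup_of_cert (g := g)
      (ι := fun x => (eG x : ℕ)) hι hmul hg ⟨eG.symm ⟨_, hc1⟩, by simp⟩ hprim
      (IsPrimSubst.iter_mem (IsPrimSubst.singleton_mem h0) _)
      (hprim.iter_singleton_ne_nil h0 _) hc2 hc3
    rw [hlang] at hw hmin hK hmem
    refine ⟨_, hK, stabilizesOver_of_card_minimal hf hgA hL hw hmin, ?_⟩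
    have hne : (lang X).Nonempty := by
      obtain ⟨u, hu, -⟩ := hw
      exact ⟨u, hu⟩
    rw [hasStableReturnGroups_iff hf hgA hL hne, stable_iff_of_card_minimal hL hw hmin]
    refine forall_congr' fun a => ?_
    have h1 : letterOf Φ a ∈ certElems ((S, T, M, Φ), c) ↔
        g a ∈ retImage g (List.map (fun a => (eA a : ℕ)) '' lang X) c.2.1.1 := by
      refine (hK _).trans ⟨?_, fun h => ⟨g a, h, hg a⟩⟩
      rintro ⟨x, hx, hxa⟩
      rw [← hg] at hxa
      exact hι hxa ▸ hx
    exact imp_congr (hmem a) h1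

end ReturnGroups

/-- Algorithms are partial recursive functions on codes; on every input satisfying the
hypotheses they halt with a correct answer. A subgroup is output as the list of (the numbers
of) its elements. -/
theorem proposition4p4 :
    (∃ f : ReturnGroups.Code →. List ℕ, Partrec f ∧
      ∀ (A : Type*) (B : Type*) (G : Type*) [Group G] (m n N : ℕ)
        (eA : A ≃ Fin m) (eB : B ≃ Fin n) (eG : G ≃ Fin N)
        (σ : B → List B) (τ : B → A) (φ : FreeGroup A →* G) (X : Set (ℤ → A)),
        ReturnGroups.IsPrimitive σ → ReturnGroups.IsGeneratedBy X σ τ →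
        Function.Surjective φ →
        ∃ l ∈ f (ReturnGroups.encodeInput eA eB eG σ τ φ), ∃ H : Subgroup G,
          (∀ k : ℕ, k ∈ l ↔ ∃ h ∈ H, (eG h : ℕ) = k) ∧
          ReturnGroups.StabilizesOver φ X H) ∧
    (∃ d : ReturnGroups.Code →. Bool, Partrec d ∧
      ∀ (A : Type*) (B : Type*) (G : Type*) [Group G] (m n N : ℕ)
        (eA : A ≃ Fin m) (eB : B ≃ Fin n) (eG : G ≃ Fin N)
        (σ : B → List B) (τ : B → A) (φ : FreeGroup A →* G) (X : Set (ℤ → A)),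
        ReturnGroups.IsPrimitive σ → ReturnGroups.IsGeneratedBy X σ τ →
        Function.Surjective φ →
        ∃ b ∈ d (ReturnGroups.encodeInput eA eB eG σ τ φ),
          (b = true ↔ ReturnGroups.HasStableReturnGroups φ X)) := by
  classical
  constructor
  · obtain ⟨f, hf, h⟩ :=
      ReturnGroups.exists_partrec_of_certValid ReturnGroups.primrec_certElems
    refine ⟨f, hf, fun A B G _ m n N eA eB eG σ τ φ X hσ hX _ => ?_⟩
    obtain ⟨h1, h2⟩ := ReturnGroups.encodeInput_spec eA eB eG σ τ φ X hσ hX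
    obtain ⟨o, ho, c, hc, rfl⟩ := h _ h1
    obtain ⟨H, hH, hst, -⟩ := h2 c hc
    exact ⟨_, ho, H, hH, hst⟩
  · obtain ⟨f, hf, h⟩ := ReturnGroups.exists_partrec_of_certValid
      (out := fun a => decide (ReturnGroups.CertStable a))
      ReturnGroups.primrecPred_certStable.decide
    refine ⟨f, hf, fun A B G _ m n N eA eB eG σ τ φ X hσ hX _ => ?_⟩
    obtain ⟨h1, h2⟩ := ReturnGroups.encodeInput_spec eA eB eG σ τ φ X hσ hX
    obtain ⟨o, ho, c, hc, rfl⟩ := h _ h1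
    obtain ⟨H, -, -, hst⟩ := h2 c hc
    exact ⟨_, ho, by simpa using hst⟩
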